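/- A set $C\subset\mathbb C^2$ is a representative set of a curve-germ if there are a function $f$, holomorphic in a neighbourhood of the origin of $\mathbb C^2$, with $f(0)=0$ and $f$ not identically zero on any neighbourhood of $0$, and a neighbourhood $U$ of $0$ such that $C\cap U=f^{-1}(0)\cap U$. For $\epsilon>0$ let $$D_\epsilon=\{(z,w)\in\mathbb C^2: |z|^2+|w|^2\le\epsilon^2\},\qquad S_\epsilon=\{(z,w)\in\mathbb C^2: |z|^2+|w|^2=\epsilon^2\}.$$ The cone on a space $X$ is the quotient space $\mathcal C(X)=(X\times[0,\epsilon])/(X\times\{\epsilon\})$, and the cone on a pair $(X,K)$ with $K\subset X$ is the pair $(\mathcal C(X),\mathcal C(K))$, where $\mathcal C(K)$ is the image of $K\times[0,\epsilon]$ in $\mathcal C(X)$. The cone $\mathcal C(S_\epsilon)$ is oriented so that the radial homeomorphism $\mathcal C(S_\epsilon)\to D_\epsilon$, $[x,t]\mapsto(1-t/\epsilon)\,x$, preserves orientation, where $D_\epsilon$ has the orientation of $\mathbb C^2$. A self-homeomorphism of $D_\epsilon$ preserves orientation if its local degree at every interior point is $1$. **Theorem.** Let $C\subset\mathbb C^2$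 be a representative set of a curve-germ. Then there exists $\epsilon_0>0$ such that, for every $0<\epsilon<\epsilon_0$: 1. $C\cap S_\epsilon$, with the subspace topology, is a $1$-dimensional real manifold smoothly embedded in $S_\epsilon$; 2. there is an orientation-preserving homeomorphism of pairs from $(D_\epsilon, C\cap D_\epsilon)$ to the cone on $(S_\epsilon, C\cap S_\epsilon)$, that is, an orientation-preserving homeomorphism $\Phi:D_\epsilon\to\mathcal C(S_\epsilon)$ with $\Phi(C\cap D_\epsilon)=\mathcal C(C\cap S_\epsilon)$. -/

import Mathlib

open Topology Metric
open scoped Manifold ContDiff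

noncomputable section

namespace PlaneCurve

/-- The space `ℂ²`, with `‖(z, w)‖² = |z|² + |w|²`.  Thus `sphere (0 : C2) ε` is
`{|z|² + |w|² = ε²}` and `closedBall (0 : C2) ε` is `{|z|² + |w|² ≤ ε²}`. -/
abbrev C2 : Type := EuclideanSpace ℂ (Fin 2)

theorem finrank_real_C2 : Module.finrank ℝ C2 = 3 + 1 := by
  have h := Module.finrank_mul_finrank ℝ ℂ C2
  rw [Complex.finrank_real_complex, finrank_euclideanSpace_fin] at h
  omega

/-- `ℂ²` has real dimension `4`; this gives the unit sphere of `ℂ²` its standard structure of a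
smooth `3`-manifold. -/
instance : Fact (Module.finrank ℝ C2 = 3 + 1) := ⟨finrank_real_C2⟩

/-- `C` is a representative set of the germ at the origin of a plane curve: near the origin, `C`
coincides with the zero set of a function `f` which is holomorphic at the origin, vanishes at
the origin, and whose germ at the origin is not zero. -/
def IsCurveRepresentative (C : Set C2) : Prop :=
  ∃ f : C2 → ℂ, AnalyticAt ℂ f 0 ∧ f 0 = 0 ∧ (¬ ∀ᶠ x in 𝓝 0, f x = 0) ∧
    ∃ U ∈ 𝓝 (0 : C2), C ∩ U = f ⁻¹' {0} ∩ U

/-! ### Smoothly embedded 1-manifolds in the sphere of radius `ε` -/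

/-- The homothety `p ↦ ε⁻¹ p` from the sphere of radius `ε` onto the unit sphere. -/
def toUnitSphere {ε : ℝ} (hε : 0 < ε) (p : sphere (0 : C2) ε) : sphere (0 : C2) 1 :=
  ⟨ε⁻¹ • (p : C2), by
    have hp : ‖(p : C2)‖ = ε := mem_sphere_zero_iff_norm.mp p.2
    rw [mem_sphere_zero_iff_norm, norm_smul, norm_inv, Real.norm_of_nonneg hε.le, hp,
      inv_mul_cancel₀ hε.ne']⟩

/-- The subset `K` of the sphere of radius `ε`, with the subspace topology, carries the structure
of a smooth real manifold of dimension `1` for which its inclusion into the sphere is a smooth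
embedding.  The smooth structure on the sphere of radius `ε` is that of the unit sphere,
transported by the homothety. -/
def IsSmoothlyEmbeddedOneManifold {ε : ℝ} (hε : 0 < ε) (K : Set (sphere (0 : C2) ε)) : Prop :=
  ∃ (_ : ChartedSpace (EuclideanSpace ℝ (Fin 1)) K) (_ : IsManifold (𝓡 1) ∞ K),
    Manifold.IsSmoothEmbedding (𝓡 1) (𝓡 3) ∞ (fun p : K => toUnitSphere hε (p : sphere (0 : C2) ε))

/-! ### Cones -/

/-- The equivalence relation on `X × [0, ε]` that collapses `X × {ε}`. -/
def coneSetoid (X : Type) (ε : ℝ) : Setoid (X × Set.Icc (0 : ℝ) ε) where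
  r p q := p = q ∨ ((p.2 : ℝ) = ε ∧ (q.2 : ℝ) = ε)
  iseqv :=
    { refl := fun _ => Or.inl rfl
      symm := by
        rintro p q (h | h)
        · exact Or.inl h.symm
        · exact Or.inr h.symm
      trans := by
        rintro p q r (rfl | h) (rfl | h')
        · exact Or.inl rfl
        · exact Or.inr h'
        · exact Or.inr h
        · exact Or.inr ⟨h.1, h'.2⟩ }

/-- The cone on `X`: the topological quotient of `X × [0, ε]` by `X × {ε}`. -/
def Cone (X : Type) (ε : ℝ) : Type := Quotient (coneSetoid X ε)

instance (X : Type) [TopologicalSpace X] (ε : ℝ) : TopologicalSpace (Cone X ε) :=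
  inferInstanceAs (TopologicalSpace (Quotient (coneSetoid X ε)))

/-- The point `[x, t]` of the cone. -/
def Cone.mk {X : Type} {ε : ℝ} (p : X × Set.Icc (0 : ℝ) ε) : Cone X ε :=
  Quotient.mk (coneSetoid X ε) p

/-- The cone on a subset `K` of `X`, as a subset of the cone on `X`. -/
def subCone {X : Type} (ε : ℝ) (K : Set X) : Set (Cone X ε) :=
  Cone.mk '' (K ×ˢ Set.univ)

instance (X : Type) [TopologicalSpace X] [CompactSpace X] (ε : ℝ) : CompactSpace (Cone X ε) :=
  inferInstanceAs (CompactSpace (Quotient (coneSetoid X ε)))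

/-- The radial map `[x, t] ↦ (1 - t / ε) x` from the cone on the sphere to the ball. -/
def coneToBall {ε : ℝ} (hε : 0 < ε) : Cone (sphere (0 : C2) ε) ε → closedBall (0 : C2) ε :=
  Quotient.lift (s := coneSetoid (sphere (0 : C2) ε) ε)
    (fun p => ⟨(1 - (p.2 : ℝ) / ε) • (p.1 : C2), by
      have hp : ‖(p.1 : C2)‖ = ε := mem_sphere_zero_iff_norm.mp p.1.2
      have h0 : 0 ≤ (p.2 : ℝ) / ε := div_nonneg p.2.2.1 hε.le
      have h1 : (p.2 : ℝ) / ε ≤ 1 := (div_le_one hε).2 p.2.2.2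
      rw [mem_closedBall_zero_iff, norm_smul, Real.norm_of_nonneg (by linarith), hp]
      nlinarith⟩)
    (by
      rintro p q (rfl | ⟨h, h'⟩)
      · rfl
      · simp [h, h', div_self hε.ne'])

theorem continuous_coneToBall {ε : ℝ} (hε : 0 < ε) : Continuous (coneToBall hε) := by
  refine Continuous.quotient_lift (Continuous.subtype_mk ?_ _) _
  fun_prop

theorem norm_coneToBall_mk {ε : ℝ} (hε : 0 < ε) (p : sphere (0 : C2) ε × Set.Icc (0 : ℝ) ε) :
    ‖((coneToBall hε (Cone.mk p) : closedBall (0 : C2) ε) : C2)‖ = ε - p.2 := by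
  have hp : ‖(p.1 : C2)‖ = ε := mem_sphere_zero_iff_norm.mp p.1.2
  have h1 : (p.2 : ℝ) / ε ≤ 1 := (div_le_one hε).2 p.2.2.2
  change ‖(1 - (p.2 : ℝ) / ε) • (p.1 : C2)‖ = _
  rw [norm_smul, Real.norm_of_nonneg (by linarith), hp]
  field_simp

theorem bijective_coneToBall {ε : ℝ} (hε : 0 < ε) : Function.Bijective (coneToBall hε) := by
  constructor
  · intro a b
    refine Quotient.inductionOn₂ a b (fun p q h => ?_)
    change coneToBall hε (Cone.mk p) = coneToBall hε (Cone.mk q) at h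
    have ht : (p.2 : ℝ) = q.2 := by
      have h2 := norm_coneToBall_mk hε p
      rw [h, norm_coneToBall_mk hε q] at h2
      linarith
    refine Quotient.sound ?_
    change p = q ∨ ((p.2 : ℝ) = ε ∧ (q.2 : ℝ) = ε)
    by_cases hp : (p.2 : ℝ) = ε
    · exact Or.inr ⟨hp, ht ▸ hp⟩
    · left
      have hv : (1 - (p.2 : ℝ) / ε) • (p.1 : C2) = (1 - (q.2 : ℝ) / ε) • (q.1 : C2) :=
        congrArg Subtype.val h
      rw [← ht] at hv
      have hne : (1 - (p.2 : ℝ) / ε) ≠ 0 := by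
        intro h0
        apply hp
        field_simp at h0
        linarith
      exact Prod.ext (Subtype.ext (smul_right_injective C2 hne hv)) (Subtype.ext ht)
  · rintro ⟨y, hy⟩
    rw [mem_closedBall_zero_iff] at hy
    by_cases h0 : y = 0
    · obtain ⟨x, hx⟩ := NormedSpace.sphere_nonempty (E := C2) (x := 0) (r := ε) |>.2 hε.le
      refine ⟨Cone.mk (⟨x, hx⟩, ⟨ε, hε.le, le_rfl⟩), Subtype.ext ?_⟩
      change (1 - ε / ε) • x = y
      simp [h0, div_self hε.ne']
    · have hn : 0 < ‖y‖ := norm_pos_iff.2 h0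
      refine ⟨Cone.mk (⟨(ε / ‖y‖) • y, ?_⟩, ⟨ε - ‖y‖, by linarith, by linarith⟩), Subtype.ext ?_⟩
      · rw [mem_sphere_zero_iff_norm, norm_smul, Real.norm_of_nonneg (by positivity)]
        field_simp
      · change (1 - (ε - ‖y‖) / ε) • (ε / ‖y‖) • y = y
        rw [smul_smul]
        have : (1 - (ε - ‖y‖) / ε) * (ε / ‖y‖) = 1 := by
          field_simp
          ring
        rw [this, one_smul]

/-- The radial homeomorphism from the cone on the sphere of radius `ε` onto the closed ball of
radius `ε`. -/
def coneHomeoBall {ε : ℝ} (hε : 0 < ε) :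
    Cone (sphere (0 : C2) ε) ε ≃ₜ closedBall (0 : C2) ε :=
  (continuous_coneToBall hε).homeoOfEquivCompactToT2
    (f := Equiv.ofBijective (coneToBall hε) (bijective_coneToBall hε))

/-! ### Orientations -/

/-- A continuous self-map of the unit 3-sphere of `ℂ²` has degree one: it induces the identity on
the third singular homology group with integer coefficients. -/
def HasDegreeOne (g : C(sphere (0 : C2) 1, sphere (0 : C2) 1)) : Prop :=
  ((AlgebraicTopology.singularHomologyFunctor (ModuleCat.{0} ℤ) 3).obj (ModuleCat.of ℤ ℤ)).map
      (TopCat.ofHom g) =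
    CategoryTheory.CategoryStruct.id _

/-- The point `x + δ u` of the ball, when the closed ball of centre `x` and radius `δ` lies in it
and `u` is a unit vector. -/
def nearPoint {ε δ : ℝ} (hδ : 0 < δ) {x : C2} (hx : closedBall x δ ⊆ closedBall (0 : C2) ε)
    (u : sphere (0 : C2) 1) : closedBall (0 : C2) ε :=
  ⟨x + δ • (u : C2), hx (by
    have hu : ‖(u : C2)‖ = 1 := mem_sphere_zero_iff_norm.mp u.2
    rw [mem_closedBall_iff_norm, add_sub_cancel_left, norm_smul, hu, Real.norm_of_nonneg hδ.le,
      mul_one])⟩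

/-- The centre `x` as a point of the ball. -/
def centrePoint {ε δ : ℝ} (hδ : 0 < δ) {x : C2} (hx : closedBall x δ ⊆ closedBall (0 : C2) ε) :
    closedBall (0 : C2) ε :=
  ⟨x, hx (mem_closedBall_self hδ.le)⟩

theorem sub_ne_zero_of_homeo {ε δ : ℝ} (hδ : 0 < δ) {x : C2}
    (hx : closedBall x δ ⊆ closedBall (0 : C2) ε)
    (h : closedBall (0 : C2) ε ≃ₜ closedBall (0 : C2) ε) (u : sphere (0 : C2) 1) :
    (h (nearPoint hδ hx u) : C2) - h (centrePoint hδ hx) ≠ 0 := by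
  intro h0
  have h1 : nearPoint hδ hx u = centrePoint hδ hx :=
    h.injective (Subtype.ext (sub_eq_zero.1 h0))
  have h2 : x + δ • (u : C2) = x := congrArg Subtype.val h1
  have hu : ‖(u : C2)‖ = 1 := mem_sphere_zero_iff_norm.mp u.2
  have h3 : δ • (u : C2) = 0 := by simpa using h2
  rcases smul_eq_zero.1 h3 with h4 | h4
  · exact hδ.ne' h4
  · rw [h4, norm_zero] at hu
    exact zero_ne_one hu

/-- The action of a self-homeomorphism `h` of the ball on directions around the interior point `x`:
the self-map `u ↦ (h (x + δ u) - h x) / ‖h (x + δ u) - h x‖` of the unit sphere. -/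
def directionMap {ε δ : ℝ} (hδ : 0 < δ) {x : C2} (hx : closedBall x δ ⊆ closedBall (0 : C2) ε)
    (h : closedBall (0 : C2) ε ≃ₜ closedBall (0 : C2) ε) :
    C(sphere (0 : C2) 1, sphere (0 : C2) 1) where
  toFun u :=
    ⟨‖(h (nearPoint hδ hx u) : C2) - h (centrePoint hδ hx)‖⁻¹ •
        ((h (nearPoint hδ hx u) : C2) - h (centrePoint hδ hx)), by
      have hne := norm_ne_zero_iff.2 (sub_ne_zero_of_homeo hδ hx h u)
      rw [mem_sphere_zero_iff_norm, norm_smul, norm_inv, norm_norm, inv_mul_cancel₀ hne]⟩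
  continuous_toFun := by
    have hnear : Continuous (nearPoint hδ hx) := by
      refine Continuous.subtype_mk ?_ _
      fun_prop
    have hv : Continuous fun u : sphere (0 : C2) 1 =>
        (h (nearPoint hδ hx u) : C2) - h (centrePoint hδ hx) :=
      (continuous_subtype_val.comp (h.continuous.comp hnear)).sub continuous_const
    refine Continuous.subtype_mk ?_ _
    exact (hv.norm.inv₀ fun u => norm_ne_zero_iff.2 (sub_ne_zero_of_homeo hδ hx h u)).smul hv

/-- A self-homeomorphism of the closed ball preserves orientation: its local degree at every
interior point is `1`. -/
def PreservesOrientation {ε : ℝ} (h : closedBall (0 : C2) ε ≃ₜ closedBall (0 : C2) ε) : Prop :=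
  ∀ (x : C2) (δ : ℝ) (hδ : 0 < δ) (hx : closedBall x δ ⊆ closedBall (0 : C2) ε),
    HasDegreeOne (directionMap hδ hx h)

/-- A homeomorphism from the closed ball to the cone on its boundary sphere preserves orientation.
The cone is oriented by the radial homeomorphism onto the ball; equivalently, away from the apex, by
the product orientation of `sphere × [0, ε)`, where the sphere is oriented as the boundary of the
ball. -/
def PreservesOrientationToCone {ε : ℝ} (hε : 0 < ε)
    (Φ : closedBall (0 : C2) ε ≃ₜ Cone (sphere (0 : C2) ε) ε) : Prop :=
  PreservesOrientation (Φ.trans (coneHomeoBall hε))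

end PlaneCurve

end

/-!
A plane curve germ is locally the cone over its link, and the link is a smooth submanifold of the
sphere.

*A good equation.* After a linear change of coordinates the equation `f` of the curve does not
vanish identically on the line `z = 0`. By Puiseux's theorem (`hasBranches_of_hasSliceOrder`), after
the substitution `z = t ^ N` its zero set is a finite union of graphs of functions `ψ`, analytic at
`0`. The product of the factors `w - ψ t`, over the distinct germs `ψ`, depends on `t ^ N` only and
so is an analytic function of `(z, w)` (`exists_reduced_equation`): it is an equation `F` of the
curve with nonzero differential at every zero `x ≠ 0` near the origin. Along a holomorphic arc
`γ t = t ^ k c + ⋯` the product `⟪γ, γ'⟫` is nonzero for small `t ≠ 0`, so the complex tangent line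
of the curve at `x` is not orthogonal to `x`. As `dF` vanishes on this line, it does not vanish on
the complex line orthogonal to `x`, spanned by `perp x`
(`IsCurveRepresentative.exists_transverse_equation`).

*The link.* The vectors `λ • perp x` are tangent to the sphere through `x`. The restriction of `F`
to the sphere is therefore a submersion at its zeros, which gives slice charts for the link
(`IsTransverseEquation.isSmoothlyEmbeddedOneManifold`).

*The conic structure.* The vector field `x ↦ x + tangentialField F x` is smooth off the origin, its
second summand is tangent to the spheres, and the derivative of `F` along it is a multiple of `F`.
Its flow expands the norm by the factor `exp s` and preserves the zero set of `F`. Flowing from the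
sphere of radius `ε` down to the sphere of radius `‖x‖` defines a norm-preserving homeomorphism of
the ball, equal to the identity on the boundary, which carries the radial cone over the link to the
curve (`IsTransverseEquation.exists_homeomorph`).

*Orientation.* A homeomorphism of the ball which is the identity on the boundary is isotopic to the
identity by the Alexander trick. The isotopy makes its action on directions around any interior
point homotopic to the identity, so the local degree is one by homotopy invariance of singular
homology (`preservesOrientation_of_eq_self`).
-/

namespace PlaneCurve

/-! ### Division of an analytic function of two variables by a coordinate -/

/-- The linear map `(z, w) ↦ (z, s w)` of `ℂ × ℂ`. -/
noncomputable def scaleSnd (s : ℝ) : ℂ × ℂ →L[ℂ] ℂ × ℂ :=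
  (ContinuousLinearMap.fst ℂ ℂ ℂ).prod ((s : ℂ) • ContinuousLinearMap.snd ℂ ℂ ℂ)

theorem scaleSnd_apply (s : ℝ) (v : ℂ × ℂ) : scaleSnd s v = (v.1, (s : ℂ) * v.2) := rfl

theorem norm_scaleSnd_apply_le {s : ℝ} (hs : s ∈ Set.Icc (0 : ℝ) 1) (v : ℂ × ℂ) :
    ‖scaleSnd s v‖ ≤ ‖v‖ := by
  rw [scaleSnd_apply, Prod.norm_mk, Prod.norm_def, norm_mul, Complex.norm_real,
    Real.norm_of_nonneg hs.1]
  exact max_le_max le_rfl (mul_le_of_le_one_left (norm_nonneg _) hs.2)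

theorem continuous_scaleSnd_apply : Continuous fun x : ℝ × (ℂ × ℂ) => scaleSnd x.1 x.2 := by
  simp only [scaleSnd_apply]
  fun_prop

theorem continuous_comp_scaleSnd {n : ℕ} (p : ContinuousMultilinearMap ℂ (fun _ : Fin n => ℂ × ℂ) ℂ)
    (v : Fin n → ℂ × ℂ) : Continuous fun s : ℝ => p (fun i => scaleSnd s (v i)) :=
  p.cont.comp (continuous_pi fun i =>
    continuous_scaleSnd_apply.comp (f := fun s : ℝ => (s, v i)) (by fun_prop))

/-- The average over `s ∈ [0, 1]` of the multilinear maps `v ↦ p (scaleSnd s ∘ v)`. -/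
noncomputable def averageMultilinear {n : ℕ}
    (p : ContinuousMultilinearMap ℂ (fun _ : Fin n => ℂ × ℂ) ℂ) :
    ContinuousMultilinearMap ℂ (fun _ : Fin n => ℂ × ℂ) ℂ :=
  MultilinearMap.mkContinuous
    { toFun := fun v => ∫ s in (0 : ℝ)..1, p (fun i => scaleSnd s (v i))
      map_update_add' := by
        intro _ v i x y
        rw [← intervalIntegral.integral_add
          ((continuous_comp_scaleSnd p _).intervalIntegrable _ _)
          ((continuous_comp_scaleSnd p _).intervalIntegrable _ _)]
        congr 1
        funext s
        have := (p.compContinuousLinearMap fun _ => scaleSnd s).map_update_add v i x y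
        simp only [ContinuousMultilinearMap.compContinuousLinearMap_apply] at this
        convert this
      map_update_smul' := by
        intro _ v i c x
        rw [← intervalIntegral.integral_smul]
        congr 1
        funext s
        have := (p.compContinuousLinearMap fun _ => scaleSnd s).map_update_smul v i c x
        simp only [ContinuousMultilinearMap.compContinuousLinearMap_apply] at this
        convert this }
    ‖p‖ (by
      intro v
      have h := intervalIntegral.norm_integral_le_of_norm_le_const (a := (0 : ℝ)) (b := 1)
        (f := fun s => p (fun i => scaleSnd s (v i))) (C := ‖p‖ * ∏ i, ‖v i‖) (by
          intro s hs
          rw [Set.uIoc_of_le zero_le_one] at hs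
          refine (p.le_opNorm _).trans ?_
          gcongr with i
          exact norm_scaleSnd_apply_le ⟨hs.1.le, hs.2⟩ _)
      simpa using h)

theorem norm_averageMultilinear_le {n : ℕ}
    (p : ContinuousMultilinearMap ℂ (fun _ : Fin n => ℂ × ℂ) ℂ) :
    ‖averageMultilinear p‖ ≤ ‖p‖ :=
  MultilinearMap.mkContinuous_norm_le _ (norm_nonneg _) _

theorem averageMultilinear_apply {n : ℕ}
    (p : ContinuousMultilinearMap ℂ (fun _ : Fin n => ℂ × ℂ) ℂ) (v : Fin n → ℂ × ℂ) :
    averageMultilinear p v = ∫ s in (0 : ℝ)..1, p (fun i => scaleSnd s (v i)) := rfl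

/-- The power series of `g` may be averaged term by term. -/
theorem analyticAt_integral_scaleSnd {g : ℂ × ℂ → ℂ} (hg : AnalyticAt ℂ g 0) :
    AnalyticAt ℂ (fun v => ∫ s in (0 : ℝ)..1, g (scaleSnd s v)) 0 := by
  obtain ⟨p, r, hp⟩ := hg
  refine ⟨fun n => averageMultilinear (p n), r, ?_, hp.r_pos, ?_⟩
  · exact hp.r_le.trans (FormalMultilinearSeries.radius_le_of_le
      (fun n => norm_averageMultilinear_le (p n)))
  · intro y hy
    simp only [zero_add, averageMultilinear_apply]
    have hy' : (‖y‖₊ : ENNReal) < r := by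
      rwa [Metric.mem_eball, edist_zero_right, enorm_eq_nnnorm] at hy
    have hrad : (‖y‖₊ : ENNReal) < p.radius := lt_of_lt_of_le hy' hp.r_le
    have hsum : Summable fun n => ‖p n‖ * ‖y‖ ^ n := by
      have h := p.summable_norm_mul_pow (r := ‖y‖₊) hrad
      simpa only [coe_nnnorm] using h
    have hmem : ∀ s ∈ Set.Icc (0 : ℝ) 1, scaleSnd s y ∈ Metric.eball (0 : ℂ × ℂ) r := by
      intro s hs
      have h1 : ‖scaleSnd s y‖₊ ≤ ‖y‖₊ := norm_scaleSnd_apply_le hs y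
      rw [Metric.mem_eball, edist_zero_right, enorm_eq_nnnorm]
      exact lt_of_le_of_lt (ENNReal.coe_le_coe.2 h1) hy'
    refine intervalIntegral.hasSum_integral_of_dominated_convergence
      (fun n _ => ‖p n‖ * ‖y‖ ^ n) (fun n => ?_) (fun n => ?_) ?_ ?_ ?_
    · exact (continuous_comp_scaleSnd (p n) fun _ => y).aestronglyMeasurable
    · refine Filter.Eventually.of_forall fun s hs => ?_
      rw [Set.uIoc_of_le zero_le_one] at hs
      refine ((p n).le_opNorm _).trans ?_
      rw [Finset.prod_const, Finset.card_univ, Fintype.card_fin]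
      gcongr
      exact norm_scaleSnd_apply_le ⟨hs.1.le, hs.2⟩ _
    · exact Filter.Eventually.of_forall fun s _ => hsum
    · exact intervalIntegrable_const
    · refine Filter.Eventually.of_forall fun s hs => ?_
      rw [Set.uIoc_of_le zero_le_one] at hs
      simpa using hp.hasSum (hmem s ⟨hs.1.le, hs.2⟩)

/-- The partial derivative with respect to the second variable. -/
noncomputable def derivSnd (f : ℂ × ℂ → ℂ) (p : ℂ × ℂ) : ℂ := fderiv ℂ f p (0, 1)

theorem analyticAt_derivSnd {f : ℂ × ℂ → ℂ} {p : ℂ × ℂ} (hf : AnalyticAt ℂ f p) :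
    AnalyticAt ℂ (derivSnd f) p :=
  ((ContinuousLinearMap.apply ℂ ℂ ((0, 1) : ℂ × ℂ)).analyticAt _).comp hf.fderiv

/-- An analytic function of `(z, w)` equals `f (z, 0) + w g (z, w)` with `g` analytic,
namely `g (z, w) = ∫ s in 0..1, ∂f/∂w (z, s w)`. -/
theorem exists_eq_add_snd_mul {f : ℂ × ℂ → ℂ} (hf : AnalyticAt ℂ f 0) :
    ∃ g : ℂ × ℂ → ℂ, AnalyticAt ℂ g 0 ∧
      ∀ᶠ p in 𝓝 (0 : ℂ × ℂ), f p = f (p.1, 0) + p.2 * g p := by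
  refine ⟨_, analyticAt_integral_scaleSnd (analyticAt_derivSnd hf), ?_⟩
  obtain ⟨r, hr, hball⟩ := Metric.eventually_nhds_iff_ball.1 hf.eventually_analyticAt
  filter_upwards [Metric.ball_mem_nhds (0 : ℂ × ℂ) hr] with p hp
  have hmem : ∀ s ∈ Set.Icc (0 : ℝ) 1, scaleSnd s p ∈ ball (0 : ℂ × ℂ) r := by
    intro s hs
    rw [mem_ball_zero_iff] at hp ⊢
    exact (norm_scaleSnd_apply_le hs p).trans_lt hp
  have hder : ∀ s ∈ Set.uIcc (0 : ℝ) 1, HasDerivAt (fun s : ℝ => f (scaleSnd s p))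
      (p.2 * derivSnd f (scaleSnd s p)) s := by
    intro s hs
    rw [Set.uIcc_of_le zero_le_one] at hs
    have h1 : HasFDerivAt f (fderiv ℂ f (scaleSnd s p)) (scaleSnd s p) :=
      (hball _ (hmem s hs)).differentiableAt.hasFDerivAt
    have h2 : HasDerivAt (fun s : ℝ => scaleSnd s p) ((0, p.2) : ℂ × ℂ) s := by
      simp only [scaleSnd_apply]
      refine (hasDerivAt_const s p.1).prodMk ?_
      simpa using (Complex.ofRealCLM.hasDerivAt (x := s)).mul_const p.2
    have h3 := (h1.restrictScalars ℝ).comp_hasDerivAt s h2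
    refine h3.congr_deriv ?_
    change fderiv ℂ f (scaleSnd s p) (0, p.2) = p.2 * fderiv ℂ f (scaleSnd s p) (0, 1)
    rw [← smul_eq_mul, ← map_smul, Prod.smul_mk, smul_zero, smul_eq_mul, mul_one]
  have hcont : ContinuousOn (fun s : ℝ => p.2 * derivSnd f (scaleSnd s p))
      (Set.uIcc (0 : ℝ) 1) := by
    intro s hs
    rw [Set.uIcc_of_le zero_le_one] at hs
    refine ContinuousAt.continuousWithinAt (continuousAt_const.mul ?_)
    exact ContinuousAt.comp (f := fun s : ℝ => scaleSnd s p)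
      (analyticAt_derivSnd (hball _ (hmem s hs))).continuousAt
      (continuous_scaleSnd_apply.comp (by fun_prop : Continuous fun s : ℝ => (s, p))).continuousAt
  have h := intervalIntegral.integral_eq_sub_of_hasDerivAt hder hcont.intervalIntegrable
  rw [intervalIntegral.integral_const_mul] at h
  rw [h]
  simp [scaleSnd_apply]

/-! ### Taylor expansion in the second variable -/

/-- `w ↦ f (0, w)` vanishes at `0` to order exactly `m`. -/
def HasSliceOrder (f : ℂ × ℂ → ℂ) (m : ℕ) : Prop :=
  ∃ u : ℂ → ℂ, AnalyticAt ℂ u 0 ∧ u 0 ≠ 0 ∧ ∀ᶠ w in 𝓝 (0 : ℂ), f (0, w) = w ^ m * u w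

theorem tendsto_mk_zero : Filter.Tendsto (fun w : ℂ => ((0 : ℂ), w)) (𝓝 0) (𝓝 0) :=
  (by fun_prop : Continuous fun w : ℂ => ((0 : ℂ), w)).tendsto' _ _ rfl

theorem tendsto_mk_zero' : Filter.Tendsto (fun z : ℂ => (z, (0 : ℂ))) (𝓝 0) (𝓝 0) :=
  (by fun_prop : Continuous fun z : ℂ => (z, (0 : ℂ))).tendsto' _ _ rfl

theorem _root_.AnalyticAt.slice_snd {f : ℂ × ℂ → ℂ} (hf : AnalyticAt ℂ f 0) :
    AnalyticAt ℂ (fun w : ℂ => f (0, w)) 0 := by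
  refine AnalyticAt.fun_comp (g := f) (f := fun w : ℂ => ((0 : ℂ), w)) hf ?_
  fun_prop

theorem _root_.AnalyticAt.slice_fst {f : ℂ × ℂ → ℂ} (hf : AnalyticAt ℂ f 0) :
    AnalyticAt ℂ (fun z : ℂ => f (z, 0)) 0 := by
  refine AnalyticAt.fun_comp (g := f) (f := fun z : ℂ => (z, (0 : ℂ))) hf ?_
  fun_prop

theorem HasSliceOrder.apply_zero {f : ℂ × ℂ → ℂ} {m : ℕ} (h : HasSliceOrder f (m + 1)) :
    f 0 = 0 := by
  obtain ⟨u, -, -, hu⟩ := h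
  have := hu.self_of_nhds
  rw [pow_succ, mul_zero, zero_mul] at this
  exact this

theorem HasSliceOrder.of_eq_mul {f g : ℂ × ℂ → ℂ} {m : ℕ} (hg : AnalyticAt ℂ g 0)
    (hfg : ∀ᶠ p in 𝓝 (0 : ℂ × ℂ), f p = f (p.1, 0) + p.2 * g p) (h : HasSliceOrder f (m + 1)) :
    HasSliceOrder g m := by
  have h0 : f (0, 0) = 0 := h.apply_zero
  obtain ⟨u, hu, hu0, hfu⟩ := h
  refine ⟨u, hu, hu0, ?_⟩
  have h1 : ∀ᶠ w in 𝓝[≠] (0 : ℂ), g (0, w) = w ^ m * u w := by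
    filter_upwards [nhdsWithin_le_nhds hfu,
      nhdsWithin_le_nhds (tendsto_mk_zero.eventually hfg), self_mem_nhdsWithin] with w h1 h2 h3
    rw [h1, h0, zero_add, pow_succ'] at h2
    have h2' : w * (w ^ m * u w) = w * g (0, w) := by rw [← h2]; ring
    exact (mul_left_cancel₀ h3 h2').symm
  exact (AnalyticAt.frequently_eq_iff_eventually_eq hg.slice_snd
    (by fun_prop : AnalyticAt ℂ (fun w => w ^ m * u w) 0)).1 h1.frequently

theorem analyticAt_iterate_derivSnd {f : ℂ × ℂ → ℂ} {p : ℂ × ℂ} (hf : AnalyticAt ℂ f p) (k : ℕ) :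
    AnalyticAt ℂ (derivSnd^[k] f) p := by
  induction k with
  | zero => exact hf
  | succ k ih => rw [Function.iterate_succ_apply']; exact analyticAt_derivSnd ih

theorem derivSnd_congr {f g : ℂ × ℂ → ℂ} {p : ℂ × ℂ} (h : f =ᶠ[𝓝 p] g) :
    derivSnd f =ᶠ[𝓝 p] derivSnd g := by
  filter_upwards [h.eventuallyEq_nhds] with q hq
  rw [derivSnd, derivSnd, hq.fderiv_eq]

/-- Iterated Leibniz rule for `p ↦ c p.1 + p.2 * g p`. -/
theorem iterate_derivSnd_add_snd_mul {c : ℂ → ℂ} {g : ℂ × ℂ → ℂ} (hc : AnalyticAt ℂ c 0)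
    (hg : AnalyticAt ℂ g 0) (k : ℕ) :
    derivSnd^[k + 1] (fun p => c p.1 + p.2 * g p) =ᶠ[𝓝 0]
      fun p => p.2 * derivSnd^[k + 1] g p + (k + 1) * derivSnd^[k] g p := by
  induction k with
  | zero =>
    have hc' : ∀ᶠ p in 𝓝 (0 : ℂ × ℂ), AnalyticAt ℂ c p.1 :=
      (continuous_fst.tendsto' (0 : ℂ × ℂ) 0 rfl).eventually hc.eventually_analyticAt
    filter_upwards [hg.eventually_analyticAt, hc'] with p hp hcp
    have h1 : HasFDerivAt (fun p : ℂ × ℂ => c p.1) _ p :=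
      hcp.differentiableAt.hasFDerivAt.comp p hasFDerivAt_fst
    have h2 := (hasFDerivAt_snd (𝕜 := ℂ) (p := p)).mul hp.differentiableAt.hasFDerivAt
    simp only [Function.iterate_one, zero_add, Function.iterate_zero, id]
    have h3 : HasFDerivAt (fun p : ℂ × ℂ => c p.1 + p.2 * g p) _ p := h1.add h2
    rw [derivSnd, h3.fderiv]
    simp [derivSnd]
  | succ k ih =>
    rw [Function.iterate_succ_apply']
    refine (derivSnd_congr ih).trans ?_
    filter_upwards [hg.eventually_analyticAt] with p hp
    have h1 := (analyticAt_iterate_derivSnd hp (k + 1)).differentiableAt.hasFDerivAt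
    have h2 := (analyticAt_iterate_derivSnd hp k).differentiableAt.hasFDerivAt
    have h3 : HasFDerivAt
        (fun p => p.2 * derivSnd^[k + 1] g p + ((k : ℂ) + 1) * derivSnd^[k] g p) _ p :=
      ((hasFDerivAt_snd (𝕜 := ℂ) (p := p)).mul h1).add (h2.const_mul ((k : ℂ) + 1))
    rw [derivSnd, h3.fderiv, Function.iterate_succ_apply' derivSnd (k + 1) g,
      Function.iterate_succ_apply' derivSnd k g]
    simp [derivSnd]
    ring

/-- Taylor expansion of order `m` in the second variable, for a function whose slice at `z = 0`
vanishes to order `m`. The coefficient `a i` is the `i`-th derivative in `w` at `w = 0`, divided by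
`i!`. -/
theorem exists_taylor_snd (m : ℕ) : ∀ {f : ℂ × ℂ → ℂ}, AnalyticAt ℂ f 0 → HasSliceOrder f m →
    ∃ (a : ℕ → ℂ → ℂ) (g : ℂ × ℂ → ℂ), (∀ i, AnalyticAt ℂ (a i) 0) ∧ AnalyticAt ℂ g 0 ∧
      (∀ i < m, a i 0 = 0) ∧ g 0 ≠ 0 ∧
      (∀ᶠ p in 𝓝 (0 : ℂ × ℂ), f p = ∑ i ∈ Finset.range m, a i p.1 * p.2 ^ i + p.2 ^ m * g p) ∧
      (∀ i < m, ∀ᶠ z in 𝓝 (0 : ℂ), derivSnd^[i] f (z, 0) = (Nat.factorial i : ℂ) * a i z) ∧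
      derivSnd^[m] f 0 ≠ 0 := by
  induction m with
  | zero =>
    intro f hf ⟨u, _, hu0, hfu⟩
    have h0 : f 0 ≠ 0 := by
      have := hfu.self_of_nhds
      simp only [pow_zero, one_mul] at this
      rw [show (0 : ℂ × ℂ) = (0, 0) from rfl, this]
      exact hu0
    exact ⟨fun _ _ => 0, f, fun _ => analyticAt_const, hf, by simp, h0, by simp, by simp, h0⟩
  | succ m ih =>
    intro f hf hord
    obtain ⟨f₁, hf₁, hff₁⟩ := exists_eq_add_snd_mul hf
    have h0 : f 0 = 0 := hord.apply_zero
    obtain ⟨b, g, hb, hg, hb0, hg0, hexp, hder, hm⟩ := ih hf₁ (hord.of_eq_mul hf₁ hff₁)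
    have hD (k : ℕ) : derivSnd^[k + 1] f =ᶠ[𝓝 0]
        fun p => p.2 * derivSnd^[k + 1] f₁ p + (k + 1) * derivSnd^[k] f₁ p := by
      refine Filter.EventuallyEq.trans ?_ (iterate_derivSnd_add_snd_mul hf.slice_fst hf₁ k)
      have : ∀ n, derivSnd^[n] f =ᶠ[𝓝 0] derivSnd^[n] (fun p => f (p.1, 0) + p.2 * f₁ p) := by
        intro n
        induction n with
        | zero => exact hff₁
        | succ n ihn =>
          rw [Function.iterate_succ_apply', Function.iterate_succ_apply']
          exact derivSnd_congr ihn
      exact this _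
    obtain ⟨a, ha0, haS⟩ : ∃ a : ℕ → ℂ → ℂ, (a 0 = fun z => f (z, 0)) ∧ ∀ i, a (i + 1) = b i :=
      ⟨fun i => Nat.casesOn i (fun z => f (z, 0)) b, rfl, fun _ => rfl⟩
    refine ⟨a, g, ?_, hg, ?_, hg0, ?_, ?_, ?_⟩
    · rintro (_ | i)
      · rw [ha0]
        exact hf.slice_fst
      · rw [haS]
        exact hb i
    · rintro (_ | i) hi
      · rw [ha0]
        exact h0
      · rw [haS]
        exact hb0 i (by omega)
    · filter_upwards [hff₁, hexp] with p h1 h2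
      rw [h1, h2, Finset.sum_range_succ', mul_add, Finset.mul_sum]
      simp only [ha0, haS, pow_zero, mul_one, pow_succ]
      have : ∀ i ∈ Finset.range m, p.2 * (b i p.1 * p.2 ^ i) = b i p.1 * (p.2 ^ i * p.2) :=
        fun i _ => by ring
      rw [Finset.sum_congr rfl this]
      ring
    · rintro (_ | i) hi
      · simp [ha0]
      · rw [haS]
        filter_upwards [hder i (by omega), tendsto_mk_zero'.eventually (hD i)] with z h1 h2
        rw [h2, h1]
        simp only [zero_mul, zero_add, Nat.factorial_succ]
        push_cast
        ring
    · rw [(hD m).self_of_nhds]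
      simp only [Prod.snd_zero, zero_mul, zero_add]
      exact mul_ne_zero (by exact_mod_cast Nat.succ_ne_zero m) hm

/-! ### Tschirnhaus shift -/

/-- Analytic implicit function theorem in two variables. -/
theorem exists_analyticAt_implicit {h : ℂ × ℂ → ℂ} (hh : AnalyticAt ℂ h 0) (h0 : h 0 = 0)
    (hw : derivSnd h 0 ≠ 0) :
    ∃ φ : ℂ → ℂ, AnalyticAt ℂ φ 0 ∧ φ 0 = 0 ∧ ∀ᶠ z in 𝓝 (0 : ℂ), h (z, φ z) = 0 := by
  set D := fderiv ℂ h 0 with hD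
  have hDv : ∀ v : ℂ × ℂ, D v = v.1 * D (1, 0) + v.2 * D (0, 1) := by
    intro v
    rw [← smul_eq_mul, ← smul_eq_mul, ← map_smul, ← map_smul, ← map_add]
    simp
  have hβ : D (0, 1) ≠ 0 := hw
  let e : (ℂ × ℂ) ≃L[ℂ] (ℂ × ℂ) := ContinuousLinearEquiv.equivOfInverse
    ((ContinuousLinearMap.fst ℂ ℂ ℂ).prod D)
    ((ContinuousLinearMap.fst ℂ ℂ ℂ).prod ((D (0, 1))⁻¹ •
      (ContinuousLinearMap.snd ℂ ℂ ℂ - D (1, 0) • ContinuousLinearMap.fst ℂ ℂ ℂ)))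
    (by
      intro v
      refine Prod.ext rfl ?_
      change (D (0, 1))⁻¹ * (D v - D (1, 0) * v.1) = v.2
      rw [hDv v]
      field_simp
      ring)
    (by
      intro v
      refine Prod.ext rfl ?_
      change D (v.1, (D (0, 1))⁻¹ * (v.2 - D (1, 0) * v.1)) = v.2
      rw [hDv]
      field_simp
      ring)
  have hH : AnalyticAt ℂ (fun p : ℂ × ℂ => (p.1, h p)) 0 := analyticAt_fst.prod hh
  have hfd : HasFDerivAt (fun p : ℂ × ℂ => (p.1, h p)) (e : ℂ × ℂ →L[ℂ] ℂ × ℂ) 0 :=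
    hasFDerivAt_fst.prodMk hh.differentiableAt.hasFDerivAt
  have hst : HasStrictFDerivAt (fun p : ℂ × ℂ => (p.1, h p)) (e : ℂ × ℂ →L[ℂ] ℂ × ℂ) 0 := by
    rw [← hfd.fderiv]
    exact hH.hasStrictFDerivAt
  set Φ := hst.toOpenPartialHomeomorph with hΦ
  have hΦc : ∀ p, Φ p = (p.1, h p) := fun p => rfl
  have hsrc : (0 : ℂ × ℂ) ∈ Φ.source := hst.mem_toOpenPartialHomeomorph_source
  have hΦ0 : Φ 0 = 0 := by rw [hΦc, h0]; rfl
  have hsymm : AnalyticAt ℂ Φ.symm 0 := by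
    have := Φ.analyticAt_symm' hsrc hH hfd.fderiv
    rwa [hΦ0] at this
  have htgt : (0 : ℂ × ℂ) ∈ Φ.target := hΦ0 ▸ Φ.map_source hsrc
  refine ⟨fun z => (Φ.symm (z, 0)).2, ?_, ?_, ?_⟩
  · refine AnalyticAt.fun_comp (g := Prod.snd) analyticAt_snd ?_
    refine AnalyticAt.fun_comp (g := Φ.symm) (f := fun z : ℂ => (z, (0 : ℂ))) hsymm ?_
    fun_prop
  · change (Φ.symm 0).2 = 0
    rw [← hΦ0, Φ.left_inv hsrc]
    rfl
  · filter_upwards [tendsto_mk_zero'.eventually (Φ.open_target.mem_nhds htgt)] with z hz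
    have h1 := Φ.right_inv hz
    rw [hΦc] at h1
    have h2 : (Φ.symm (z, 0)).1 = z := congrArg Prod.fst h1
    have h3 : h (Φ.symm (z, 0)) = 0 := congrArg Prod.snd h1
    have h4 : (z, (Φ.symm (z, 0)).2) = Φ.symm (z, 0) := Prod.ext h2.symm rfl
    rw [h4]
    exact h3

/-- The shift `(z, w) ↦ (z, w + φ z)`. -/
def shiftSnd (φ : ℂ → ℂ) (p : ℂ × ℂ) : ℂ × ℂ := (p.1, p.2 + φ p.1)

theorem analyticAt_shiftSnd {φ : ℂ → ℂ} (hφ : AnalyticAt ℂ φ 0) :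
    AnalyticAt ℂ (shiftSnd φ) 0 := by
  refine analyticAt_fst.prod (analyticAt_snd.add ?_)
  exact AnalyticAt.fun_comp (g := φ) (f := Prod.fst) hφ analyticAt_fst

theorem shiftSnd_zero {φ : ℂ → ℂ} (h0 : φ 0 = 0) : shiftSnd φ 0 = 0 := by
  simp [shiftSnd, h0]

theorem iterate_derivSnd_shift {f : ℂ × ℂ → ℂ} (hf : AnalyticAt ℂ f 0) {φ : ℂ → ℂ}
    (hφ : AnalyticAt ℂ φ 0) (h0 : φ 0 = 0) (k : ℕ) :
    derivSnd^[k] (f ∘ shiftSnd φ) =ᶠ[𝓝 0] derivSnd^[k] f ∘ shiftSnd φ := by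
  induction k with
  | zero => rfl
  | succ k ih =>
    rw [Function.iterate_succ_apply', Function.iterate_succ_apply']
    refine (derivSnd_congr ih).trans ?_
    have ht : Filter.Tendsto (shiftSnd φ) (𝓝 0) (𝓝 0) := by
      have := (analyticAt_shiftSnd hφ).continuousAt.tendsto
      rwa [shiftSnd_zero h0] at this
    have hφ' : ∀ᶠ p in 𝓝 (0 : ℂ × ℂ), AnalyticAt ℂ φ p.1 :=
      (continuous_fst.tendsto' (0 : ℂ × ℂ) 0 rfl).eventually hφ.eventually_analyticAt
    filter_upwards [ht.eventually hf.eventually_analyticAt, hφ'] with p hp hφp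
    have h1 := (analyticAt_iterate_derivSnd hp k).differentiableAt.hasFDerivAt
    have h2 : HasFDerivAt (fun p : ℂ × ℂ => φ p.1) _ p :=
      hφp.differentiableAt.hasFDerivAt.comp p hasFDerivAt_fst
    have h3 : HasFDerivAt (shiftSnd φ) _ p :=
      (hasFDerivAt_fst (𝕜 := ℂ)).prodMk ((hasFDerivAt_snd (𝕜 := ℂ)).add h2)
    rw [derivSnd, (h1.comp p h3).fderiv]
    simp [derivSnd]

/-- After a shift `w ↦ w + φ z`, the coefficient of `w ^ m` in the Taylor expansion of order `m + 1`
vanishes identically: `φ` is the solution of `∂ᵐf/∂wᵐ (z, φ z) = 0`. -/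
theorem exists_tschirnhaus {m : ℕ} {f : ℂ × ℂ → ℂ} (hf : AnalyticAt ℂ f 0)
    (hord : HasSliceOrder f (m + 1)) :
    ∃ (φ : ℂ → ℂ) (a : ℕ → ℂ → ℂ) (g : ℂ × ℂ → ℂ), AnalyticAt ℂ φ 0 ∧ φ 0 = 0 ∧
      (∀ i, AnalyticAt ℂ (a i) 0) ∧ AnalyticAt ℂ g 0 ∧ (∀ i < m, a i 0 = 0) ∧ g 0 ≠ 0 ∧
      ∀ᶠ p in 𝓝 (0 : ℂ × ℂ), f (shiftSnd φ p) =
        ∑ i ∈ Finset.range m, a i p.1 * p.2 ^ i + p.2 ^ (m + 1) * g p := by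
  obtain ⟨a, g, ha, hg, ha0, hg0, hexp, hder, hm⟩ := exists_taylor_snd (m + 1) hf hord
  have h0 : derivSnd^[m] f 0 = 0 := by
    have := (hder m (by omega)).self_of_nhds
    rw [ha0 m (by omega), mul_zero] at this
    exact this
  rw [Function.iterate_succ_apply'] at hm
  obtain ⟨φ, hφ, hφ0, hφz⟩ :=
    exists_analyticAt_implicit (analyticAt_iterate_derivSnd hf m) h0 hm
  have hfs : AnalyticAt ℂ (f ∘ shiftSnd φ) 0 := by
    refine AnalyticAt.comp (g := f) ?_ (analyticAt_shiftSnd hφ)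
    rwa [shiftSnd_zero hφ0]
  have hords : HasSliceOrder (f ∘ shiftSnd φ) (m + 1) := by
    obtain ⟨u, hu, hu0, hfu⟩ := hord
    refine ⟨u, hu, hu0, ?_⟩
    filter_upwards [hfu] with w hw
    simp [shiftSnd, hφ0, hw]
  obtain ⟨b, k, hb, hk, hb0, hk0, hexpb, hderb, -⟩ := exists_taylor_snd (m + 1) hfs hords
  refine ⟨φ, b, k, hφ, hφ0, hb, hk, fun i hi => hb0 i (by omega), hk0, ?_⟩
  have hbm : ∀ᶠ z in 𝓝 (0 : ℂ), b m z = 0 := by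
    filter_upwards [hderb m (by omega), hφz,
      tendsto_mk_zero'.eventually (iterate_derivSnd_shift hf hφ hφ0 m)] with z h1 h2 h3
    rw [h1] at h3
    simp only [Function.comp, shiftSnd, zero_add, h2] at h3
    exact (mul_eq_zero.1 h3).resolve_left (by exact_mod_cast Nat.factorial_ne_zero m)
  filter_upwards [hexpb, (continuous_fst.tendsto' (0 : ℂ × ℂ) 0 rfl).eventually hbm] with p h1 h2
  rw [← Function.comp_apply (f := f), h1, Finset.sum_range_succ, h2]
  ring

/-! ### Puiseux parametrization of the zero set -/

/-- After the substitution `z = t ^ N`, the zeros of `f` near the origin with `t ≠ 0` form the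
union of the graphs of finitely many functions `ψ`, analytic at `0`, with `ψ 0 = 0`. -/
def HasBranches (f : ℂ × ℂ → ℂ) : Prop :=
  ∃ (N : ℕ) (Ψ : Set (ℂ → ℂ)), 0 < N ∧ Ψ.Finite ∧ Ψ.Nonempty ∧
    (∀ ψ ∈ Ψ, AnalyticAt ℂ ψ 0 ∧ ψ 0 = 0) ∧
    ∀ᶠ p in 𝓝 (0 : ℂ × ℂ), p.1 ≠ 0 → (f (p.1 ^ N, p.2) = 0 ↔ ∃ ψ ∈ Ψ, p.2 = ψ p.1)

theorem HasBranches.of_shift {f : ℂ × ℂ → ℂ} {φ : ℂ → ℂ} (hφ : AnalyticAt ℂ φ 0) (h0 : φ 0 = 0)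
    (h : HasBranches (f ∘ shiftSnd φ)) : HasBranches f := by
  obtain ⟨N, Ψ, hN, hfin, hne, hΨ, hev⟩ := h
  have hpow : AnalyticAt ℂ (fun t : ℂ => φ (t ^ N)) 0 := by
    refine AnalyticAt.fun_comp (g := φ) (f := fun t : ℂ => t ^ N) ?_ (by fun_prop)
    simpa [hN.ne'] using hφ
  have hpow0 : φ (0 ^ N) = 0 := by rw [zero_pow hN.ne', h0]
  refine ⟨N, (fun ψ t => ψ t + φ (t ^ N)) '' Ψ, hN, hfin.image _, hne.image _, ?_, ?_⟩
  · rintro _ ⟨ψ, hψ, rfl⟩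
    refine ⟨(hΨ ψ hψ).1.add hpow, ?_⟩
    simp only [(hΨ ψ hψ).2, hpow0, add_zero]
  · have ht : Filter.Tendsto (fun p : ℂ × ℂ => (p.1, p.2 - φ (p.1 ^ N))) (𝓝 0) (𝓝 0) := by
      have hc : ContinuousAt (fun p : ℂ × ℂ => (p.1, p.2 - φ (p.1 ^ N))) 0 := by
        refine continuousAt_fst.prodMk (continuousAt_snd.sub ?_)
        exact ContinuousAt.comp (g := fun t : ℂ => φ (t ^ N)) (f := Prod.fst)
          hpow.continuousAt continuousAt_fst
      have := hc.tendsto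
      rwa [Prod.fst_zero, Prod.snd_zero, hpow0, sub_zero] at this
    filter_upwards [ht.eventually hev] with p hp hp0
    have h1 := hp hp0
    simp only [Function.comp, shiftSnd, sub_add_cancel] at h1
    rw [h1]
    simp only [Set.exists_mem_image, sub_eq_iff_eq_add]

/-- The first slope of the Newton polygon of `∑ a i z * w ^ i + w ^ (m + 1)`: after a substitution
`z = t ^ N`, the coefficient `a i` is divisible by `t ^ (k * (m + 1 - i))`, and for at least one `i`
the quotient `b i` does not vanish at `0`. -/
theorem exists_newton_slope {m : ℕ} {a : ℕ → ℂ → ℂ} (ha : ∀ i, AnalyticAt ℂ (a i) 0)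
    (ha0 : ∀ i < m, a i 0 = 0) (hne : ∃ i < m, ¬ ∀ᶠ z in 𝓝 (0 : ℂ), a i z = 0) :
    ∃ (N k : ℕ) (b : ℕ → ℂ → ℂ), 0 < N ∧ 0 < k ∧ (∀ i, AnalyticAt ℂ (b i) 0) ∧
      (∀ i < m, ∀ᶠ t in 𝓝 (0 : ℂ), a i (t ^ N) = t ^ (k * (m + 1 - i)) * b i t) ∧
      ∃ i < m, b i 0 ≠ 0 := by
  classical
  set S : Finset ℕ := (Finset.range m).filter fun i => ¬ ∀ᶠ z in 𝓝 (0 : ℂ), a i z = 0 with hS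
  have hSne : S.Nonempty := by
    obtain ⟨i, hi, h⟩ := hne
    exact ⟨i, by simp only [hS, Finset.mem_filter, Finset.mem_range]; exact ⟨hi, h⟩⟩
  have hSm : ∀ i ∈ S, i < m := fun i hi => by
    simpa using (Finset.mem_filter.1 hi).1
  have hex : ∀ i, ∃ (n : ℕ) (c : ℂ → ℂ), i ∈ S → (AnalyticAt ℂ c 0 ∧ c 0 ≠ 0 ∧
      ∀ᶠ z in 𝓝 (0 : ℂ), a i z = z ^ n * c z) := by
    intro i
    by_cases hi : i ∈ S
    · obtain ⟨n, c, hc, hc0, h⟩ :=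
        (ha i).exists_eventuallyEq_pow_smul_nonzero_iff.2 (Finset.mem_filter.1 hi).2
      exact ⟨n, c, fun _ => ⟨hc, hc0, by simpa using h⟩⟩
    · exact ⟨0, 0, fun h => absurd h hi⟩
  choose n c hnc using hex
  -- The quotient `n i / (m + 1 - i)`, up to sign the slope of the segment from `(i, n i)` to
  -- `(m + 1, 0)`, is minimal at `i = j`; hence the exponents `N = m + 1 - j` and `k = n j`.
  obtain ⟨j, hj, hmin⟩ :=
    Finset.exists_min_image S (fun i => (n i : ℚ) / ((m + 1 - i : ℕ) : ℚ)) hSne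
  have hjm := hSm j hj
  have hle : ∀ i ∈ S, n j * (m + 1 - i) ≤ n i * (m + 1 - j) := by
    intro i hi
    have him := hSm i hi
    have h := hmin i hi
    rw [div_le_div_iff₀ (by exact_mod_cast (by omega : 0 < m + 1 - j))
      (by exact_mod_cast (by omega : 0 < m + 1 - i))] at h
    exact_mod_cast h
  have hk : 0 < n j := by
    rcases Nat.eq_zero_or_pos (n j) with h | h
    · exfalso
      obtain ⟨-, hc0, hev⟩ := hnc j hj
      have := hev.self_of_nhds
      rw [ha0 j hjm, h, pow_zero, one_mul] at this
      exact hc0 this.symm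
    · exact h
  have hN : 0 < m + 1 - j := by omega
  have htend : Filter.Tendsto (fun t : ℂ => t ^ (m + 1 - j)) (𝓝 0) (𝓝 0) :=
    (by fun_prop : Continuous fun t : ℂ => t ^ (m + 1 - j)).tendsto' _ _ (zero_pow hN.ne')
  refine ⟨m + 1 - j, n j, fun i => if i ∈ S then fun t =>
    t ^ (n i * (m + 1 - j) - n j * (m + 1 - i)) * c i (t ^ (m + 1 - j)) else 0, hN, hk, ?_, ?_, ?_⟩
  · intro i
    by_cases hi : i ∈ S
    · simp only [hi, if_true]
      refine AnalyticAt.mul (by fun_prop) ?_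
      refine AnalyticAt.fun_comp (g := c i) (f := fun t : ℂ => t ^ (m + 1 - j)) ?_ (by fun_prop)
      simpa [hN.ne'] using (hnc i hi).1
    · simp only [hi, if_false]
      exact analyticAt_const
  · intro i him
    by_cases hi : i ∈ S
    · simp only [hi, if_true]
      filter_upwards [htend.eventually (hnc i hi).2.2] with t ht
      rw [ht, ← mul_assoc, ← pow_add, ← pow_mul, Nat.add_sub_cancel' (hle i hi), mul_comm (n i)]
    · simp only [hi, if_false]
      have : ∀ᶠ z in 𝓝 (0 : ℂ), a i z = 0 := by
        by_contra h
        exact hi (Finset.mem_filter.2 ⟨Finset.mem_range.2 him, h⟩)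
      filter_upwards [htend.eventually this] with t ht
      simp [ht]
  · refine ⟨j, hjm, ?_⟩
    simp only [hj, if_true, Nat.sub_self, pow_zero, one_mul]
    rw [zero_pow hN.ne']
    exact (hnc j hj).2.1

open Polynomial in
/-- A polynomial of degree `m + 1` with no term of degree `m`, not a monomial, is not a constant
times the power of a linear form. -/
theorem rootMultiplicity_le_of_coeff {m : ℕ} {p : ℂ[X]} (hdeg : p.natDegree = m + 1)
    (hm : p.coeff m = 0) (hi : ∃ i < m, p.coeff i ≠ 0) (a : ℂ) : p.rootMultiplicity a ≤ m := by
  have hp : p ≠ 0 := by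
    rintro rfl
    simp at hdeg
  by_contra! h
  obtain ⟨r, hr⟩ := (pow_dvd_pow _ (Nat.succ_le_of_lt h)).trans (pow_rootMultiplicity_dvd p a)
  have hr0 : r ≠ 0 := by
    rintro rfl
    exact hp (by simpa using hr)
  have hdr : r.natDegree = 0 := by
    have := congrArg natDegree hr
    rw [hdeg, natDegree_mul (pow_ne_zero _ (X_sub_C_ne_zero a)) hr0, natDegree_pow,
      natDegree_X_sub_C] at this
    omega
  obtain ⟨c, rfl⟩ : ∃ c, r = C c := ⟨_, eq_C_of_natDegree_eq_zero hdr⟩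
  have hc : c ≠ 0 := by
    rintro rfl
    simp at hr0
  have ha : a = 0 := by
    rw [hr, sub_eq_add_neg, ← C_neg, coeff_mul_C, coeff_X_add_C_pow] at hm
    simp only [Nat.succ_eq_add_one, Nat.add_sub_cancel_left, pow_one, Nat.choose_succ_self_right,
      mul_eq_zero, neg_eq_zero, hc, or_false] at hm
    exact hm.resolve_right (by exact_mod_cast Nat.succ_ne_zero m)
  obtain ⟨i, him, hi⟩ := hi
  rw [hr, ha] at hi
  simp only [map_zero, sub_zero, coeff_mul_C, coeff_X_pow, Nat.succ_eq_add_one,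
    if_neg (by omega : i ≠ m + 1), zero_mul, ne_eq, not_true_eq_false] at hi

/-- The bound on the roots of a polynomial in terms of its coefficients. -/
theorem norm_le_of_sum_add_pow_eq_zero {m : ℕ} {b : ℕ → ℂ} {c w : ℂ} {A δ : ℝ} (hδ : 0 < δ)
    (hA : ∀ i < m, ‖b i‖ ≤ A) (hA0 : 0 ≤ A) (hc : δ ≤ ‖c‖)
    (h : ∑ i ∈ Finset.range m, b i * w ^ i + w ^ (m + 1) * c = 0) :
    ‖w‖ ≤ max 1 (m * A / δ) := by
  by_cases hw : ‖w‖ ≤ 1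
  · exact hw.trans (le_max_left _ _)
  push Not at hw
  refine le_trans ?_ (le_max_right _ _)
  rw [le_div_iff₀ hδ]
  have h1 : ‖w‖ ^ (m + 1) * ‖c‖ ≤ m * (A * ‖w‖ ^ m) := by
    have h2 : w ^ (m + 1) * c = -∑ i ∈ Finset.range m, b i * w ^ i := by
      linear_combination h
    have h3 := congrArg norm h2
    rw [norm_mul, norm_pow, norm_neg] at h3
    rw [h3]
    refine (norm_sum_le _ _).trans ?_
    refine (Finset.sum_le_card_nsmul _ _ (A * ‖w‖ ^ m) ?_).trans (by simp)
    intro i hi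
    rw [norm_mul, norm_pow]
    have him := Finset.mem_range.1 hi
    exact mul_le_mul (hA i him) (pow_le_pow_right₀ hw.le him.le) (by positivity) hA0
  have h4 : ‖w‖ ^ m * (‖w‖ * δ) ≤ ‖w‖ ^ m * (m * A) := by
    calc ‖w‖ ^ m * (‖w‖ * δ) = ‖w‖ ^ (m + 1) * δ := by ring
      _ ≤ ‖w‖ ^ (m + 1) * ‖c‖ := by gcongr
      _ ≤ _ := h1
      _ = _ := by ring
  exact le_of_mul_le_mul_left h4 (by positivity)

/-- The strict transform of `∑ a i w ^ i + w ^ (m + 1) g` under `(t, w) ↦ (t ^ N, t ^ k w)`. -/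
noncomputable def strictTransform (m N k : ℕ) (b : ℕ → ℂ → ℂ) (g : ℂ × ℂ → ℂ) (p : ℂ × ℂ) : ℂ :=
  ∑ i ∈ Finset.range m, b i p.1 * p.2 ^ i + p.2 ^ (m + 1) * g (p.1 ^ N, p.1 ^ k * p.2)

theorem analyticAt_strictTransform {m N k : ℕ} {b : ℕ → ℂ → ℂ} {g : ℂ × ℂ → ℂ} (hN : 0 < N)
    (hk : 0 < k) (hb : ∀ i, AnalyticAt ℂ (b i) 0) (hg : AnalyticAt ℂ g 0) (w : ℂ) :
    AnalyticAt ℂ (strictTransform m N k b g) (0, w) := by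
  refine AnalyticAt.add (Finset.analyticAt_fun_sum _ fun i _ => ?_) ?_
  · refine AnalyticAt.mul ?_ (analyticAt_snd.pow i)
    exact AnalyticAt.fun_comp (g := b i) (f := Prod.fst) (hb i) analyticAt_fst
  · refine AnalyticAt.mul (analyticAt_snd.pow _) ?_
    refine AnalyticAt.fun_comp (g := g) (f := fun p : ℂ × ℂ => (p.1 ^ N, p.1 ^ k * p.2)) ?_
      ((analyticAt_fst.pow N).prod ((analyticAt_fst.pow k).mul analyticAt_snd))
    have h0 : (((0 : ℂ) ^ N, (0 : ℂ) ^ k * w) : ℂ × ℂ) = 0 := by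
      rw [zero_pow hN.ne', zero_pow hk.ne', zero_mul]
      rfl
    simp only [h0]
    exact hg

/-- The substitution `(z, w) = (t ^ N, t ^ k w')` multiplies the strict transform by
`t ^ (k * (m + 1))`. -/
theorem eventually_eq_strictTransform {m N k : ℕ} {a b : ℕ → ℂ → ℂ} {f g : ℂ × ℂ → ℂ} (hN : 0 < N)
    (hab : ∀ i < m, ∀ᶠ t in 𝓝 (0 : ℂ), a i (t ^ N) = t ^ (k * (m + 1 - i)) * b i t)
    (hf : ∀ᶠ p in 𝓝 (0 : ℂ × ℂ),
      f p = ∑ i ∈ Finset.range m, a i p.1 * p.2 ^ i + p.2 ^ (m + 1) * g p) :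
    ∀ᶠ p in 𝓝 (0 : ℂ × ℂ), p.1 ≠ 0 → f (p.1 ^ N, p.2) =
      p.1 ^ (k * (m + 1)) * strictTransform m N k b g (p.1, p.2 / p.1 ^ k) := by
  have h1 : Filter.Tendsto (fun p : ℂ × ℂ => (p.1 ^ N, p.2)) (𝓝 0) (𝓝 0) :=
    (by fun_prop : Continuous fun p : ℂ × ℂ => (p.1 ^ N, p.2)).tendsto' _ _ (by simp [hN.ne'])
  have h2 : ∀ᶠ t in 𝓝 (0 : ℂ), ∀ i ∈ Finset.range m,
      a i (t ^ N) = t ^ (k * (m + 1 - i)) * b i t :=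
    (Filter.eventually_all_finset _).2 fun i hi => hab i (Finset.mem_range.1 hi)
  filter_upwards [h1.eventually hf, (continuous_fst.tendsto' (0 : ℂ × ℂ) 0 rfl).eventually h2]
    with p hp1 hp2 hp0
  have hpk : p.1 ^ k ≠ 0 := pow_ne_zero _ hp0
  obtain ⟨w, hw⟩ : ∃ w, p.2 = p.1 ^ k * w := ⟨p.2 / p.1 ^ k, by field_simp⟩
  rw [hp1]
  simp only [strictTransform, hw, mul_div_cancel_left₀ _ hpk]
  rw [mul_add, Finset.mul_sum]
  congr 1
  · refine Finset.sum_congr rfl fun i hi => ?_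
    have him := Finset.mem_range.1 hi
    rw [hp2 i hi]
    have : k * (m + 1) = k * (m + 1 - i) + k * i := by
      rw [← mul_add, Nat.sub_add_cancel (by omega)]
    rw [this, pow_add]
    ring
  · ring

open Polynomial in
/-- The slice at `t = 0` of the strict transform, as a polynomial. -/
noncomputable def slicePolynomial (m : ℕ) (b : ℕ → ℂ) (c : ℂ) : ℂ[X] :=
  ∑ i ∈ Finset.range m, C (b i) * X ^ i + C c * X ^ (m + 1)

open Polynomial in
theorem eval_slicePolynomial (m : ℕ) (b : ℕ → ℂ) (c w : ℂ) : (slicePolynomial m b c).eval w =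
    ∑ i ∈ Finset.range m, b i * w ^ i + w ^ (m + 1) * c := by
  simp [slicePolynomial, eval_finsetSum, mul_comm c]

open Polynomial in
theorem coeff_slicePolynomial (m : ℕ) (b : ℕ → ℂ) (c : ℂ) (j : ℕ) :
    (slicePolynomial m b c).coeff j =
      (if j < m then b j else 0) + if j = m + 1 then c else 0 := by
  simp [slicePolynomial, coeff_X_pow]

open Polynomial in
theorem natDegree_slicePolynomial (m : ℕ) (b : ℕ → ℂ) {c : ℂ} (hc : c ≠ 0) :
    (slicePolynomial m b c).natDegree = m + 1 := by
  refine natDegree_eq_of_le_of_coeff_ne_zero ?_ ?_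
  · refine (natDegree_le_iff_coeff_eq_zero).2 fun j hj => ?_
    rw [coeff_slicePolynomial, if_neg (by omega), if_neg (by omega), add_zero]
  · rw [coeff_slicePolynomial, if_neg (by omega), if_pos rfl, zero_add]
    exact hc

open Polynomial in
theorem strictTransform_zero {m N k : ℕ} {b : ℕ → ℂ → ℂ} {g : ℂ × ℂ → ℂ} (hN : 0 < N)
    (hk : 0 < k) (w : ℂ) : strictTransform m N k b g (0, w) =
      (slicePolynomial m (fun i => b i 0) (g 0)).eval w := by
  rw [eval_slicePolynomial, strictTransform]
  simp only [zero_pow hN.ne', zero_pow hk.ne', zero_mul]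
  rfl

open Polynomial in
/-- The order of the slice of the strict transform at `(0, w)` is the multiplicity of `w` as a root
of the slice polynomial. -/
theorem hasSliceOrder_strictTransform {m N k : ℕ} {b : ℕ → ℂ → ℂ} {g : ℂ × ℂ → ℂ} (hN : 0 < N)
    (hk : 0 < k) (hg0 : g 0 ≠ 0) (w : ℂ) :
    HasSliceOrder (fun p => strictTransform m N k b g (p.1, w + p.2))
      ((slicePolynomial m (fun i => b i 0) (g 0)).rootMultiplicity w) := by
  set q := slicePolynomial m (fun i => b i 0) (g 0) with hq
  have hq0 : q ≠ 0 := by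
    intro h
    have := natDegree_slicePolynomial m (fun i => b i 0) hg0
    rw [← hq, h] at this
    simp at this
  obtain ⟨r, hr, hndvd⟩ := exists_eq_pow_rootMultiplicity_mul_and_not_dvd q hq0 w
  refine ⟨fun v => r.eval (w + v), ?_, ?_, ?_⟩
  · exact AnalyticAt.fun_comp (g := fun x => r.eval x) (f := fun v : ℂ => w + v)
      (AnalyticOnNhd.eval_polynomial r _ (Set.mem_univ _)) (by fun_prop)
  · change r.eval (w + 0) ≠ 0
    rw [add_zero]
    rwa [dvd_iff_isRoot, IsRoot] at hndvd
  · refine Filter.Eventually.of_forall fun v => ?_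
    simp only
    rw [strictTransform_zero hN hk, ← hq]
    conv_lhs => rw [hr]
    simp

/-- Local description of the zeros of the strict transform, uniform over a compact set of values
of the second coordinate, given the branches at each zero of its slice at `t = 0`. -/
theorem eventually_forall_strictTransform_eq_zero_iff {m N k : ℕ} {b : ℕ → ℂ → ℂ}
    {g : ℂ × ℂ → ℂ} (hN : 0 < N) (hk : 0 < k) (hb : ∀ i, AnalyticAt ℂ (b i) 0)
    (hg : AnalyticAt ℂ g 0) {M : ℕ} (hM : 0 < M) {roots : Set ℂ} (hfin : roots.Finite)
    (hroots : ∀ w, w ∈ roots ↔ strictTransform m N k b g (0, w) = 0) {n e : ℂ → ℕ}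
    (he : ∀ w ∈ roots, 0 < e w) (hne : ∀ w ∈ roots, e w * n w = M) {Ψ : ℂ → Set (ℂ → ℂ)}
    (hΨfin : ∀ w ∈ roots, (Ψ w).Finite)
    (hΨ : ∀ w ∈ roots, ∀ ψ ∈ Ψ w, AnalyticAt ℂ ψ 0 ∧ ψ 0 = 0)
    (hbr : ∀ w ∈ roots, ∀ᶠ p in 𝓝 (0 : ℂ × ℂ), p.1 ≠ 0 →
      (strictTransform m N k b g (p.1 ^ n w, w + p.2) = 0 ↔ ∃ ψ ∈ Ψ w, p.2 = ψ p.1))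
    {K : Set ℂ} (hK : IsCompact K) :
    ∀ᶠ s in 𝓝 (0 : ℂ), ∀ w ∈ K, s ≠ 0 → (strictTransform m N k b g (s ^ M, w) = 0 ↔
      ∃ w₀ ∈ roots, ∃ ψ ∈ Ψ w₀, w = w₀ + ψ (s ^ e w₀)) := by
  refine hK.eventually_forall_of_forall_eventually fun w₁ _ => ?_
  have hψ : ∀ w₀ ∈ roots, ∀ ψ ∈ Ψ w₀,
      ContinuousAt (fun p : ℂ × ℂ => w₀ + ψ (p.1 ^ e w₀)) (0, w₁) := by
    intro w₀ hw₀ ψ hψ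
    refine continuousAt_const.add ?_
    refine ContinuousAt.comp (g := ψ) (f := fun p : ℂ × ℂ => p.1 ^ e w₀) ?_ (by fun_prop)
    simpa [(he w₀ hw₀).ne'] using (hΨ w₀ hw₀ ψ hψ).1.continuousAt
  have hother : ∀ᶠ p in 𝓝 ((0 : ℂ), w₁), ∀ w₀ ∈ roots, ∀ ψ ∈ Ψ w₀, w₀ ≠ w₁ →
      p.2 ≠ w₀ + ψ (p.1 ^ e w₀) := by
    refine (Filter.eventually_all_finite hfin).2 fun w₀ hw₀ => ?_
    refine (Filter.eventually_all_finite (hΨfin w₀ hw₀)).2 fun ψ hψm => ?_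
    by_cases hw : w₀ = w₁
    · exact Filter.Eventually.of_forall fun p h => absurd hw h
    · have h1 := ((continuousAt_snd (p := ((0 : ℂ), w₁))).ne_iff_eventually_ne
        (hψ w₀ hw₀ ψ hψm)).1 (by
        simp only [zero_pow (he w₀ hw₀).ne', (hΨ w₀ hw₀ ψ hψm).2, add_zero]
        exact Ne.symm hw)
      exact h1.mono fun p hp _ => hp
  by_cases hw₁ : w₁ ∈ roots
  · have ht : Filter.Tendsto (fun p : ℂ × ℂ => (p.1 ^ e w₁, p.2 - w₁)) (𝓝 (0, w₁)) (𝓝 0) :=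
      (by fun_prop : Continuous fun p : ℂ × ℂ => (p.1 ^ e w₁, p.2 - w₁)).tendsto' _ _ (by
        simp [(he w₁ hw₁).ne'])
    filter_upwards [hother, ht.eventually (hbr w₁ hw₁)] with p hp1 hp2 hp0
    have h1 := hp2 (pow_ne_zero _ hp0)
    rw [← pow_mul, hne w₁ hw₁, add_sub_cancel] at h1
    rw [h1]
    constructor
    · rintro ⟨ψ, hψm, h⟩
      exact ⟨w₁, hw₁, ψ, hψm, by rw [← h]; ring⟩
    · rintro ⟨w₀, hw₀, ψ, hψm, h⟩
      have : w₀ = w₁ := by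
        by_contra hne
        exact hp1 w₀ hw₀ ψ hψm hne h
      subst this
      exact ⟨ψ, hψm, by rw [h]; ring⟩
  · have hQ0 : strictTransform m N k b g (0, w₁) ≠ 0 := fun h => hw₁ ((hroots w₁).2 h)
    have hcont : ContinuousAt (fun p : ℂ × ℂ => strictTransform m N k b g (p.1 ^ M, p.2))
        (0, w₁) := by
      refine ContinuousAt.comp (g := strictTransform m N k b g)
        (f := fun p : ℂ × ℂ => (p.1 ^ M, p.2)) ?_ (by fun_prop)
      simp only [zero_pow hM.ne']
      exact (analyticAt_strictTransform hN hk hb hg w₁).continuousAt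
    have hne0 := hcont.eventually_ne (y := 0) (by simpa only [zero_pow hM.ne'] using hQ0)
    filter_upwards [hother, hne0] with p hp1 hp2 hp0
    refine iff_of_false hp2 ?_
    rintro ⟨w₀, hw₀, ψ, hψm, h⟩
    exact hp1 w₀ hw₀ ψ hψm (fun h' => hw₁ (h' ▸ hw₀)) h

open Polynomial in
/-- **Puiseux's theorem**, as a description of the zero set: by induction on the order of the slice,
which drops under a Tschirnhaus shift followed by a strict transform. -/
theorem hasBranches_of_hasSliceOrder (m : ℕ) : ∀ {f : ℂ × ℂ → ℂ}, AnalyticAt ℂ f 0 →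
    HasSliceOrder f m → 0 < m → HasBranches f := by
  classical
  induction m using Nat.strong_induction_on with
  | _ m ih =>
  intro f hf hord hm
  obtain ⟨m, rfl⟩ : ∃ l, m = l + 1 := ⟨m - 1, by omega⟩
  obtain ⟨φ, a, g, hφ, hφ0, ha, hg, ha0, hg0, hexp⟩ := exists_tschirnhaus hf hord
  refine HasBranches.of_shift hφ hφ0 ?_
  set F := f ∘ shiftSnd φ with hF
  have hgne : ∀ᶠ p in 𝓝 (0 : ℂ × ℂ), ‖g 0‖ / 2 ≤ ‖g p‖ := by
    have h := hg.continuousAt.norm.eventually_const_lt (half_lt_self (norm_pos_iff.2 hg0))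
    exact h.mono fun p hp => hp.le
  by_cases hall : ∃ i < m, ¬ ∀ᶠ z in 𝓝 (0 : ℂ), a i z = 0
  swap
  · -- All lower coefficients vanish: the zero set is `w = 0`.
    push Not at hall
    have hall' : ∀ᶠ z in 𝓝 (0 : ℂ), ∀ i ∈ Finset.range m, a i z = 0 :=
      (Filter.eventually_all_finset _).2 fun i hi => hall i (Finset.mem_range.1 hi)
    refine ⟨1, {fun _ => 0}, one_pos, Set.finite_singleton _, Set.singleton_nonempty _, ?_, ?_⟩
    · rintro _ rfl
      exact ⟨analyticAt_const, rfl⟩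
    · filter_upwards [hexp, (continuous_fst.tendsto' (0 : ℂ × ℂ) 0 rfl).eventually hall', hgne]
        with p hp1 hp2 hp3 _
      have hgp : g p ≠ 0 := by
        rw [← norm_pos_iff]
        exact lt_of_lt_of_le (half_pos (norm_pos_iff.2 hg0)) hp3
      rw [pow_one, hF, Function.comp_apply, hp1,
        Finset.sum_eq_zero fun i hi => by rw [hp2 i hi, zero_mul]]
      simp [hgp]
  obtain ⟨N, k, b, hN, hk, hb, hab, hbne⟩ := exists_newton_slope ha ha0 hall
  have hstrict := eventually_eq_strictTransform (k := k) (f := F) hN hab hexp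
  -- The slice polynomial `q` of the strict transform has degree `m + 1` and no term of degree `m`,
  -- but is not a monomial: all its roots have multiplicity at most `m`, and the induction
  -- hypothesis applies at each of them.
  set Q := strictTransform m N k b g with hQ
  set q := slicePolynomial m (fun i => b i 0) (g 0) with hq
  have hdeg : q.natDegree = m + 1 := natDegree_slicePolynomial m _ hg0
  have hq0 : q ≠ 0 := by
    intro h
    rw [h] at hdeg
    simp at hdeg
  have hcoeffm : q.coeff m = 0 := by
    rw [hq, coeff_slicePolynomial, if_neg (lt_irrefl m), if_neg (by omega), add_zero]
  have hcoeffi : ∃ i < m, q.coeff i ≠ 0 := by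
    obtain ⟨i, hi, hbi⟩ := hbne
    refine ⟨i, hi, ?_⟩
    rw [hq, coeff_slicePolynomial, if_pos hi, if_neg (by omega), add_zero]
    exact hbi
  have hroot : ∀ w, w ∈ q.roots.toFinset ↔ Q (0, w) = 0 := by
    intro w
    rw [Multiset.mem_toFinset, mem_roots hq0, IsRoot, hQ, strictTransform_zero hN hk]
  have hIH : ∀ w, ∃ (n : ℕ) (Ψ : Set (ℂ → ℂ)), w ∈ q.roots.toFinset → (0 < n ∧ Ψ.Finite ∧
      Ψ.Nonempty ∧ (∀ ψ ∈ Ψ, AnalyticAt ℂ ψ 0 ∧ ψ 0 = 0) ∧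
      ∀ᶠ p in 𝓝 (0 : ℂ × ℂ), p.1 ≠ 0 → (Q (p.1 ^ n, w + p.2) = 0 ↔ ∃ ψ ∈ Ψ, p.2 = ψ p.1)) := by
    intro w
    by_cases hw : w ∈ q.roots.toFinset
    · have hmult : 0 < q.rootMultiplicity w := by
        rw [rootMultiplicity_pos hq0]
        exact (mem_roots hq0).1 (Multiset.mem_toFinset.1 hw)
      have hmult' := rootMultiplicity_le_of_coeff hdeg hcoeffm hcoeffi w
      have han : AnalyticAt ℂ (fun p : ℂ × ℂ => Q (p.1, w + p.2)) 0 := by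
        refine AnalyticAt.fun_comp (g := Q) (f := fun p : ℂ × ℂ => (p.1, w + p.2)) ?_
          (analyticAt_fst.prod (analyticAt_const.add analyticAt_snd))
        rw [Prod.fst_zero, Prod.snd_zero, add_zero]
        exact analyticAt_strictTransform hN hk hb hg w
      obtain ⟨n, Ψ, h1, h2, h3, h4, h5⟩ := ih (q.rootMultiplicity w) (by omega) han
        (hasSliceOrder_strictTransform (b := b) hN hk hg0 w) hmult
      exact ⟨n, Ψ, fun _ => ⟨h1, h2, h3, h4, h5⟩⟩
    · exact ⟨0, ∅, fun h => absurd h hw⟩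
  choose n Ψ hnΨ using hIH
  set R₀ := q.roots.toFinset with hR₀
  -- A common exponent for the parametrizations found at the roots.
  set M := ∏ w ∈ R₀, n w with hMdef
  have hM : 0 < M := Finset.prod_pos fun w hw => (hnΨ w hw).1
  set e : ℂ → ℕ := fun w => M / n w with he
  have hne : ∀ w ∈ R₀, e w * n w = M := fun w hw =>
    Nat.div_mul_cancel (Finset.dvd_prod_of_mem n hw)
  have hepos : ∀ w ∈ R₀, 0 < e w := fun w hw => by
    have := hne w hw
    by_contra h
    rw [Nat.eq_zero_of_not_pos h] at this
    omega
  have hRne : R₀.Nonempty := by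
    obtain ⟨w, hw⟩ := IsAlgClosed.exists_root q (by
      rw [degree_eq_natDegree hq0, hdeg]
      exact_mod_cast Nat.succ_ne_zero m)
    exact ⟨w, Multiset.mem_toFinset.2 ((mem_roots hq0).2 hw)⟩
  -- The zeros of the strict transform near `t = 0` satisfy `‖w‖ ≤ B`, so that the compact ball of
  -- radius `R` contains them, as well as the values of all the branches.
  set A : ℝ := ∑ i ∈ Finset.range m, (‖b i 0‖ + 1) with hA
  have hA0 : 0 ≤ A := Finset.sum_nonneg fun i _ => by positivity
  have hbA : ∀ᶠ t in 𝓝 (0 : ℂ), ∀ i ∈ Finset.range m, ‖b i t‖ ≤ A := by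
    refine (Filter.eventually_all_finset _).2 fun i hi => ?_
    have h := (hb i).continuousAt.norm.eventually_lt_const (lt_add_one ‖b i 0‖)
    refine h.mono fun t ht => ht.le.trans ?_
    exact Finset.single_le_sum (f := fun i => ‖b i 0‖ + 1) (fun i _ => by positivity) hi
  set B : ℝ := max 1 (m * A / (‖g 0‖ / 2)) with hB
  set R : ℝ := B + ∑ w ∈ R₀, (‖w‖ + 1) with hR
  have hsum0 : 0 ≤ ∑ w ∈ R₀, (‖w‖ + 1) := Finset.sum_nonneg fun w _ => by positivity
  have hB1 : 1 ≤ B := le_max_left _ _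
  have hunif := eventually_forall_strictTransform_eq_zero_iff (K := closedBall (0 : ℂ) R)
    hN hk hb hg hM
    R₀.finite_toSet (fun w => by rw [Finset.mem_coe]; exact hroot w) (n := n) (e := e)
    (fun w hw => hepos w (Finset.mem_coe.1 hw)) (fun w hw => hne w (Finset.mem_coe.1 hw))
    (Ψ := Ψ) (fun w hw => (hnΨ w (Finset.mem_coe.1 hw)).2.1)
    (fun w hw => (hnΨ w (Finset.mem_coe.1 hw)).2.2.2.1)
    (fun w hw => (hnΨ w (Finset.mem_coe.1 hw)).2.2.2.2)
    (isCompact_closedBall (0 : ℂ) R)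
  have hψsmall : ∀ᶠ s in 𝓝 (0 : ℂ), ∀ w ∈ R₀, ∀ ψ ∈ Ψ w, ‖ψ (s ^ e w)‖ ≤ 1 := by
    refine (Filter.eventually_all_finset _).2 fun w hw => ?_
    refine (Filter.eventually_all_finite (hnΨ w hw).2.1).2 fun ψ hψ => ?_
    obtain ⟨h1, h2⟩ := (hnΨ w hw).2.2.2.1 ψ hψ
    have hc : ContinuousAt (fun s : ℂ => ψ (s ^ e w)) 0 := by
      refine ContinuousAt.comp (g := ψ) (f := fun s : ℂ => s ^ e w) ?_ (by fun_prop)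
      simpa [(hepos w hw).ne'] using h1.continuousAt
    have h := hc.norm.eventually_lt_const (u := 1) (by
      simp [zero_pow (hepos w hw).ne', h2])
    exact h.mono fun s hs => hs.le
  refine ⟨M * N, {χ | ∃ w ∈ R₀, ∃ ψ ∈ Ψ w, χ = fun s => (s ^ M) ^ k * (w + ψ (s ^ e w))},
    Nat.mul_pos hM hN, ?_, ?_, ?_, ?_⟩
  · have : {χ : ℂ → ℂ | ∃ w ∈ R₀, ∃ ψ ∈ Ψ w, χ = fun s => (s ^ M) ^ k * (w + ψ (s ^ e w))} =
        ⋃ w ∈ R₀, (fun ψ s => (s ^ M) ^ k * (w + ψ (s ^ e w))) '' Ψ w := by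
      ext χ
      simp only [Set.mem_ofPred_eq, Set.mem_iUnion, Set.mem_image, exists_prop, eq_comm]
    rw [this]
    exact R₀.finite_toSet.biUnion fun w hw => (hnΨ w (Finset.mem_coe.1 hw)).2.1.image _
  · obtain ⟨w, hw⟩ := hRne
    obtain ⟨ψ, hψ⟩ := (hnΨ w hw).2.2.1
    exact ⟨_, w, hw, ψ, hψ, rfl⟩
  · rintro _ ⟨w, hw, ψ, hψ, rfl⟩
    obtain ⟨h1, h2⟩ := (hnΨ w hw).2.2.2.1 ψ hψ
    constructor
    · refine AnalyticAt.mul (by fun_prop) (analyticAt_const.add ?_)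
      refine AnalyticAt.fun_comp (g := ψ) (f := fun s : ℂ => s ^ e w) ?_ (by fun_prop)
      simpa [(hepos w hw).ne'] using h1
    · simp [hM.ne', hk.ne']
  · have htp : Filter.Tendsto (fun p : ℂ × ℂ => (p.1 ^ M, p.2)) (𝓝 0) (𝓝 0) :=
      (by fun_prop : Continuous fun p : ℂ × ℂ => (p.1 ^ M, p.2)).tendsto' _ _ (by simp [hM.ne'])
    have htp' : Filter.Tendsto (fun p : ℂ × ℂ => ((p.1 ^ M) ^ N, p.2)) (𝓝 0) (𝓝 0) :=
      (by fun_prop : Continuous fun p : ℂ × ℂ => ((p.1 ^ M) ^ N, p.2)).tendsto' _ _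
        (by simp [hM.ne', hN.ne'])
    have htf : Filter.Tendsto (fun p : ℂ × ℂ => p.1) (𝓝 0) (𝓝 0) :=
      continuous_fst.tendsto' (0 : ℂ × ℂ) 0 rfl
    have htfM : Filter.Tendsto (fun p : ℂ × ℂ => p.1 ^ M) (𝓝 0) (𝓝 0) :=
      (by fun_prop : Continuous fun p : ℂ × ℂ => p.1 ^ M).tendsto' _ _ (by simp [hM.ne'])
    filter_upwards [htp.eventually hstrict, htp'.eventually hgne, htf.eventually hunif,
      htf.eventually hψsmall, htfM.eventually hbA] with p hp1 hp2 hp3 hp4 hp5 hp0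
    have htM : p.1 ^ M ≠ 0 := pow_ne_zero _ hp0
    have htk : (p.1 ^ M) ^ k ≠ 0 := pow_ne_zero _ htM
    rw [pow_mul, hp1 htM, mul_eq_zero]
    simp only [pow_ne_zero _ htM, false_or]
    constructor
    · intro h
      have hw : ‖p.2 / (p.1 ^ M) ^ k‖ ≤ B := by
        refine norm_le_of_sum_add_pow_eq_zero (b := fun i => b i (p.1 ^ M)) (m := m)
          (half_pos (norm_pos_iff.2 hg0)) (fun i hi => hp5 i (Finset.mem_range.2 hi)) hA0 hp2 ?_
        rw [hQ, strictTransform] at h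
        simp only [mul_div_cancel₀ _ htk] at h
        exact h
      obtain ⟨w₀, hw₀, ψ, hψ, hh⟩ := (hp3 _ (by
        rw [mem_closedBall_zero_iff]
        linarith) hp0).1 h
      refine ⟨_, ⟨w₀, Finset.mem_coe.1 hw₀, ψ, hψ, rfl⟩, ?_⟩
      rw [← hh]
      field_simp
    · rintro ⟨_, ⟨w₀, hw₀, ψ, hψ, rfl⟩, h⟩
      have hw : p.2 / (p.1 ^ M) ^ k = w₀ + ψ (p.1 ^ e w₀) := by
        rw [h]
        field_simp
      refine (hp3 _ ?_ hp0).2 ⟨w₀, Finset.mem_coe.2 hw₀, ψ, hψ, hw⟩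
      rw [mem_closedBall_zero_iff, hw]
      have h1 : ‖w₀‖ + 1 ≤ ∑ w ∈ R₀, (‖w‖ + 1) :=
        Finset.single_le_sum (f := fun w : ℂ => ‖w‖ + 1) (fun w _ => by positivity) hw₀
      have h2 := norm_add_le w₀ (ψ (p.1 ^ e w₀))
      have h3 := hp4 w₀ hw₀ ψ hψ
      linarith

/-! ### The reduced equation -/

section ReducedEquation

open Polynomial

/-- The branches can be chosen with pairwise distinct germs, hence with pairwise distinct values
at every `t ≠ 0` near `0`. -/
theorem HasBranches.exists_distinct {f : ℂ × ℂ → ℂ} (h : HasBranches f) :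
    ∃ (N : ℕ) (Ψ : Finset (ℂ → ℂ)), 0 < N ∧ Ψ.Nonempty ∧
      (∀ ψ ∈ Ψ, AnalyticAt ℂ ψ 0 ∧ ψ 0 = 0) ∧
      (∀ᶠ t in 𝓝 (0 : ℂ), t ≠ 0 → Set.InjOn (fun ψ : ℂ → ℂ => ψ t) Ψ) ∧
      ∀ᶠ p in 𝓝 (0 : ℂ × ℂ), p.1 ≠ 0 → (f (p.1 ^ N, p.2) = 0 ↔ ∃ ψ ∈ Ψ, p.2 = ψ p.1) := by
  classical
  obtain ⟨N, Ψ, hN, hfin, hne, hΨ, hev⟩ := h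
  let _ : Setoid (ℂ → ℂ) := Filter.germSetoid (𝓝 (0 : ℂ)) ℂ
  -- A chosen representative of the germ of a function
  set rep : (ℂ → ℂ) → (ℂ → ℂ) := fun ψ => (⟦ψ⟧ : Quotient (Filter.germSetoid (𝓝 (0 : ℂ)) ℂ)).out
  have hrep : ∀ ψ, rep ψ =ᶠ[𝓝 0] ψ := fun ψ =>
    Quotient.mk_out (s := Filter.germSetoid (𝓝 (0 : ℂ)) ℂ) ψ
  have hrepeq : ∀ ψ χ, ψ =ᶠ[𝓝 0] χ → rep ψ = rep χ := by
    intro ψ χ h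
    have : (⟦ψ⟧ : Quotient (Filter.germSetoid (𝓝 (0 : ℂ)) ℂ)) = ⟦χ⟧ := Quotient.sound h
    simp only [rep, this]
  refine ⟨N, hfin.toFinset.image rep, hN, ?_, ?_, ?_, ?_⟩
  · exact (hfin.toFinset_nonempty.2 hne).image _
  · intro χ hχ
    obtain ⟨ψ, hψ, rfl⟩ := Finset.mem_image.1 hχ
    obtain ⟨h1, h2⟩ := hΨ ψ (hfin.mem_toFinset.1 hψ)
    exact ⟨h1.congr (hrep ψ).symm, by rw [(hrep ψ).self_of_nhds, h2]⟩
  · have hpair : ∀ χ₁ ∈ hfin.toFinset.image rep, ∀ χ₂ ∈ hfin.toFinset.image rep,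
        ∀ᶠ t in 𝓝 (0 : ℂ), t ≠ 0 → χ₁ t = χ₂ t → χ₁ = χ₂ := by
      intro χ₁ h₁ χ₂ h₂
      obtain ⟨ψ₁, hψ₁, rfl⟩ := Finset.mem_image.1 h₁
      obtain ⟨ψ₂, hψ₂, rfl⟩ := Finset.mem_image.1 h₂
      have ha₁ := (hΨ ψ₁ (hfin.mem_toFinset.1 hψ₁)).1.congr (hrep ψ₁).symm
      have ha₂ := (hΨ ψ₂ (hfin.mem_toFinset.1 hψ₂)).1.congr (hrep ψ₂).symm
      rcases ha₁.eventually_eq_or_eventually_ne ha₂ with h | h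
      · have : rep ψ₁ = rep ψ₂ :=
          hrepeq _ _ ((hrep ψ₁).symm.trans (Filter.EventuallyEq.trans h (hrep ψ₂)))
        exact Filter.Eventually.of_forall fun _ _ _ => this
      · rw [eventually_nhdsWithin_iff] at h
        exact h.mono fun t ht ht0 heq => absurd heq (ht ht0)
    have := (Filter.eventually_all_finset _).2 fun χ₁ h₁ =>
      (Filter.eventually_all_finset _).2 (hpair χ₁ h₁)
    exact this.mono fun t ht ht0 χ₁ h₁ χ₂ h₂ h => ht χ₁ h₁ χ₂ h₂ ht0 h
  · have hall : ∀ᶠ t in 𝓝 (0 : ℂ), ∀ ψ ∈ hfin.toFinset, rep ψ t = ψ t :=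
      (Filter.eventually_all_finset _).2 fun ψ _ => hrep ψ
    filter_upwards [hev, (continuous_fst.tendsto' (0 : ℂ × ℂ) 0 rfl).eventually hall]
      with p hp1 hp2 hp0
    rw [hp1 hp0]
    simp only [Finset.exists_mem_image, Set.Finite.mem_toFinset]
    exact exists_congr fun ψ => and_congr_right fun hψ => by
      rw [hp2 ψ (hfin.mem_toFinset.2 hψ)]

/-- The polynomial with roots `ψ t`, for `ψ ∈ Ψ`. -/
noncomputable def branchPolynomial (Ψ : Finset (ℂ → ℂ)) (t : ℂ) : ℂ[X] :=
  ∏ ψ ∈ Ψ, (X - C (ψ t))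

theorem analyticAt_coeff_branchPolynomial {Ψ : Finset (ℂ → ℂ)} {t₀ : ℂ}
    (hΨ : ∀ ψ ∈ Ψ, AnalyticAt ℂ ψ t₀) (i : ℕ) :
    AnalyticAt ℂ (fun t => (branchPolynomial Ψ t).coeff i) t₀ := by
  classical
  induction Ψ using Finset.induction_on generalizing i with
  | empty => simp only [branchPolynomial, Finset.prod_empty]; exact analyticAt_const
  | insert ψ Ψ hψ ih =>
    have hih := ih fun χ hχ => hΨ χ (Finset.mem_insert_of_mem hχ)
    have hψa := hΨ ψ (Finset.mem_insert_self _ _)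
    have heq : ∀ t, branchPolynomial (insert ψ Ψ) t =
        X * branchPolynomial Ψ t - C (ψ t) * branchPolynomial Ψ t := fun t => by
      rw [branchPolynomial, Finset.prod_insert hψ, sub_mul, branchPolynomial]
    simp only [heq, coeff_sub, coeff_C_mul]
    refine AnalyticAt.sub ?_ (hψa.mul (hih i))
    cases i with
    | zero => simp only [mul_coeff_zero, coeff_X_zero, zero_mul]; exact analyticAt_const
    | succ i => simp only [coeff_X_mul]; exact hih i

theorem eval_branchPolynomial (Ψ : Finset (ℂ → ℂ)) (t w : ℂ) :
    (branchPolynomial Ψ t).eval w = ∏ ψ ∈ Ψ, (w - ψ t) := by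
  simp [branchPolynomial, eval_prod]

theorem natDegree_branchPolynomial (Ψ : Finset (ℂ → ℂ)) (t : ℂ) :
    (branchPolynomial Ψ t).natDegree = Ψ.card := by
  simp [branchPolynomial]

/-- A function that is analytic as a function of `t = z ^ (1 / N)`, and depends on `z` only, is
analytic: away from `0` one may use a local branch of the root, and `0` is a removable
singularity. -/
theorem analyticAt_comp_nthRoot {N : ℕ} (hN : 0 < N) {c : ℂ → ℂ} (hc : AnalyticAt ℂ c 0)
    (hinv : ∀ᶠ t in 𝓝 (0 : ℂ), ∀ t', t ^ N = t' ^ N → c t = c t') :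
    AnalyticAt ℂ (fun z : ℂ => c (z ^ ((N : ℂ)⁻¹))) 0 := by
  have hroot : ∀ z : ℂ, (z ^ ((N : ℂ)⁻¹)) ^ N = z := fun z => Complex.cpow_nat_inv_pow z hN.ne'
  have hcont : ContinuousAt (fun z : ℂ => z ^ ((N : ℂ)⁻¹)) 0 := by
    refine Complex.continuousAt_cpow_const_of_re_pos (Or.inl le_rfl) ?_
    rw [← Complex.ofReal_natCast, ← Complex.ofReal_inv, Complex.ofReal_re]
    positivity
  have hr0 : (0 : ℂ) ^ ((N : ℂ)⁻¹) = 0 :=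
    Complex.zero_cpow (inv_ne_zero (by exact_mod_cast hN.ne'))
  have htend : Filter.Tendsto (fun z : ℂ => z ^ ((N : ℂ)⁻¹)) (𝓝 0) (𝓝 0) := by
    have := hcont.tendsto
    rwa [hr0] at this
  refine Complex.analyticAt_of_differentiable_on_punctured_nhds_of_continuousAt ?_ ?_
  · rw [eventually_nhdsWithin_iff]
    filter_upwards [htend.eventually hinv.eventually_nhds,
      htend.eventually hc.eventually_analyticAt] with z hz1 hz2 hz0
    set t := z ^ ((N : ℂ)⁻¹) with ht
    have ht0 : t ≠ 0 := by
      intro h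
      apply hz0
      have := hroot z
      rw [← ht, h, zero_pow hN.ne'] at this
      exact this.symm
    have hpow : HasStrictDerivAt (fun s : ℂ => s ^ N) ((N : ℂ) * t ^ (N - 1)) t :=
      hasStrictDerivAt_pow N t
    have hne : (N : ℂ) * t ^ (N - 1) ≠ 0 :=
      mul_ne_zero (by exact_mod_cast hN.ne') (pow_ne_zero _ ht0)
    set σ := hpow.localInverse _ _ _ hne with hσ
    have hσd := hpow.to_localInverse hne
    have htz : t ^ N = z := hroot z
    rw [htz] at hσd
    have hσz : σ z = t := by
      have := (hpow.hasStrictFDerivAt_equiv hne).localInverse_apply_image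
      rw [htz] at this
      exact this
    have hright : ∀ᶠ y in 𝓝 z, σ y ^ N = y := by
      have := (hpow.hasStrictFDerivAt_equiv hne).eventually_right_inverse
      rw [htz] at this
      exact this
    have hσt : Filter.Tendsto σ (𝓝 z) (𝓝 t) := by
      have := hσd.hasDerivAt.continuousAt.tendsto
      rwa [← hσ, hσz] at this
    have hd : DifferentiableAt ℂ (fun y => c (σ y)) z := by
      refine DifferentiableAt.comp (g := c) z ?_ hσd.hasDerivAt.differentiableAt
      rw [hσz]
      exact hz2.differentiableAt
    refine hd.congr_of_eventuallyEq ?_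
    filter_upwards [hσt.eventually hz1, hright] with y hy1 hy2
    exact (hy1 _ (by rw [hy2, hroot])).symm
  · refine ContinuousAt.comp (g := c) ?_ hcont
    rw [hr0]
    exact hc.continuousAt

/-- The reduced equation of a curve: it is analytic, has the same zeros near the origin, and,
after the substitution `z = t ^ N`, is a product of linear factors that are distinct for
`t ≠ 0`. -/
theorem exists_reduced_equation {f : ℂ × ℂ → ℂ} (hf : HasBranches f)
    (hf0 : ∀ᶠ w in 𝓝 (0 : ℂ), f (0, w) = 0 ↔ w = 0) :
    ∃ (P : ℂ × ℂ → ℂ) (N : ℕ) (Ψ : Finset (ℂ → ℂ)), AnalyticAt ℂ P 0 ∧ 0 < N ∧ Ψ.Nonempty ∧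
      (∀ ψ ∈ Ψ, AnalyticAt ℂ ψ 0 ∧ ψ 0 = 0) ∧
      (∀ᶠ t in 𝓝 (0 : ℂ), t ≠ 0 → Set.InjOn (fun ψ : ℂ → ℂ => ψ t) Ψ) ∧
      (∀ᶠ t in 𝓝 (0 : ℂ), ∀ w, P (t ^ N, w) = ∏ ψ ∈ Ψ, (w - ψ t)) ∧
      ∀ᶠ p in 𝓝 (0 : ℂ × ℂ), f p = 0 ↔ P p = 0 := by
  classical
  obtain ⟨N, Ψ, hN, hne, hΨ, hinj, hev⟩ := hf.exists_distinct
  have hroot : ∀ z : ℂ, (z ^ ((N : ℂ)⁻¹)) ^ N = z := fun z => Complex.cpow_nat_inv_pow z hN.ne'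
  -- The branch polynomial depends on `t ^ N` only, because it is determined by the set of its
  -- roots, which are the zeros of `f (t ^ N, ·)` near `0`.
  have hinv : ∀ᶠ t in 𝓝 (0 : ℂ), ∀ t', t ^ N = t' ^ N →
      branchPolynomial Ψ t = branchPolynomial Ψ t' := by
    obtain ⟨r, hr, hball⟩ := Metric.eventually_nhds_iff_ball.1 hev
    have hsmall : ∀ᶠ t in 𝓝 (0 : ℂ), ∀ ψ ∈ Ψ, ‖ψ t‖ < r :=
      (Filter.eventually_all_finset _).2 fun ψ hψ => by
        have := (hΨ ψ hψ).1.continuousAt.norm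
        exact this.eventually_lt_const (by simp only [(hΨ ψ hψ).2, norm_zero]; exact hr)
    obtain ⟨ρ, hρ, hball'⟩ := Metric.eventually_nhds_iff_ball.1 (hinj.and hsmall)
    filter_upwards [Metric.ball_mem_nhds (0 : ℂ) (lt_min hρ hr)] with t ht t' htt'
    rw [mem_ball_zero_iff] at ht
    have hnorm : ‖t'‖ = ‖t‖ := by
      have := congrArg norm htt'
      rw [norm_pow, norm_pow] at this
      exact (pow_left_inj₀ (norm_nonneg _) (norm_nonneg _) hN.ne').1 this.symm
    by_cases ht0 : t = 0
    · rw [ht0, norm_zero, norm_eq_zero] at hnorm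
      rw [ht0, hnorm]
    have ht0' : t' ≠ 0 := by
      rw [← norm_ne_zero_iff, hnorm]
      exact norm_ne_zero_iff.2 ht0
    have himage : ∀ s : ℂ, s ≠ 0 → ‖s‖ = ‖t‖ →
        branchPolynomial Ψ s = ∏ x ∈ Ψ.image (fun ψ => ψ s), (X - C x) := by
      intro s hs hst
      rw [Finset.prod_image]
      · rfl
      · exact (hball' s (by rw [mem_ball_zero_iff, hst]; exact ht.trans_le (min_le_left _ _))).1 hs
    have hmem : ∀ s : ℂ, s ≠ 0 → ‖s‖ = ‖t‖ → ∀ x, x ∈ Ψ.image (fun ψ => ψ s) ↔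
        ‖x‖ < r ∧ f (s ^ N, x) = 0 := by
      intro s hs hst x
      have hsr : ‖s‖ < r := by rw [hst]; exact ht.trans_le (min_le_right _ _)
      rw [Finset.mem_image]
      constructor
      · rintro ⟨ψ, hψ, rfl⟩
        have hψr := (hball' s (by
          rw [mem_ball_zero_iff, hst]; exact ht.trans_le (min_le_left _ _))).2 ψ hψ
        refine ⟨hψr, (hball (s, ψ s) ?_ hs).2 ⟨ψ, hψ, rfl⟩⟩
        rw [mem_ball_zero_iff, Prod.norm_mk]
        exact max_lt hsr hψr
      · rintro ⟨hx, h0⟩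
        obtain ⟨ψ, hψ, h⟩ := (hball (s, x) (by
          rw [mem_ball_zero_iff, Prod.norm_mk]
          exact max_lt hsr hx) hs).1 h0
        exact ⟨ψ, hψ, h.symm⟩
    rw [himage t ht0 rfl, himage t' ht0' hnorm]
    congr 1
    ext x
    rw [hmem t ht0 rfl, hmem t' ht0' hnorm, htt']
  set P : ℂ × ℂ → ℂ := fun p => ∑ i ∈ Finset.range (Ψ.card + 1),
    (branchPolynomial Ψ (p.1 ^ ((N : ℂ)⁻¹))).coeff i * p.2 ^ i with hP
  have hPeval : ∀ p : ℂ × ℂ, P p = (branchPolynomial Ψ (p.1 ^ ((N : ℂ)⁻¹))).eval p.2 := by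
    intro p
    rw [eval_eq_sum_range, natDegree_branchPolynomial]
  have hPt : ∀ᶠ t in 𝓝 (0 : ℂ), ∀ w, P (t ^ N, w) = ∏ ψ ∈ Ψ, (w - ψ t) := by
    filter_upwards [hinv] with t ht w
    rw [hPeval, ← ht _ (hroot _).symm, eval_branchPolynomial]
  refine ⟨P, N, Ψ, ?_, hN, hne, hΨ, hinj, hPt, ?_⟩
  · refine Finset.analyticAt_fun_sum _ fun i _ => AnalyticAt.mul ?_ (analyticAt_snd.pow i)
    have h1 := analyticAt_comp_nthRoot hN
      (analyticAt_coeff_branchPolynomial (fun ψ hψ => (hΨ ψ hψ).1) i)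
      (hinv.mono fun t ht t' h => by rw [ht t' h])
    exact AnalyticAt.fun_comp (f := Prod.fst) (x := (0 : ℂ × ℂ))
      (g := fun z : ℂ => (branchPolynomial Ψ (z ^ ((N : ℂ)⁻¹))).coeff i) h1 analyticAt_fst
  · have hcont : Filter.Tendsto (fun z : ℂ => z ^ ((N : ℂ)⁻¹)) (𝓝 0) (𝓝 0) := by
      have h := (Complex.continuousAt_cpow_const_of_re_pos (z := (0 : ℂ)) (w := (N : ℂ)⁻¹)
        (Or.inl le_rfl) (by
          rw [← Complex.ofReal_natCast, ← Complex.ofReal_inv, Complex.ofReal_re]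
          positivity)).tendsto
      rwa [Complex.zero_cpow (inv_ne_zero (by exact_mod_cast hN.ne'))] at h
    have hcont2 : Filter.Tendsto (fun p : ℂ × ℂ => (p.1 ^ ((N : ℂ)⁻¹), p.2)) (𝓝 0) (𝓝 0) :=
      (hcont.comp (continuous_fst.tendsto' (0 : ℂ × ℂ) 0 rfl)).prodMk_nhds
        (continuous_snd.tendsto' (0 : ℂ × ℂ) 0 rfl)
    have hfst : Filter.Tendsto (fun p : ℂ × ℂ => p.1 ^ ((N : ℂ)⁻¹)) (𝓝 0) (𝓝 0) :=
      hcont.comp (continuous_fst.tendsto' (0 : ℂ × ℂ) 0 rfl)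
    filter_upwards [hcont2.eventually hev, hfst.eventually hPt,
      (continuous_snd.tendsto' (0 : ℂ × ℂ) 0 rfl).eventually hf0] with p hp1 hp2 hp3
    have h2 := hp2 p.2
    rw [hroot] at h2
    change P p = _ at h2
    rw [h2, Finset.prod_eq_zero_iff]
    simp only [sub_eq_zero]
    by_cases hz : p.1 = 0
    · have hp : p = (0, p.2) := Prod.ext hz rfl
      have h0 : (0 : ℂ) ^ ((N : ℂ)⁻¹) = 0 :=
        Complex.zero_cpow (inv_ne_zero (by exact_mod_cast hN.ne'))
      rw [hp, hp3]
      simp only [h0]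
      constructor
      · intro h
        obtain ⟨ψ, hψ⟩ := hne
        exact ⟨ψ, hψ, by rw [h, (hΨ ψ hψ).2]⟩
      · rintro ⟨ψ, hψ, h⟩
        rw [h, (hΨ ψ hψ).2]
    · have ht : p.1 ^ ((N : ℂ)⁻¹) ≠ 0 := by
        intro h
        apply hz
        rw [← hroot p.1, h, zero_pow hN.ne']
      have h1 := hp1 ht
      simp only [hroot] at h1
      exact h1

end ReducedEquation

open scoped ComplexConjugate InnerProductSpace

/-! ### Transversality of the curve to the spheres -/

/-- The vector `(-w̄, z̄)`, which is orthogonal to `(z, w)` over `ℂ` and has the same norm. -/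
noncomputable def perp (x : C2) : C2 := !₂[-conj (x 1), conj (x 0)]

theorem inner_perp_self (x : C2) : ⟪x, perp x⟫_ℂ = 0 := by
  simp [perp, PiLp.inner_apply, Fin.sum_univ_two]
  ring

/-- The expansion of `y` in the orthogonal basis `x`, `perp x`, cleared of denominators. -/
theorem inner_smul_add_inner_perp_smul (x y : C2) :
    ⟪x, y⟫_ℂ • x + ⟪perp x, y⟫_ℂ • perp x = ((‖x‖ : ℂ) ^ 2) • y := by
  have hn : ((‖x‖ : ℂ) ^ 2) = x 0 * conj (x 0) + x 1 * conj (x 1) := by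
    have h : ((‖x‖ : ℂ) ^ 2) = ⟪x, x⟫_ℂ := (inner_self_eq_norm_sq_to_K x).symm
    rw [h, PiLp.inner_apply, Fin.sum_univ_two]
    rfl
  rw [hn]
  ext i
  fin_cases i <;> simp [perp, PiLp.inner_apply, Fin.sum_univ_two] <;> ring

/-- A nonzero linear form which vanishes on a vector that is not orthogonal to `x` does not vanish
on `perp x`. -/
theorem apply_perp_ne_zero {D : C2 →L[ℂ] ℂ} {x u v : C2} (hu : D u = 0) (hxu : ⟪x, u⟫_ℂ ≠ 0)
    (hv : D v ≠ 0) : D (perp x) ≠ 0 := by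
  intro h
  have hx : x ≠ 0 := by
    rintro rfl
    simp at hxu
  have key : ∀ y, ⟪x, y⟫_ℂ * D x = (‖x‖ : ℂ) ^ 2 * D y := by
    intro y
    have := congrArg D (inner_smul_add_inner_perp_smul x y)
    simpa [h] using this
  have hDx : D x = 0 := by
    have := key u
    rw [hu, mul_zero] at this
    exact (mul_eq_zero.1 this).resolve_left hxu
  have := key v
  rw [hDx, mul_zero] at this
  have hn : (‖x‖ : ℂ) ^ 2 ≠ 0 := pow_ne_zero _ (by exact_mod_cast norm_ne_zero_iff.2 hx)
  exact (mul_ne_zero hn hv) this.symm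

/-- A holomorphic arc through the origin is, near the origin, nowhere tangent to the spheres:
its leading term `t ^ k c` dominates. -/
theorem eventually_inner_deriv_ne_zero {γ : ℂ → C2} (hγ : AnalyticAt ℂ γ 0) (h0 : γ 0 = 0)
    (hne : ¬ ∀ᶠ t in 𝓝 (0 : ℂ), γ t = 0) :
    ∀ᶠ t in 𝓝 (0 : ℂ), t ≠ 0 → ⟪γ t, deriv γ t⟫_ℂ ≠ 0 := by
  obtain ⟨k, g, hg, hg0, hev⟩ := hγ.exists_eventuallyEq_pow_smul_nonzero_iff.2 hne
  simp only [sub_zero] at hev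
  have hk : k ≠ 0 := by
    rintro rfl
    have := hev.self_of_nhds
    rw [h0, pow_zero, one_smul] at this
    exact hg0 this.symm
  have hcont : ContinuousAt (fun t => (k : ℂ) * ⟪g t, g t⟫_ℂ + t * ⟪g t, deriv g t⟫_ℂ) 0 := by
    have h1 := hg.continuousAt
    have h2 := hg.deriv.continuousAt
    exact (continuousAt_const.mul (h1.inner (𝕜 := ℂ) h1)).add
      (continuousAt_id.mul (h1.inner (𝕜 := ℂ) h2))
  have hne0 : ∀ᶠ t in 𝓝 (0 : ℂ), (k : ℂ) * ⟪g t, g t⟫_ℂ + t * ⟪g t, deriv g t⟫_ℂ ≠ 0 := by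
    refine hcont.eventually_ne ?_
    rw [zero_mul, add_zero]
    exact mul_ne_zero (by exact_mod_cast hk) (inner_self_ne_zero.2 hg0)
  filter_upwards [hev.eventually_nhds, hg.eventually_analyticAt, hne0] with t ht1 ht2 ht3 ht0
  have hd : HasDerivAt γ (t ^ k • deriv g t + ((k : ℂ) * t ^ (k - 1)) • g t) t := by
    have h := (hasDerivAt_pow k t).smul ht2.differentiableAt.hasDerivAt
    exact HasDerivAt.congr_of_eventuallyEq h ht1
  rw [ht1.self_of_nhds, hd.deriv]
  intro h
  apply ht3
  have hpow : t ^ k = t ^ (k - 1) * t := by rw [← pow_succ, Nat.sub_add_cancel (by omega)]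
  simp only [inner_smul_left, inner_smul_right, inner_add_right] at h
  have hc : conj (t ^ k) * t ^ (k - 1) ≠ 0 :=
    mul_ne_zero ((map_ne_zero _).2 (pow_ne_zero _ ht0)) (pow_ne_zero _ ht0)
  refine (mul_eq_zero.1 ?_).resolve_left hc
  rw [← h, hpow]
  ring

/-- Some complex line through the origin is not contained, near the origin, in the zero set of a
nonzero analytic germ. -/
theorem exists_line_not_eventually_zero {f : C2 → ℂ} (hf : AnalyticAt ℂ f 0)
    (hne : ¬ ∀ᶠ x in 𝓝 0, f x = 0) : ∃ v : C2, ¬ ∀ᶠ l in 𝓝 (0 : ℂ), f (l • v) = 0 := by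
  by_contra! hall
  apply hne
  obtain ⟨r, hr, hball⟩ := Metric.eventually_nhds_iff_ball.1 hf.eventually_analyticAt
  filter_upwards [Metric.ball_mem_nhds (0 : C2) (half_pos hr)] with v hv
  rw [mem_ball_zero_iff] at hv
  have han : AnalyticOnNhd ℂ (fun l : ℂ => f (l • v)) (ball 0 2) := by
    intro l hl
    refine AnalyticAt.fun_comp (g := f) (f := fun l : ℂ => l • v) ?_
      (analyticAt_id.smul analyticAt_const)
    apply hball
    rw [mem_ball_zero_iff] at hl ⊢
    rw [norm_smul]
    nlinarith [norm_nonneg v, norm_nonneg l]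
  have h := han.eqOn_zero_of_preconnected_of_eventuallyEq_zero
    (convex_ball (0 : ℂ) 2).isPreconnected (mem_ball_self two_pos) (hall v)
  have h1 := h (show (1 : ℂ) ∈ ball (0 : ℂ) 2 by simp)
  simpa using h1

/-- Coordinates on `ℂ²` for which `v` spans the second axis. -/
theorem exists_coordinates {v : C2} (hv : v ≠ 0) :
    ∃ L : (ℂ × ℂ) ≃L[ℂ] C2, ∀ w : ℂ, L (0, w) = w • v := by
  let A : ℂ × ℂ →ₗ[ℂ] C2 :=
    (LinearMap.fst ℂ ℂ ℂ).smulRight (perp v) + (LinearMap.snd ℂ ℂ ℂ).smulRight v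
  have hA : ∀ p, A p = p.1 • perp v + p.2 • v := fun p => rfl
  have hinj : Function.Injective A := by
    rw [injective_iff_map_eq_zero]
    intro p hp
    rw [hA] at hp
    have hnorm : ⟪v, v⟫_ℂ ≠ 0 := inner_self_ne_zero.2 hv
    have h2 : p.2 = 0 := by
      have := congrArg (fun y => ⟪v, y⟫_ℂ) hp
      simp only [inner_add_right, inner_smul_right, inner_perp_self, mul_zero, zero_add,
        inner_zero_right] at this
      exact (mul_eq_zero.1 this).resolve_right hnorm
    have hperp : perp v ≠ 0 := by
      intro h
      have := inner_smul_add_inner_perp_smul v (perp v)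
      rw [h, inner_zero_right, zero_smul, inner_zero_right, zero_smul, smul_zero, add_zero] at this
      apply hv
      have h0 := congrArg (fun y : C2 => y 1) h
      have h1 := congrArg (fun y : C2 => y 0) h
      simp [perp] at h0 h1
      ext i
      fin_cases i
      · simpa using h0
      · simpa using h1
    rw [h2, zero_smul, add_zero, smul_eq_zero] at hp
    exact Prod.ext (hp.resolve_right hperp) h2
  let e := LinearEquiv.ofInjectiveOfFinrankEq A hinj (by simp)
  exact ⟨e.toContinuousLinearEquiv, fun w => by
    change A (0, w) = _
    rw [hA]
    simp⟩

theorem HasSliceOrder.eventually_eq_zero_iff {f : ℂ × ℂ → ℂ} {m : ℕ} (h : HasSliceOrder f m)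
    (hm : 0 < m) : ∀ᶠ w in 𝓝 (0 : ℂ), f (0, w) = 0 ↔ w = 0 := by
  obtain ⟨u, hu, hu0, hfu⟩ := h
  filter_upwards [hfu, hu.continuousAt.eventually_ne hu0] with w h1 h2
  rw [h1, mul_eq_zero, pow_eq_zero_iff hm.ne']
  simp [h2]

/-- The partial derivative of a product of distinct linear factors does not vanish at a root. -/
theorem derivSnd_ne_zero_of_prod {P : ℂ × ℂ → ℂ} {z : ℂ} {ι : Type*} {s : Finset ι} {r : ι → ℂ}
    (hP : ∀ w, P (z, w) = ∏ i ∈ s, (w - r i)) (hr : Set.InjOn r s) {i : ι} (hi : i ∈ s)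
    (hd : DifferentiableAt ℂ P (z, r i)) : derivSnd P (z, r i) ≠ 0 := by
  classical
  have h1 : HasDerivAt (fun w => P (z, w)) (derivSnd P (z, r i)) (r i) := by
    have h := hd.hasFDerivAt.comp_hasDerivAt (r i)
      ((hasDerivAt_const (r i) z).prodMk (hasDerivAt_id (r i)))
    exact h
  have h2 : HasDerivAt (fun w => ∏ j ∈ s, (w - r j)) (∏ j ∈ s.erase i, (r i - r j)) (r i) := by
    have hdiff : DifferentiableAt ℂ (fun w => ∏ j ∈ s.erase i, (w - r j)) (r i) := by fun_prop
    have h := ((hasDerivAt_id (r i)).sub_const (r i)).mul hdiff.hasDerivAt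
    have heq : (fun w => ∏ j ∈ s, (w - r j)) =
        fun w => (w - r i) * ∏ j ∈ s.erase i, (w - r j) := by
      funext w
      rw [Finset.mul_prod_erase s (fun j => w - r j) hi]
    rw [heq]
    refine HasDerivAt.congr_deriv h ?_
    simp
  have heq : (fun w => P (z, w)) = fun w => ∏ j ∈ s, (w - r j) := funext hP
  rw [heq] at h1
  rw [h1.unique h2, Finset.prod_ne_zero_iff]
  intro j hj
  rw [sub_ne_zero]
  intro h
  exact (Finset.mem_erase.1 hj).1 (hr hi (Finset.mem_coe.2 (Finset.mem_erase.1 hj).2) h).symm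

/-- A plane curve has, near the origin, an equation which is transverse to the spheres centred at
the origin at all zeros but the origin. -/
theorem IsCurveRepresentative.exists_transverse_equation {C : Set C2}
    (hC : IsCurveRepresentative C) :
    ∃ F : C2 → ℂ, AnalyticAt ℂ F 0 ∧ F 0 = 0 ∧ (∀ᶠ x in 𝓝 (0 : C2), x ∈ C ↔ F x = 0) ∧
      (∀ᶠ x in 𝓝 (0 : C2), x ≠ 0 → F x = 0 → fderiv ℂ F x (perp x) ≠ 0) ∧
      ∃ᶠ x in 𝓝[≠] (0 : C2), F x = 0 := by
  obtain ⟨f, hf, hf0, hfne, U, hU, hCU⟩ := hC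
  have hCf : ∀ᶠ x in 𝓝 (0 : C2), x ∈ C ↔ f x = 0 := by
    filter_upwards [hU] with x hx
    have : x ∈ C ∩ U ↔ x ∈ f ⁻¹' {0} ∩ U := by rw [hCU]
    simpa [hx] using this
  obtain ⟨v, hv⟩ := exists_line_not_eventually_zero hf hfne
  have hv0 : v ≠ 0 := by
    rintro rfl
    exact hv (Filter.Eventually.of_forall fun l => by rw [smul_zero, hf0])
  obtain ⟨L, hL⟩ := exists_coordinates hv0
  have hLan : ∀ p, AnalyticAt ℂ (fun p => L p) p := fun p => L.toContinuousLinearMap.analyticAt p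
  have hLsan : ∀ x, AnalyticAt ℂ (fun x => L.symm x) x := fun x =>
    L.symm.toContinuousLinearMap.analyticAt x
  have hLtend : Filter.Tendsto L (𝓝 0) (𝓝 0) := L.continuous.tendsto' _ _ (map_zero L)
  have hLstend : Filter.Tendsto L.symm (𝓝 0) (𝓝 0) := L.symm.continuous.tendsto' _ _ (map_zero _)
  have hG : AnalyticAt ℂ (fun p => f (L p)) 0 := by
    refine AnalyticAt.fun_comp (g := f) (f := fun p => L p) ?_ (hLan 0)
    rwa [map_zero]
  have hslice : ¬ ∀ᶠ w in 𝓝 (0 : ℂ), f (L (0, w)) = 0 := by simpa only [hL] using hv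
  obtain ⟨m, u, hu, hu0, hmu⟩ :=
    hG.slice_snd.exists_eventuallyEq_pow_smul_nonzero_iff.2 hslice
  have hord : HasSliceOrder (fun p => f (L p)) m := ⟨u, hu, hu0, by simpa using hmu⟩
  have hm : 0 < m := by
    rcases Nat.eq_zero_or_pos m with rfl | h
    · have := hmu.self_of_nhds
      rw [pow_zero, one_smul, hL, zero_smul, hf0] at this
      exact absurd this.symm hu0
    · exact h
  obtain ⟨P, N, Ψ, hP, hN, hne, hΨ, hinj, hPt, hfP⟩ := exists_reduced_equation
    (hasBranches_of_hasSliceOrder m hG hord hm) (hord.eventually_eq_zero_iff hm)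
  set F : C2 → ℂ := fun x => P (L.symm x) with hF
  have hFan : AnalyticAt ℂ F 0 := by
    refine AnalyticAt.fun_comp (g := P) (f := fun x => L.symm x) ?_ (hLsan 0)
    rwa [map_zero]
  have hP0 : P 0 = 0 := by
    refine hfP.self_of_nhds.1 ?_
    rw [map_zero, hf0]
  have hγan : ∀ ψ ∈ Ψ, AnalyticAt ℂ (fun t : ℂ => L (t ^ N, ψ t)) 0 := fun ψ hψ =>
    AnalyticAt.fun_comp (g := fun p => L p) (f := fun t : ℂ => (t ^ N, ψ t)) (hLan _)
      ((analyticAt_id.pow N).prod (hΨ ψ hψ).1)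
  have hγ0 : ∀ ψ ∈ Ψ, L ((0 : ℂ) ^ N, ψ 0) = 0 := fun ψ hψ => by
    rw [zero_pow hN.ne', (hΨ ψ hψ).2]
    exact map_zero L
  have hpair : ∀ ψ ∈ Ψ, Filter.Tendsto (fun t : ℂ => (t ^ N, ψ t)) (𝓝 0) (𝓝 0) := by
    intro ψ hψ
    have h := ((analyticAt_id (𝕜 := ℂ) (z := (0 : ℂ)).pow N).prod (hΨ ψ hψ).1).continuousAt.tendsto
    have h0 : ((0 : ℂ) ^ N, ψ 0) = (0 : ℂ × ℂ) := by
      rw [zero_pow hN.ne', (hΨ ψ hψ).2]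
      rfl
    exact h0 ▸ h
  have hPγ : ∀ ψ ∈ Ψ, ∀ᶠ t in 𝓝 (0 : ℂ), P (t ^ N, ψ t) = 0 := by
    intro ψ hψ
    filter_upwards [hPt] with t ht
    rw [ht]
    exact Finset.prod_eq_zero (f := fun χ : ℂ → ℂ => ψ t - χ t) hψ (sub_self _)
  have hγne : ∀ ψ ∈ Ψ, ∀ t : ℂ, t ≠ 0 → L (t ^ N, ψ t) ≠ 0 := by
    intro ψ _ t ht h
    rw [map_eq_zero_iff L L.injective] at h
    exact pow_ne_zero N ht (congrArg Prod.fst h)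
  -- Along each branch `γ`, the differential of `F` vanishes on `γ'`, which is not orthogonal to
  -- `γ`, but not on `v`, because the linear factors of `P` are distinct.
  have hbranch : ∀ᶠ t in 𝓝 (0 : ℂ), ∀ ψ ∈ Ψ, t ≠ 0 →
      fderiv ℂ F (L (t ^ N, ψ t)) (perp (L (t ^ N, ψ t))) ≠ 0 := by
    refine (Filter.eventually_all_finset _).2 fun ψ hψ => ?_
    have hnz : ¬ ∀ᶠ t in 𝓝 (0 : ℂ), L (t ^ N, ψ t) = 0 := by
      intro h
      obtain ⟨r, hr, hball⟩ := Metric.eventually_nhds_iff_ball.1 h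
      refine hγne ψ hψ (((r / 2 : ℝ)) : ℂ) (by exact_mod_cast (half_pos hr).ne') (hball _ ?_)
      rw [mem_ball_zero_iff, Complex.norm_real, Real.norm_of_nonneg (half_pos hr).le]
      exact half_lt_self hr
    filter_upwards [eventually_inner_deriv_ne_zero (hγan ψ hψ) (hγ0 ψ hψ) hnz, hinj, hPt,
      (hPγ ψ hψ).eventually_nhds, (hpair ψ hψ).eventually hP.eventually_analyticAt,
      (hγan ψ hψ).eventually_analyticAt] with t h1 h2 h3 h4 h5 h6 ht
    have hFd : HasFDerivAt F ((fderiv ℂ P (t ^ N, ψ t)).comp (L.symm : C2 →L[ℂ] ℂ × ℂ))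
        (L (t ^ N, ψ t)) := by
      refine HasFDerivAt.comp (g := P) _ ?_ L.symm.hasFDerivAt
      rw [L.symm_apply_apply]
      exact h5.differentiableAt.hasFDerivAt
    refine apply_perp_ne_zero (u := deriv (fun t : ℂ => L (t ^ N, ψ t)) t) (v := v) ?_ (h1 ht) ?_
    · have hc : HasDerivAt (fun s : ℂ => F (L (s ^ N, ψ s)))
          (fderiv ℂ F (L (t ^ N, ψ t)) (deriv (fun t : ℂ => L (t ^ N, ψ t)) t)) t :=
        HasFDerivAt.comp_hasDerivAt (l := F) (f := fun s : ℂ => L (s ^ N, ψ s)) t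
          hFd.differentiableAt.hasFDerivAt h6.differentiableAt.hasDerivAt
      refine hc.unique ((hasDerivAt_const t (0 : ℂ)).congr_of_eventuallyEq ?_)
      filter_upwards [h4] with s hs
      rw [hF]
      simp only [L.symm_apply_apply]
      exact hs
    · rw [hFd.fderiv]
      have hLv : L.symm v = (0, 1) := by
        rw [ContinuousLinearEquiv.symm_apply_eq, hL, one_smul]
      change fderiv ℂ P (t ^ N, ψ t) (L.symm v) ≠ 0
      rw [hLv]
      exact derivSnd_ne_zero_of_prod (r := fun χ : ℂ → ℂ => χ t) h3 (h2 ht) hψ h5.differentiableAt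
  have hroot : ∀ z : ℂ, (z ^ ((N : ℂ)⁻¹)) ^ N = z := fun z => Complex.cpow_nat_inv_pow z hN.ne'
  have hroott : Filter.Tendsto (fun x : C2 => (L.symm x).1 ^ ((N : ℂ)⁻¹)) (𝓝 0) (𝓝 0) := by
    have h := (Complex.continuousAt_cpow_const_of_re_pos (z := (0 : ℂ)) (w := (N : ℂ)⁻¹)
      (Or.inl le_rfl) (by
        rw [← Complex.ofReal_natCast, ← Complex.ofReal_inv, Complex.ofReal_re]
        positivity)).tendsto
    rw [Complex.zero_cpow (inv_ne_zero (by exact_mod_cast hN.ne'))] at h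
    exact h.comp ((continuous_fst.tendsto' (0 : ℂ × ℂ) 0 rfl).comp hLstend)
  refine ⟨F, hFan, ?_, ?_, ?_, ?_⟩
  · rw [hF]
    simp only [map_zero, hP0]
  · filter_upwards [hCf, hLstend.eventually hfP] with x h1 h2
    rw [h1, ← h2, L.apply_symm_apply]
  · filter_upwards [hroott.eventually hbranch, hroott.eventually hPt] with x h1 h2 hx0 hFx
    set t := (L.symm x).1 ^ ((N : ℂ)⁻¹) with ht
    have htN : t ^ N = (L.symm x).1 := hroot _
    have h3 := h2 (L.symm x).2
    rw [htN] at h3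
    change P (L.symm x) = _ at h3
    rw [show P (L.symm x) = 0 from hFx] at h3
    obtain ⟨ψ, hψ, h4⟩ := Finset.prod_eq_zero_iff.1 h3.symm
    rw [sub_eq_zero] at h4
    have hx : L (t ^ N, ψ t) = x := by
      rw [htN, ← h4]
      exact L.apply_symm_apply x
    have ht0 : t ≠ 0 := by
      intro h
      apply hx0
      rw [← hx, h]
      exact hγ0 ψ hψ
    have := h1 ψ hψ ht0
    rwa [hx] at this
  · obtain ⟨ψ, hψ⟩ := hne
    have htend : Filter.Tendsto (fun t : ℂ => L (t ^ N, ψ t)) (𝓝[≠] 0) (𝓝[≠] 0) := by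
      refine tendsto_nhdsWithin_iff.2 ⟨(hLtend.comp (hpair ψ hψ)).mono_left nhdsWithin_le_nhds, ?_⟩
      filter_upwards [self_mem_nhdsWithin] with t ht
      exact hγne ψ hψ t ht
    refine htend.frequently (Filter.Eventually.frequently ?_)
    filter_upwards [nhdsWithin_le_nhds (hPγ ψ hψ)] with t ht
    rw [hF]
    simp only [L.symm_apply_apply]
    exact ht

/-! ### Trajectories of tangential perturbations of the radial field -/

section Flow

variable {E : Type*} [NormedAddCommGroup E] [InnerProductSpace ℝ E]

/-- A vector field tangent to the spheres about the origin can be cut off outside an annulus,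
becoming globally Lipschitz and bounded while staying tangent to the spheres. -/
theorem exists_lipschitz_cutoff [FiniteDimensional ℝ E] {X : E → E} {r ε R : ℝ} (hr : 0 < r)
    (hε : ε < R) (hX : ContDiffOn ℝ 1 X (ball 0 R \ {0}))
    (ht : ∀ x ∈ ball (0 : E) R \ {0}, ⟪x, X x⟫_ℝ = 0) :
    ∃ (Y : E → E) (K M : NNReal), LipschitzWith K Y ∧ (∀ x, ‖Y x‖ ≤ M) ∧ (∀ x, ⟪x, Y x⟫_ℝ = 0) ∧
      ∀ x, r ≤ ‖x‖ → ‖x‖ ≤ ε → Y x = X x := by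
  have hs : IsClosed {x : E | ‖x‖ ≤ r / 2 ∨ (ε + R) / 2 ≤ ‖x‖} :=
    (isClosed_le continuous_norm continuous_const).union
      (isClosed_le continuous_const continuous_norm)
  have ht' : IsClosed {x : E | r ≤ ‖x‖ ∧ ‖x‖ ≤ ε} :=
    (isClosed_le continuous_const continuous_norm).inter
      (isClosed_le continuous_norm continuous_const)
  obtain ⟨χ, hχ0, hχ1, -⟩ := exists_contMDiffMap_zero_one_of_isClosed (n := 1) 𝓘(ℝ, E) hs ht' (by
    rw [Set.disjoint_left]
    rintro x (h | h) ⟨h1, h2⟩ <;> linarith)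
  have hχ : ContDiff ℝ 1 χ := χ.contMDiff.contDiff
  have hUo : IsOpen (ball (0 : E) R \ {0}) := isOpen_ball.sdiff isClosed_singleton
  have hout : ∀ x : E, x ∉ ball (0 : E) R \ {0} → ∀ᶠ y in 𝓝 x, χ y = 0 := by
    intro x hx
    by_cases h0 : x = 0
    · have : ∀ᶠ y in 𝓝 x, ‖y‖ < r / 2 :=
        continuous_norm.continuousAt.eventually_lt continuousAt_const (by simpa [h0] using hr)
      filter_upwards [this] with y hy
      exact hχ0 (Or.inl hy.le)
    · have hR : R ≤ ‖x‖ := by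
        by_contra! h
        exact hx ⟨by simpa using h, h0⟩
      have : ∀ᶠ y in 𝓝 x, (ε + R) / 2 < ‖y‖ :=
        continuousAt_const.eventually_lt continuous_norm.continuousAt (by linarith)
      filter_upwards [this] with y hy
      exact hχ0 (Or.inr hy.le)
  have hY : ContDiff ℝ 1 fun x => χ x • X x := by
    rw [contDiff_iff_contDiffAt]
    intro x
    by_cases hx : x ∈ ball (0 : E) R \ {0}
    · exact hχ.contDiffAt.smul (hX.contDiffAt (hUo.mem_nhds hx))
    · refine (contDiffAt_const (c := (0 : E))).congr_of_eventuallyEq ?_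
      filter_upwards [hout x hx] with y hy
      rw [hy, zero_smul]
  have hc : HasCompactSupport fun x => χ x • X x := by
    refine HasCompactSupport.intro (isCompact_closedBall (0 : E) R) fun x hx => ?_
    rw [(hout x fun h => hx (ball_subset_closedBall h.1)).self_of_nhds, zero_smul]
  obtain ⟨K, hK⟩ := ContDiff.lipschitzWith_of_hasCompactSupport hc hY one_ne_zero
  obtain ⟨M, hM⟩ := hc.exists_bound_of_continuous hY.continuous
  refine ⟨_, K, M.toNNReal, hK, fun x => (hM x).trans (Real.le_coe_toNNReal M), fun x => ?_,
    fun x h1 h2 => ?_⟩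
  · by_cases hx : x ∈ ball (0 : E) R \ {0}
    · rw [inner_smul_right, ht x hx, mul_zero]
    · rw [(hout x hx).self_of_nhds, zero_smul, inner_zero_right]
  · rw [show χ x = 1 from hχ1 ⟨h1, h2⟩, one_smul]

/-- `β` is a curve in the sphere of radius `ε`, defined for times in `[-T, 0]`, for which
`s ↦ exp s • β s` is an integral curve of the vector field `x ↦ x + X x`. -/
def IsSphericalTrajectory (X : E → E) (ε T : ℝ) (β : ℝ → E) : Prop :=
  ∀ s ∈ Set.Icc (-T) 0,
    HasDerivWithinAt β (Real.exp (-s) • X (Real.exp s • β s)) (Set.Icc (-T) 0) s ∧ ‖β s‖ = ε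

theorem IsSphericalTrajectory.mono {X : E → E} {ε T T' : ℝ} {β : ℝ → E}
    (h : IsSphericalTrajectory X ε T β) (hT : T' ≤ T) : IsSphericalTrajectory X ε T' β := by
  intro s hs
  have hsub : Set.Icc (-T') 0 ⊆ Set.Icc (-T) 0 := Set.Icc_subset_Icc_left (by linarith)
  exact ⟨(h s (hsub hs)).1.mono hsub, (h s (hsub hs)).2⟩

theorem IsSphericalTrajectory.continuousOn {X : E → E} {ε T : ℝ} {β : ℝ → E}
    (h : IsSphericalTrajectory X ε T β) : ContinuousOn β (Set.Icc (-T) 0) :=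
  fun s hs => (h s hs).1.continuousWithinAt

theorem lipschitzWith_rescale {Y : E → E} {K : NNReal} (hY : LipschitzWith K Y) (s : ℝ) :
    LipschitzWith K fun y => Real.exp (-s) • Y (Real.exp s • y) := by
  refine LipschitzWith.of_dist_le_mul fun x y => ?_
  have h := hY.dist_le_mul (Real.exp s • x) (Real.exp s • y)
  rw [dist_smul₀, Real.norm_of_nonneg (Real.exp_pos s).le] at h
  rw [dist_smul₀, Real.norm_of_nonneg (Real.exp_pos _).le]
  calc Real.exp (-s) * dist (Y (Real.exp s • x)) (Y (Real.exp s • y))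
      ≤ Real.exp (-s) * (K * (Real.exp s * dist x y)) := by gcongr
    _ = (Real.exp (-s) * Real.exp s) * (K * dist x y) := by ring
    _ = K * dist x y := by rw [← Real.exp_add, neg_add_cancel, Real.exp_zero, one_mul]

/-- Two trajectories that meet coincide. -/
theorem IsSphericalTrajectory.eqOn [FiniteDimensional ℝ E] {X : E → E} {ε R T : ℝ} (hε : 0 < ε)
    (hεR : ε < R) (hX : ContDiffOn ℝ 1 X (ball 0 R \ {0}))
    (ht : ∀ x ∈ ball (0 : E) R \ {0}, ⟪x, X x⟫_ℝ = 0) {β γ : ℝ → E}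
    (hβ : IsSphericalTrajectory X ε T β) (hγ : IsSphericalTrajectory X ε T γ) {s₀ : ℝ}
    (hs₀ : s₀ ∈ Set.Icc (-T) 0) (h : β s₀ = γ s₀) : Set.EqOn β γ (Set.Icc (-T) 0) := by
  obtain ⟨Y, K, -, hK, -, -, hYX⟩ := exists_lipschitz_cutoff (r := Real.exp (-T) * ε)
    (by positivity) hεR hX ht
  have key : ∀ {β : ℝ → E}, IsSphericalTrajectory X ε T β → ∀ s ∈ Set.Icc (-T) 0,
      HasDerivWithinAt β (Real.exp (-s) • Y (Real.exp s • β s)) (Set.Icc (-T) 0) s := by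
    intro β hβ s hs
    have hn : ‖Real.exp s • β s‖ = Real.exp s * ε := by
      rw [norm_smul, (hβ s hs).2, Real.norm_of_nonneg (Real.exp_pos s).le]
    have h1 : Real.exp (-T) ≤ Real.exp s := Real.exp_le_exp.2 hs.1
    have h2 : Real.exp s ≤ 1 := Real.exp_le_one_iff.2 hs.2
    rw [hYX _ (by rw [hn]; gcongr) (by rw [hn]; nlinarith)]
    exact (hβ s hs).1
  have hlip := fun (s : ℝ) (A : Set E) => (lipschitzWith_rescale hK s).lipschitzOnWith (s := A)
  have hR : Set.EqOn β γ (Set.Icc s₀ 0) := by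
    have hsub : Set.Icc s₀ 0 ⊆ Set.Icc (-T) 0 := Set.Icc_subset_Icc_left hs₀.1
    have hd : ∀ {β : ℝ → E}, IsSphericalTrajectory X ε T β → ∀ s ∈ Set.Ico s₀ 0,
        HasDerivWithinAt β (Real.exp (-s) • Y (Real.exp s • β s)) (Set.Ici s) s := by
      intro β hβ s hs
      refine (key hβ s (hsub ⟨hs.1, hs.2.le⟩)).mono_of_mem_nhdsWithin ?_
      exact Filter.mem_of_superset (Icc_mem_nhdsGE hs.2) (Set.Icc_subset_Icc_left
        (hs₀.1.trans hs.1))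
    exact ODE_solution_unique_of_mem_Icc_right (s := fun _ => Set.univ)
      (v := fun s y => Real.exp (-s) • Y (Real.exp s • y))
      (fun s _ => hlip s _) (hβ.continuousOn.mono hsub) (hd hβ) (fun _ _ => trivial)
      (hγ.continuousOn.mono hsub) (hd hγ) (fun _ _ => trivial) h
  have hL : Set.EqOn β γ (Set.Icc (-T) s₀) := by
    have hsub : Set.Icc (-T) s₀ ⊆ Set.Icc (-T) 0 := Set.Icc_subset_Icc_right hs₀.2
    have hd : ∀ {β : ℝ → E}, IsSphericalTrajectory X ε T β → ∀ s ∈ Set.Ioc (-T) s₀,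
        HasDerivWithinAt β (Real.exp (-s) • Y (Real.exp s • β s)) (Set.Iic s) s := by
      intro β hβ s hs
      refine (key hβ s (hsub ⟨hs.1.le, hs.2⟩)).mono_of_mem_nhdsWithin ?_
      exact Filter.mem_of_superset (Icc_mem_nhdsLE hs.1) (Set.Icc_subset_Icc_right
        (hs.2.trans hs₀.2))
    exact ODE_solution_unique_of_mem_Icc_left (s := fun _ => Set.univ)
      (v := fun s y => Real.exp (-s) • Y (Real.exp s • y))
      (fun s _ => hlip s _) (hβ.continuousOn.mono hsub) (hd hβ) (fun _ _ => trivial)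
      (hγ.continuousOn.mono hsub) (hd hγ) (fun _ _ => trivial) h
  intro s hs
  rcases le_total s s₀ with h1 | h1
  · exact hL ⟨hs.1, h1⟩
  · exact hR ⟨h1, hs.2⟩

/-- Trajectories exist through every point of the sphere and depend continuously on it. -/
theorem exists_sphericalTrajectory [FiniteDimensional ℝ E] {X : E → E} {ε R T : ℝ} (hε : 0 < ε)
    (hεR : ε < R) (hX : ContDiffOn ℝ 1 X (ball 0 R \ {0}))
    (ht : ∀ x ∈ ball (0 : E) R \ {0}, ⟪x, X x⟫_ℝ = 0) {t₀ : ℝ} (ht₀ : t₀ ∈ Set.Icc (-T) 0) :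
    ∃ α : E × ℝ → E,
      (∀ y, ‖y‖ = ε → α (y, t₀) = y ∧ IsSphericalTrajectory X ε T fun s => α (y, s)) ∧
      ContinuousOn α (sphere 0 ε ×ˢ Set.Icc (-T) 0) := by
  obtain ⟨Y, K, M, hK, hM, hYt, hYX⟩ := exists_lipschitz_cutoff (r := Real.exp (-T) * ε)
    (by positivity) hεR hX ht
  have hT : 0 ≤ T := by linarith [ht₀.1, ht₀.2]
  let L : NNReal := ⟨Real.exp T, (Real.exp_pos T).le⟩ * M
  let r : NNReal := ⟨ε, hε.le⟩
  have hPL : IsPicardLindelof (fun s y => Real.exp (-s) • Y (Real.exp s • y))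
      (⟨t₀, ht₀⟩ : Set.Icc (-T) 0) (0 : E) (r + L * ⟨T, hT⟩) r L K := by
    refine ⟨fun s _ => (lipschitzWith_rescale hK s).lipschitzOnWith, fun x _ => ?_,
      fun s hs x _ => ?_, ?_⟩
    · have := hK.continuous
      fun_prop
    · rw [norm_smul, Real.norm_of_nonneg (Real.exp_pos _).le]
      change _ ≤ Real.exp T * M
      have h1 : Real.exp (-s) ≤ Real.exp T := Real.exp_le_exp.2 (by linarith [hs.1])
      exact mul_le_mul h1 (hM _) (norm_nonneg _) (Real.exp_pos _).le
    · have h1 : max (0 - t₀) (t₀ - -T) ≤ T := max_le (by linarith [ht₀.1]) (by linarith [ht₀.2])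
      have h2 : (L : ℝ) * max (0 - t₀) (t₀ - -T) ≤ L * T := by gcongr
      push_cast
      change _ ≤ (r : ℝ) + L * T - r
      linarith
  obtain ⟨α, hα, hαc⟩ := hPL.exists_forall_mem_closedBall_eq_hasDerivWithinAt_continuousOn
  refine ⟨α, fun y hy => ?_, hαc.mono (Set.prod_mono sphere_subset_closedBall subset_rfl)⟩
  obtain ⟨h0, hd⟩ := hα y (by rw [mem_closedBall_zero_iff, hy]; rfl)
  refine ⟨h0, ?_⟩
  have hnorm : ∀ s ∈ Set.Icc (-T) 0, ‖α (y, s)‖ = ε := by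
    intro s hs
    have hd' : ∀ s ∈ Set.Icc (-T) 0,
        HasDerivWithinAt (fun s => ‖α (y, s)‖ ^ 2) 0 (Set.Icc (-T) 0) s := by
      intro s hs
      have h := (hd s hs).norm_sq
      have h2 := hYt (Real.exp s • α (y, s))
      rw [inner_smul_left] at h2
      have h3 : ⟪α (y, s), Y (Real.exp s • α (y, s))⟫_ℝ = 0 :=
        (mul_eq_zero.1 h2).resolve_left (by simp)
      rwa [inner_smul_right, h3, mul_zero, mul_zero] at h
    have h := (convex_Icc (-T) 0).norm_image_sub_le_of_norm_hasDerivWithin_le hd'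
      (C := 0) (by simp) ht₀ hs
    rw [zero_mul] at h
    have h4 : ‖α (y, s)‖ ^ 2 = ε ^ 2 := by
      have := sub_eq_zero.1 (norm_le_zero_iff.1 h)
      rw [this]
      change ‖α (y, t₀)‖ ^ 2 = _
      rw [show α (y, t₀) = y from h0, hy]
    exact (pow_left_inj₀ (norm_nonneg _) hε.le two_ne_zero).1 h4
  intro s hs
  refine ⟨?_, hnorm s hs⟩
  have hn : ‖Real.exp s • α (y, s)‖ = Real.exp s * ε := by
    rw [norm_smul, hnorm s hs, Real.norm_of_nonneg (Real.exp_pos s).le]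
  have h1 : Real.exp (-T) ≤ Real.exp s := Real.exp_le_exp.2 hs.1
  have h2 : Real.exp s ≤ 1 := Real.exp_le_one_iff.2 hs.2
  rw [← hYX _ (by rw [hn]; gcongr) (by rw [hn]; nlinarith)]
  exact hd s hs

end Flow

/-! ### The flow map of the ball -/

section RadialFlow

theorem log_div_norm_nonneg {E : Type*} [NormedAddCommGroup E] {x : E} {ε : ℝ}
    (hx : x ≠ 0) (h : ‖x‖ ≤ ε) : 0 ≤ Real.log (ε / ‖x‖) :=
  Real.log_nonneg ((one_le_div (norm_pos_iff.2 hx)).2 h)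

variable {E : Type*} [NormedAddCommGroup E] [InnerProductSpace ℝ E]

/-- The defining property of the flow map: it preserves the norm and carries a nonzero point `x`
to the point of norm `‖x‖` on the trajectory that leaves the sphere of radius `ε` at the radial
projection of `x`. -/
def IsRadialFlow (X : E → E) (ε : ℝ) (k : E → E) : Prop :=
  k 0 = 0 ∧ ∀ x : E, x ≠ 0 → ‖x‖ ≤ ε → ∃ β : ℝ → E,
    IsSphericalTrajectory X ε (Real.log (ε / ‖x‖)) β ∧ β 0 = (ε / ‖x‖) • x ∧
      k x = (‖x‖ / ε) • β (-Real.log (ε / ‖x‖))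

theorem norm_div_norm_smul {x : E} {ε : ℝ} (hε : 0 < ε) (hx : x ≠ 0) : ‖(ε / ‖x‖) • x‖ = ε := by
  have := norm_pos_iff.2 hx
  rw [norm_smul, Real.norm_of_nonneg (by positivity)]
  field_simp

theorem exists_isRadialFlow [FiniteDimensional ℝ E] {X : E → E} {ε R : ℝ} (hε : 0 < ε)
    (hεR : ε < R) (hX : ContDiffOn ℝ 1 X (ball 0 R \ {0}))
    (ht : ∀ x ∈ ball (0 : E) R \ {0}, ⟪x, X x⟫_ℝ = 0) : ∃ k : E → E, IsRadialFlow X ε k := by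
  have h : ∀ x : E, ∃ z : E, (x = 0 → z = 0) ∧ (x ≠ 0 → ‖x‖ ≤ ε → ∃ β : ℝ → E,
      IsSphericalTrajectory X ε (Real.log (ε / ‖x‖)) β ∧ β 0 = (ε / ‖x‖) • x ∧
        z = (‖x‖ / ε) • β (-Real.log (ε / ‖x‖))) := by
    intro x
    by_cases hx : x ≠ 0 ∧ ‖x‖ ≤ ε
    · have h0 := log_div_norm_nonneg hx.1 hx.2
      obtain ⟨α, hα, -⟩ := exists_sphericalTrajectory hε hεR hX ht
        (T := Real.log (ε / ‖x‖)) (t₀ := 0) ⟨by linarith, le_rfl⟩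
      obtain ⟨h1, h2⟩ := hα _ (norm_div_norm_smul hε hx.1)
      exact ⟨_, fun h => absurd h hx.1, fun _ _ => ⟨_, h2, h1, rfl⟩⟩
    · exact ⟨0, fun _ => rfl, fun h1 h2 => absurd ⟨h1, h2⟩ hx⟩
  choose k hk0 hk using h
  exact ⟨k, hk0 0 rfl, hk⟩

variable {X k : E → E} {ε R : ℝ}

theorem IsRadialFlow.norm_eq (hk : IsRadialFlow X ε k) (hε : 0 < ε) {x : E} (hx : ‖x‖ ≤ ε) :
    ‖k x‖ = ‖x‖ := by
  by_cases h0 : x = 0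
  · rw [h0, hk.1]
  obtain ⟨β, hβ, -, hβk⟩ := hk.2 x h0 hx
  have hl := log_div_norm_nonneg h0 hx
  rw [hβk, norm_smul, (hβ _ ⟨le_rfl, by linarith⟩).2, Real.norm_of_nonneg (by positivity)]
  field_simp

theorem IsRadialFlow.eq_self (hk : IsRadialFlow X ε k) (hε : 0 < ε) {x : E} (hx : ‖x‖ = ε) :
    k x = x := by
  have h0 : x ≠ 0 := norm_pos_iff.1 (hx ▸ hε)
  obtain ⟨β, -, hβ, hβk⟩ := hk.2 x h0 hx.le
  rw [hx, div_self hε.ne'] at hβ hβk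
  rw [hβk, Real.log_one, neg_zero, hβ, one_smul, one_smul]

theorem IsRadialFlow.injOn [FiniteDimensional ℝ E] (hk : IsRadialFlow X ε k) (hε : 0 < ε)
    (hεR : ε < R) (hX : ContDiffOn ℝ 1 X (ball 0 R \ {0}))
    (ht : ∀ x ∈ ball (0 : E) R \ {0}, ⟪x, X x⟫_ℝ = 0) : Set.InjOn k (closedBall 0 ε) := by
  intro x hx y hy hxy
  rw [mem_closedBall_zero_iff] at hx hy
  have hn : ‖x‖ = ‖y‖ := by rw [← hk.norm_eq hε hx, hxy, hk.norm_eq hε hy]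
  by_cases h0 : x = 0
  · rw [h0, norm_zero] at hn
    rw [h0, norm_eq_zero.1 hn.symm]
  have hy0 : y ≠ 0 := norm_pos_iff.1 (hn ▸ norm_pos_iff.2 h0)
  obtain ⟨β, hβ, hβ0, hβk⟩ := hk.2 x h0 hx
  obtain ⟨γ, hγ, hγ0, hγk⟩ := hk.2 y hy0 hy
  have hl := log_div_norm_nonneg h0 hx
  have hpos := norm_pos_iff.2 h0
  rw [← hn] at hγ hγ0 hγk
  rw [hβk, hγk] at hxy
  have h1 := smul_right_injective E (div_pos hpos hε).ne' hxy
  have h2 := hβ.eqOn hε hεR hX ht hγ ⟨le_rfl, by linarith⟩ h1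
    (show (0 : ℝ) ∈ _ from ⟨by linarith, le_rfl⟩)
  rw [hβ0, hγ0] at h2
  exact smul_right_injective E (div_pos hε hpos).ne' h2

theorem IsRadialFlow.surjOn [FiniteDimensional ℝ E] (hk : IsRadialFlow X ε k) (hε : 0 < ε)
    (hεR : ε < R) (hX : ContDiffOn ℝ 1 X (ball 0 R \ {0}))
    (ht : ∀ x ∈ ball (0 : E) R \ {0}, ⟪x, X x⟫_ℝ = 0) :
    Set.SurjOn k (closedBall 0 ε) (closedBall 0 ε) := by
  intro y hy
  rw [mem_closedBall_zero_iff] at hy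
  by_cases h0 : y = 0
  · exact ⟨0, by simpa using hε.le, by rw [hk.1, h0]⟩
  have hpos := norm_pos_iff.2 h0
  have hl := log_div_norm_nonneg h0 hy
  obtain ⟨α, hα, -⟩ := exists_sphericalTrajectory hε hεR hX ht
    (T := Real.log (ε / ‖y‖)) (t₀ := -Real.log (ε / ‖y‖)) ⟨le_rfl, by linarith⟩
  obtain ⟨h1, h2⟩ := hα _ (norm_div_norm_smul hε h0)
  have hn0 := (h2 0 ⟨by linarith, le_rfl⟩).2
  set β := fun s => α ((ε / ‖y‖) • y, s)
  have hxn : ‖(‖y‖ / ε) • β 0‖ = ‖y‖ := by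
    rw [norm_smul, hn0, Real.norm_of_nonneg (by positivity)]
    field_simp
  refine ⟨(‖y‖ / ε) • β 0, by rwa [mem_closedBall_zero_iff, hxn], ?_⟩
  have hx0 : (‖y‖ / ε) • β 0 ≠ 0 := norm_pos_iff.1 (by rwa [hxn])
  obtain ⟨γ, hγ, hγ0, hγk⟩ := hk.2 _ hx0 (hxn.trans_le hy)
  rw [hxn] at hγ hγ0 hγk
  rw [smul_smul, div_mul_div_cancel₀ hpos.ne', div_self hε.ne', one_smul] at hγ0
  have h3 := hγ.eqOn hε hεR hX ht h2 ⟨by linarith, le_rfl⟩ hγ0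
    (show -Real.log (ε / ‖y‖) ∈ _ from ⟨le_rfl, by linarith⟩)
  rw [hγk, h3]
  change (‖y‖ / ε) • α ((ε / ‖y‖) • y, _) = y
  rw [h1, smul_smul, div_mul_div_cancel₀ hε.ne', div_self hpos.ne', one_smul]

theorem IsRadialFlow.continuousOn [FiniteDimensional ℝ E] (hk : IsRadialFlow X ε k) (hε : 0 < ε)
    (hεR : ε < R) (hX : ContDiffOn ℝ 1 X (ball 0 R \ {0}))
    (ht : ∀ x ∈ ball (0 : E) R \ {0}, ⟪x, X x⟫_ℝ = 0) : ContinuousOn k (closedBall 0 ε) := by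
  intro x hx
  by_cases h0 : x = 0
  · rw [h0, ContinuousWithinAt, hk.1, tendsto_zero_iff_norm_tendsto_zero]
    have h1 : Filter.Tendsto (fun y : E => ‖y‖) (𝓝[closedBall 0 ε] 0) (𝓝 0) := by
      have h := (continuous_norm (E := E)).continuousWithinAt (s := closedBall 0 ε) (x := 0)
      rwa [ContinuousWithinAt, norm_zero] at h
    refine h1.congr' ?_
    filter_upwards [self_mem_nhdsWithin] with y hy
    exact (hk.norm_eq hε (mem_closedBall_zero_iff.1 hy)).symm
  have hpos := norm_pos_iff.2 h0
  -- On the annulus `‖x‖ / 2 < ‖y‖ ≤ ε` all the trajectories are defined on `[-T, 0]`.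
  set T := Real.log (ε / (‖x‖ / 2)) with hTdef
  have hxε : ‖x‖ ≤ ε := mem_closedBall_zero_iff.1 hx
  have hT : 0 ≤ T := Real.log_nonneg ((one_le_div (by positivity)).2 (by linarith))
  obtain ⟨α, hα, hαc⟩ := exists_sphericalTrajectory hε hεR hX ht (T := T) (t₀ := 0)
    ⟨by linarith, le_rfl⟩
  set A : Set E := {y | ‖x‖ / 2 < ‖y‖ ∧ ‖y‖ ≤ ε} with hA
  have hAx : A ∈ 𝓝[closedBall 0 ε] x := by
    have h1 : ∀ᶠ y in 𝓝 x, ‖x‖ / 2 < ‖y‖ :=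
      continuousAt_const.eventually_lt continuous_norm.continuousAt (by linarith)
    filter_upwards [self_mem_nhdsWithin, h1.filter_mono nhdsWithin_le_nhds] with y h2 h3
    exact ⟨h3, mem_closedBall_zero_iff.1 h2⟩
  have hA0 : ∀ y ∈ A, y ≠ 0 := fun y hy => norm_pos_iff.1 ((half_pos hpos).trans hy.1)
  have hAT : ∀ y ∈ A, -Real.log (ε / ‖y‖) ∈ Set.Icc (-T) 0 := by
    intro y hy
    have hlog : Real.log (ε / ‖y‖) ≤ T :=
      Real.log_le_log (div_pos hε (norm_pos_iff.2 (hA0 y hy)))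
        (div_le_div_of_nonneg_left hε.le (half_pos hpos) hy.1.le)
    exact ⟨by linarith, by linarith [log_div_norm_nonneg (hA0 y hy) hy.2]⟩
  have hkA : ∀ y ∈ A,
      k y = (‖y‖ / ε) • α ((ε / ‖y‖) • y, -Real.log (ε / ‖y‖)) := by
    intro y hy
    obtain ⟨β, hβ, hβ0, hβk⟩ := hk.2 y (hA0 y hy) hy.2
    obtain ⟨h1, h2⟩ := hα _ (norm_div_norm_smul hε (hA0 y hy))
    have hl := log_div_norm_nonneg (hA0 y hy) hy.2
    have h3 := (h2.mono (by linarith [(hAT y hy).1])).eqOn hε hεR hX ht hβ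
      (s₀ := 0) ⟨by linarith, le_rfl⟩ (by rw [hβ0]; exact h1)
      (show -Real.log (ε / ‖y‖) ∈ _ from ⟨le_rfl, by linarith⟩)
    rw [hβk, ← h3]
  have hc : ContinuousOn (fun y => (‖y‖ / ε) • α ((ε / ‖y‖) • y, -Real.log (ε / ‖y‖))) A := by
    have hdiv : ContinuousOn (fun y : E => ε / ‖y‖) A :=
      continuousOn_const.div continuous_norm.continuousOn fun y hy => norm_ne_zero_iff.2 (hA0 y hy)
    refine ((continuous_norm.continuousOn).div_const ε).smul (hαc.comp
      ((hdiv.smul continuousOn_id).prodMk (hdiv.log fun y hy => ?_).neg) fun y hy => ?_)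
    · exact (div_pos hε (norm_pos_iff.2 (hA0 y hy))).ne'
    · exact ⟨mem_sphere_zero_iff_norm.2 (norm_div_norm_smul hε (hA0 y hy)), hAT y hy⟩
  have hxA : x ∈ A := ⟨by linarith, hxε⟩
  have h1 : ContinuousWithinAt k A x := (hc x hxA).congr hkA (hkA x hxA)
  exact h1.mono_of_mem_nhdsWithin hAx

/-- The radial flow restricts to a homeomorphism of the closed ball. -/
theorem IsRadialFlow.exists_homeomorph [FiniteDimensional ℝ E] (hk : IsRadialFlow X ε k)
    (hε : 0 < ε) (hεR : ε < R) (hX : ContDiffOn ℝ 1 X (ball 0 R \ {0}))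
    (ht : ∀ x ∈ ball (0 : E) R \ {0}, ⟪x, X x⟫_ℝ = 0) :
    ∃ h : closedBall (0 : E) ε ≃ₜ closedBall (0 : E) ε, ∀ x, (h x : E) = k x := by
  have hmaps : Set.MapsTo k (closedBall 0 ε) (closedBall 0 ε) := by
    intro x hx
    rw [mem_closedBall_zero_iff] at hx ⊢
    rwa [hk.norm_eq hε hx]
  have hb : Set.BijOn k (closedBall 0 ε) (closedBall 0 ε) :=
    ⟨hmaps, hk.injOn hε hεR hX ht, hk.surjOn hε hεR hX ht⟩
  have hc : Continuous (hb.equiv k) :=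
    (hk.continuousOn hε hεR hX ht).domRestrict.subtype_mk fun x => hmaps x.2
  exact ⟨hc.homeoOfEquivCompactToT2, fun x => rfl⟩

end RadialFlow

/-! ### The vector field of a transverse equation -/

/-- A solution of a linear scalar equation vanishes at one end if and only if it vanishes at the
other. -/
theorem eq_zero_iff_of_hasDerivWithinAt_mul {a b : ℝ} (hab : a ≤ b) {φ κ : ℝ → ℂ}
    (hκ : ContinuousOn κ (Set.Icc a b))
    (hφ : ∀ s ∈ Set.Icc a b, HasDerivWithinAt φ (κ s * φ s) (Set.Icc a b) s) :
    φ a = 0 ↔ φ b = 0 := by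
  obtain ⟨K, hK⟩ := isCompact_Icc.exists_bound_of_continuousOn hκ
  have hlip : ∀ s ∈ Set.Icc a b,
      LipschitzOnWith K.toNNReal (fun z : ℂ => κ s * z) Set.univ := by
    intro s hs
    refine LipschitzOnWith.of_dist_le_mul fun x _ y _ => ?_
    rw [dist_eq_norm, dist_eq_norm, ← mul_sub, norm_mul]
    gcongr
    exact (hK s hs).trans (Real.le_coe_toNNReal K)
  have hc : ContinuousOn φ (Set.Icc a b) := fun s hs => (hφ s hs).continuousWithinAt
  constructor <;> intro h
  · have h1 := ODE_solution_unique_of_mem_Icc_right (v := fun s z => κ s * z)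
      (s := fun _ => Set.univ) (g := fun _ => (0 : ℂ)) (fun s hs => hlip s ⟨hs.1, hs.2.le⟩) hc
      (fun s hs => (hφ s ⟨hs.1, hs.2.le⟩).mono_of_mem_nhdsWithin
        (Filter.mem_of_superset (Icc_mem_nhdsGE hs.2) (Set.Icc_subset_Icc_left hs.1)))
      (fun _ _ => trivial) continuousOn_const
      (fun s _ => by simpa using hasDerivWithinAt_const s _ (0 : ℂ)) (fun _ _ => trivial) h
    exact h1 ⟨hab, le_rfl⟩
  · have h1 := ODE_solution_unique_of_mem_Icc_left (v := fun s z => κ s * z)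
      (s := fun _ => Set.univ) (g := fun _ => (0 : ℂ)) (fun s hs => hlip s ⟨hs.1.le, hs.2⟩) hc
      (fun s hs => (hφ s ⟨hs.1.le, hs.2⟩).mono_of_mem_nhdsWithin
        (Filter.mem_of_superset (Icc_mem_nhdsLE hs.1) (Set.Icc_subset_Icc_right hs.2)))
      (fun _ _ => trivial) continuousOn_const
      (fun s _ => by simpa using hasDerivWithinAt_const s _ (0 : ℂ)) (fun _ _ => trivial) h
    exact h1 ⟨le_rfl, hab⟩

/-- `F` is an equation for `C` in the ball of radius `R`, and its zero set is transverse to the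
spheres about the origin: at a zero `x ≠ 0` the differential of `F` does not vanish on the complex
line orthogonal to `x`. The origin is an accumulation point of the zeros. -/
structure IsTransverseEquation (C : Set C2) (F : C2 → ℂ) (R : ℝ) : Prop where
  analyticAt : ∀ x ∈ ball (0 : C2) R, AnalyticAt ℂ F x
  mem_iff : ∀ x ∈ ball (0 : C2) R, x ∈ C ↔ F x = 0
  transverse : ∀ x ∈ ball (0 : C2) R, x ≠ 0 → F x = 0 → fderiv ℂ F x (perp x) ≠ 0
  map_zero : F 0 = 0
  frequently : ∃ᶠ x in 𝓝[≠] (0 : C2), F x = 0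

theorem IsCurveRepresentative.exists_isTransverseEquation {C : Set C2}
    (hC : IsCurveRepresentative C) : ∃ F R, 0 < R ∧ IsTransverseEquation C F R := by
  obtain ⟨F, hF, h0, h1, h2, h3⟩ := hC.exists_transverse_equation
  obtain ⟨R, hR, h⟩ := Metric.eventually_nhds_iff_ball.1
    (hF.eventually_analyticAt.and (h1.and h2))
  exact ⟨F, R, hR, fun x hx => (h x hx).1, fun x hx => (h x hx).2.1, fun x hx => (h x hx).2.2,
    h0, h3⟩

/-- A vector field tangent to the spheres about the origin which, added to the radial field
`x ↦ x`, makes the derivative of `F` along the sum a multiple of `F`. With `a = dF (perp x)` and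
`b = dF x`, the coefficient `-b / a` would make that derivative zero; since `a` may vanish off the
curve, it is replaced by `-(conj a * b) / (|a|² + |F|²)`. -/
noncomputable def tangentialField (F : C2 → ℂ) (x : C2) : C2 :=
  -(conj (fderiv ℂ F x (perp x)) * fderiv ℂ F x x /
    (fderiv ℂ F x (perp x) * conj (fderiv ℂ F x (perp x)) + F x * conj (F x))) • perp x

/-- The logarithmic derivative of `F` along `x ↦ x + tangentialField F x`. -/
noncomputable def radialRate (F : C2 → ℂ) (x : C2) : ℂ :=
  conj (F x) * fderiv ℂ F x x /
    (fderiv ℂ F x (perp x) * conj (fderiv ℂ F x (perp x)) + F x * conj (F x))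

theorem mul_conj_add_mul_conj_ne_zero {a b : ℂ} (h : b = 0 → a ≠ 0) :
    a * conj a + b * conj b ≠ 0 := by
  rw [Complex.mul_conj, Complex.mul_conj, ← Complex.ofReal_add, Complex.ofReal_ne_zero]
  have ha := Complex.normSq_nonneg a
  have hb := Complex.normSq_nonneg b
  intro h0
  have hb0 : b = 0 := Complex.normSq_eq_zero.1 (by linarith)
  exact h hb0 (Complex.normSq_eq_zero.1 (by linarith))

theorem inner_smul_perp (c : ℂ) (x : C2) : ⟪x, c • perp x⟫_ℝ = 0 := by
  simp [PiLp.inner_apply, Fin.sum_univ_two, perp, Complex.inner]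
  ring

theorem inner_tangentialField (F : C2 → ℂ) (x : C2) : ⟪x, tangentialField F x⟫_ℝ = 0 :=
  inner_smul_perp _ x

section TransverseEquation

variable {C : Set C2} {F : C2 → ℂ} {R : ℝ}

theorem contDiff_perp : ContDiff ℝ ω perp := by
  unfold perp
  rw [contDiff_piLp]
  intro i
  have h : ∀ j : Fin 2, ContDiff ℝ ω fun x : C2 => conj (x j) := fun j =>
    Complex.conjCLE.contDiff.comp (contDiff_piLp_apply 2 (i := j))
  fin_cases i
  · exact (h 1).neg
  · exact h 0

theorem IsTransverseEquation.denominator_ne_zero (hF : IsTransverseEquation C F R) {x : C2}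
    (hx : x ∈ ball (0 : C2) R \ {0}) :
    fderiv ℂ F x (perp x) * conj (fderiv ℂ F x (perp x)) + F x * conj (F x) ≠ 0 :=
  mul_conj_add_mul_conj_ne_zero fun h => hF.transverse x hx.1 hx.2 h

theorem IsTransverseEquation.fderiv_add_tangentialField (hF : IsTransverseEquation C F R) {x : C2}
    (hx : x ∈ ball (0 : C2) R \ {0}) :
    fderiv ℂ F x (x + tangentialField F x) = radialRate F x * F x := by
  have h := hF.denominator_ne_zero hx
  rw [map_add, tangentialField, map_smul, radialRate, smul_eq_mul]
  generalize hD : fderiv ℂ F x (perp x) * conj (fderiv ℂ F x (perp x)) + F x * conj (F x) = D at *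
  field_simp
  rw [← hD]
  ring

theorem IsTransverseEquation.contDiffOn_fderiv (hF : IsTransverseEquation C F R) {g : C2 → C2}
    (hg : ContDiff ℝ ω g) : ContDiffOn ℝ 1 (fun x => fderiv ℂ F x (g x)) (ball 0 R) := by
  have h : ContDiffOn ℝ 1 (fun x => fderiv ℝ F x (g x)) (ball 0 R) := fun x hx =>
    ((((hF.analyticAt x hx).contDiffAt (n := ω)).restrict_scalars ℝ).fderiv_right
      (m := 1) le_top |>.clm_apply (hg.contDiffAt.of_le le_top)).contDiffWithinAt
  refine h.congr fun x hx => ?_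
  rw [(hF.analyticAt x hx).differentiableAt.fderiv_restrictScalars ℝ]
  rfl

theorem IsTransverseEquation.contDiffOn (hF : IsTransverseEquation C F R) :
    ContDiffOn ℝ 1 F (ball 0 R) := fun x hx =>
  ((hF.analyticAt x hx).contDiffAt.restrict_scalars ℝ).contDiffWithinAt

theorem _root_.ContDiffOn.conj {E : Type*} [NormedAddCommGroup E] [NormedSpace ℝ E] {f : E → ℂ}
    {s : Set E} {n : ℕ∞ω} (hf : ContDiffOn ℝ n f s) : ContDiffOn ℝ n (fun x => conj (f x)) s :=
  Complex.conjCLE.contDiff.comp_contDiffOn hf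

theorem IsTransverseEquation.contDiffOn_denominator (hF : IsTransverseEquation C F R) :
    ContDiffOn ℝ 1 (fun x => fderiv ℂ F x (perp x) * conj (fderiv ℂ F x (perp x)) +
      F x * conj (F x)) (ball 0 R) :=
  ((hF.contDiffOn_fderiv contDiff_perp).mul (hF.contDiffOn_fderiv contDiff_perp).conj).add
    (hF.contDiffOn.mul hF.contDiffOn.conj)

theorem IsTransverseEquation.contDiffOn_tangentialField (hF : IsTransverseEquation C F R) :
    ContDiffOn ℝ 1 (tangentialField F) (ball 0 R \ {0}) := by
  have hsub : ball (0 : C2) R \ {0} ⊆ ball 0 R := Set.sdiff_subset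
  unfold tangentialField
  simp only [div_eq_mul_inv]
  refine ContDiffOn.smul (ContDiffOn.neg (ContDiffOn.mul (ContDiffOn.mul ?_ ?_)
    (ContDiffOn.inv ?_ fun x hx => hF.denominator_ne_zero hx)))
    (contDiff_perp.of_le le_top).contDiffOn
  · exact (hF.contDiffOn_fderiv contDiff_perp).conj.mono hsub
  · exact (hF.contDiffOn_fderiv contDiff_id).mono hsub
  · exact hF.contDiffOn_denominator.mono hsub

theorem IsTransverseEquation.continuousOn_radialRate (hF : IsTransverseEquation C F R) :
    ContinuousOn (radialRate F) (ball 0 R \ {0}) := by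
  have hsub : ball (0 : C2) R \ {0} ⊆ ball 0 R := Set.sdiff_subset
  refine ContinuousOn.div (ContinuousOn.mul ?_ ?_) ?_ fun x hx => hF.denominator_ne_zero hx
  · exact hF.contDiffOn.conj.continuousOn.mono hsub
  · exact (hF.contDiffOn_fderiv contDiff_id).continuousOn.mono hsub
  · exact hF.contDiffOn_denominator.continuousOn.mono hsub

/-- The zero set of `F` is invariant under the flow of `x ↦ x + tangentialField F x`. -/
theorem IsTransverseEquation.eq_zero_iff (hF : IsTransverseEquation C F R) {ε T : ℝ} (hε : 0 < ε)
    (hεR : ε < R) (hT : 0 ≤ T) {β : ℝ → C2}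
    (hβ : IsSphericalTrajectory (tangentialField F) ε T β) :
    F (Real.exp (-T) • β (-T)) = 0 ↔ F (β 0) = 0 := by
  set γ : ℝ → C2 := fun s => Real.exp s • β s with hγ
  have hmem : ∀ s ∈ Set.Icc (-T) 0, γ s ∈ ball (0 : C2) R \ {0} := by
    intro s hs
    have hn : ‖γ s‖ = Real.exp s * ε := by
      rw [hγ, norm_smul, (hβ s hs).2, Real.norm_of_nonneg (Real.exp_pos s).le]
    have h1 : Real.exp s ≤ 1 := Real.exp_le_one_iff.2 hs.2
    refine ⟨?_, ?_⟩
    · rw [mem_ball_zero_iff, hn]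
      nlinarith
    · exact norm_pos_iff.1 (hn ▸ by positivity)
  have hγd : ∀ s ∈ Set.Icc (-T) 0,
      HasDerivWithinAt γ (γ s + tangentialField F (γ s)) (Set.Icc (-T) 0) s := by
    intro s hs
    have h := (Real.hasDerivAt_exp s).hasDerivWithinAt.smul (hβ s hs).1
    rwa [smul_smul, ← Real.exp_add, add_neg_cancel, Real.exp_zero, one_smul, add_comm] at h
  have h := eq_zero_iff_of_hasDerivWithinAt_mul (a := -T) (b := 0) (by linarith)
    (φ := fun s => F (γ s)) (κ := fun s => radialRate F (γ s))
    (hF.continuousOn_radialRate.comp (fun s hs => (hγd s hs).continuousWithinAt) hmem) (by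
      intro s hs
      have h1 := ((hF.analyticAt _ (hmem s hs).1).differentiableAt.hasFDerivAt.restrictScalars
        ℝ).comp_hasDerivWithinAt s (hγd s hs)
      rw [← hF.fderiv_add_tangentialField (hmem s hs)]
      exact h1)
  simpa [hγ] using h

/-- The flow of the radial field corrected by `tangentialField F` gives a homeomorphism of the ball
which is the identity on its boundary and carries the cone over the link to the curve. -/
theorem IsTransverseEquation.exists_homeomorph (hF : IsTransverseEquation C F R) {ε : ℝ}
    (hε : 0 < ε) (hεR : ε < R) :
    ∃ k : closedBall (0 : C2) ε ≃ₜ closedBall (0 : C2) ε,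
      (∀ x : closedBall (0 : C2) ε, ‖(x : C2)‖ = ε → k x = x) ∧
      (∀ x, ‖(k x : C2)‖ = ‖(x : C2)‖) ∧
        ∀ x : closedBall (0 : C2) ε, (x : C2) ≠ 0 →
          ((k x : C2) ∈ C ↔ (ε / ‖(x : C2)‖) • (x : C2) ∈ C) := by
  have hX := hF.contDiffOn_tangentialField
  have ht : ∀ x ∈ ball (0 : C2) R \ {0}, ⟪x, tangentialField F x⟫_ℝ = 0 :=
    fun x _ => inner_tangentialField F x
  obtain ⟨k, hk⟩ := exists_isRadialFlow hε hεR hX ht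
  obtain ⟨h, hh⟩ := hk.exists_homeomorph hε hεR hX ht
  have hn : ∀ x : closedBall (0 : C2) ε, ‖(x : C2)‖ ≤ ε := fun x => mem_closedBall_zero_iff.1 x.2
  have hball : ∀ x : C2, ‖x‖ ≤ ε → x ∈ ball (0 : C2) R := fun x hx =>
    mem_ball_zero_iff.2 (hx.trans_lt hεR)
  refine ⟨h, fun x hx => Subtype.ext ((hh x).trans (hk.eq_self hε hx)), fun x => ?_,
    fun x hx => ?_⟩
  · rw [hh, hk.norm_eq hε (hn x)]
  · rw [hh, hF.mem_iff _ (hball _ ((hk.norm_eq hε (hn x)).trans_le (hn x))),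
      hF.mem_iff _ (hball _ (norm_div_norm_smul hε hx).le)]
    obtain ⟨β, hβ, hβ0, hβk⟩ := hk.2 x hx (hn x)
    have hpos := norm_pos_iff.2 hx
    have h1 := hF.eq_zero_iff hε hεR (log_div_norm_nonneg hx (hn x)) hβ
    rwa [Real.exp_neg, Real.exp_log (by positivity), inv_div, ← hβk, hβ0] at h1

/-- The link is not empty: it is the image of the nonzero points of the curve under the flow. -/
theorem IsTransverseEquation.exists_mem_sphere (hF : IsTransverseEquation C F R) {ε : ℝ}
    (hε : 0 < ε) (hεR : ε < R) : ∃ x : C2, ‖x‖ = ε ∧ x ∈ C := by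
  obtain ⟨k, -, hkn, hkC⟩ := hF.exists_homeomorph hε hεR
  have h1 : ∀ᶠ x in 𝓝[≠] (0 : C2), x ∈ closedBall (0 : C2) ε ∧ x ≠ 0 :=
    (Filter.Eventually.filter_mono nhdsWithin_le_nhds
      (closedBall_mem_nhds (0 : C2) hε)).and self_mem_nhdsWithin
  obtain ⟨x, hx, hxε, hx0⟩ := (hF.frequently.and_eventually h1).exists
  set y := k.symm ⟨x, hxε⟩ with hy
  have hky : (k y : C2) = x := by rw [hy, k.apply_symm_apply]
  have hy0 : (y : C2) ≠ 0 := norm_pos_iff.1 (by rw [← hkn, hky]; exact norm_pos_iff.2 hx0)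
  refine ⟨_, norm_div_norm_smul hε hy0, (hkC y hy0).1 ?_⟩
  rw [hky]
  exact (hF.mem_iff x (closedBall_subset_ball hεR hxε)).2 hx

end TransverseEquation

/-! ### The Alexander trick -/

section AlexanderTrick

variable {E : Type*} [NormedAddCommGroup E]

open Classical in
/-- The extension of a self-homeomorphism of the closed ball of radius `ε` by the identity. -/
noncomputable def extendById {ε : ℝ} (h : closedBall (0 : E) ε ≃ₜ closedBall (0 : E) ε) (x : E) :
    E :=
  if hx : x ∈ closedBall (0 : E) ε then h ⟨x, hx⟩ else x

variable {ε : ℝ} {h : closedBall (0 : E) ε ≃ₜ closedBall (0 : E) ε}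

theorem extendById_of_mem {x : E} (hx : x ∈ closedBall (0 : E) ε) :
    extendById h x = h ⟨x, hx⟩ := dif_pos hx

theorem extendById_of_notMem {x : E} (hx : x ∉ closedBall (0 : E) ε) : extendById h x = x :=
  dif_neg hx

theorem continuous_extendById (hh : ∀ x : closedBall (0 : E) ε, ‖(x : E)‖ = ε → h x = x) :
    Continuous (extendById h) := by
  have h1 : ContinuousOn (extendById h) (closedBall 0 ε) := by
    rw [continuousOn_iff_continuous_domRestrict]
    refine (continuous_subtype_val.comp h.continuous).congr fun x => ?_
    exact (extendById_of_mem x.2).symm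
  have h2 : ContinuousOn (extendById h) {x | ε ≤ ‖x‖} := by
    refine continuousOn_id.congr fun x hx => ?_
    by_cases hx' : x ∈ closedBall (0 : E) ε
    · rw [extendById_of_mem hx', hh ⟨x, hx'⟩ (le_antisymm (mem_closedBall_zero_iff.1 hx') hx), id]
    · exact extendById_of_notMem hx'
  have h3 := h1.union_of_isClosed h2 isClosed_closedBall
    (isClosed_le continuous_const continuous_norm)
  rw [← continuousOn_univ]
  refine h3.mono fun x _ => ?_
  rcases le_total ‖x‖ ε with hx | hx
  · exact Or.inl (mem_closedBall_zero_iff.2 hx)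
  · exact Or.inr hx

theorem injective_extendById : Function.Injective (extendById h) := by
  have key : ∀ x y : E, x ∈ closedBall (0 : E) ε → extendById h x = extendById h y → x = y := by
    intro x y hx hxy
    rw [extendById_of_mem hx] at hxy
    by_cases hy : y ∈ closedBall (0 : E) ε
    · rw [extendById_of_mem hy] at hxy
      exact congrArg Subtype.val (h.injective (Subtype.ext hxy))
    · rw [extendById_of_notMem hy] at hxy
      exact absurd (hxy ▸ (h ⟨x, hx⟩).2) hy
  intro x y hxy
  by_cases hx : x ∈ closedBall (0 : E) ε
  · exact key x y hx hxy
  by_cases hy : y ∈ closedBall (0 : E) ε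
  · exact (key y x hy hxy.symm).symm
  · rwa [extendById_of_notMem hx, extendById_of_notMem hy] at hxy

theorem norm_extendById_sub_le (x : E) : ‖extendById h x - x‖ ≤ 2 * |ε| := by
  by_cases hx : x ∈ closedBall (0 : E) ε
  · rw [extendById_of_mem hx]
    have h1 := mem_closedBall_zero_iff.1 hx
    have h2 := mem_closedBall_zero_iff.1 (h ⟨x, hx⟩).2
    have h3 := norm_sub_le (h ⟨x, hx⟩ : E) x
    have := le_abs_self ε
    linarith
  · rw [extendById_of_notMem hx, sub_self, norm_zero]
    positivity

variable [NormedSpace ℝ E]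

/-- The Alexander isotopy: for `s ≠ 0` this is `x ↦ s • H (s⁻¹ • x)`, where `H` is the extension
of `h` by the identity, and for `s = 0` it is the identity. -/
noncomputable def alexanderIsotopy (h : closedBall (0 : E) ε ≃ₜ closedBall (0 : E) ε)
    (p : ℝ × E) : E :=
  p.2 + p.1 • (extendById h (p.1⁻¹ • p.2) - p.1⁻¹ • p.2)

theorem alexanderIsotopy_zero (x : E) : alexanderIsotopy h (0, x) = x := by
  simp [alexanderIsotopy]

theorem alexanderIsotopy_of_ne_zero {s : ℝ} (hs : s ≠ 0) (x : E) :
    alexanderIsotopy h (s, x) = s • extendById h (s⁻¹ • x) := by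
  simp [alexanderIsotopy, smul_sub, smul_smul, hs]

theorem injective_alexanderIsotopy (s : ℝ) :
    Function.Injective fun x => alexanderIsotopy h (s, x) := by
  intro x y hxy
  by_cases hs : s = 0
  · subst hs
    simpa only [alexanderIsotopy_zero] using hxy
  · simp only [alexanderIsotopy_of_ne_zero hs] at hxy
    exact smul_right_injective E (inv_ne_zero hs)
      (injective_extendById (smul_right_injective E hs hxy))

theorem continuous_alexanderIsotopy
    (hh : ∀ x : closedBall (0 : E) ε, ‖(x : E)‖ = ε → h x = x) :
    Continuous (alexanderIsotopy h) := by
  have hH := continuous_extendById hh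
  rw [continuous_iff_continuousAt]
  rintro ⟨s, x⟩
  refine continuousAt_snd.add ?_
  by_cases hs : s = 0
  · subst hs
    rw [ContinuousAt, zero_smul, tendsto_zero_iff_norm_tendsto_zero]
    have h1 : Filter.Tendsto (fun p : ℝ × E => |p.1| * (2 * |ε|)) (𝓝 (0, x)) (𝓝 0) := by
      have h : Continuous fun p : ℝ × E => |p.1| * (2 * |ε|) := by fun_prop
      simpa using h.tendsto (0, x)
    refine squeeze_zero (fun _ => norm_nonneg _) (fun p => ?_) h1
    rw [norm_smul, Real.norm_eq_abs]
    gcongr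
    exact norm_extendById_sub_le _
  · have h1 : ContinuousAt (fun p : ℝ × E => p.1⁻¹ • p.2) (s, x) :=
      (continuousAt_fst.inv₀ hs).smul continuousAt_snd
    exact continuousAt_fst.smul ((hH.continuousAt.comp h1).sub h1)

end AlexanderTrick

/-- A self-homeomorphism of the ball which is the identity on the boundary preserves orientation:
since every stage of the Alexander isotopy is injective, it induces a homotopy from the identity to
the action on directions around a point. -/
theorem preservesOrientation_of_eq_self {ε : ℝ}
    {h : closedBall (0 : C2) ε ≃ₜ closedBall (0 : C2) ε}
    (hh : ∀ x : closedBall (0 : C2) ε, ‖(x : C2)‖ = ε → h x = x) : PreservesOrientation h := by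
  intro x δ hδ hx
  have hG := continuous_alexanderIsotopy hh
  set v : unitInterval × sphere (0 : C2) 1 → C2 := fun p =>
    alexanderIsotopy h ((p.1 : ℝ), x + δ • (p.2 : C2)) - alexanderIsotopy h ((p.1 : ℝ), x) with hv
  have hu : ∀ u : sphere (0 : C2) 1, ‖(u : C2)‖ = 1 := fun u => mem_sphere_zero_iff_norm.1 u.2
  have hvc : Continuous v := by
    refine (hG.comp ?_).sub (hG.comp ?_) <;> fun_prop
  have hv0 : ∀ p, ‖v p‖ ≠ 0 := by
    intro p
    refine norm_ne_zero_iff.2 (sub_ne_zero.2 fun h0 => ?_)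
    have h1 := injective_alexanderIsotopy _ h0
    have h2 : δ • (p.2 : C2) = 0 := by simpa using h1
    rcases smul_eq_zero.1 h2 with h3 | h3
    · exact hδ.ne' h3
    · have := hu p.2
      rw [h3, norm_zero] at this
      exact zero_ne_one this
  have hv_zero : ∀ u, v (0, u) = δ • (u : C2) := by
    intro u
    simp [hv, alexanderIsotopy_zero]
  have hv_one : ∀ u, v (1, u) = (h (nearPoint hδ hx u) : C2) - h (centrePoint hδ hx) := by
    intro u
    simp only [hv, Set.Icc.coe_one, alexanderIsotopy_of_ne_zero one_ne_zero, inv_one, one_smul]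
    exact congrArg₂ (· - ·) (extendById_of_mem (nearPoint hδ hx u).2)
      (extendById_of_mem (centrePoint hδ hx).2)
  have hmem : ∀ p, ‖v p‖⁻¹ • v p ∈ sphere (0 : C2) 1 := by
    intro p
    rw [mem_sphere_zero_iff_norm, norm_smul, norm_inv, norm_norm, inv_mul_cancel₀ (hv0 p)]
  let H : ContinuousMap.Homotopy (ContinuousMap.id _) (directionMap hδ hx h) :=
    { toFun := fun p => ⟨‖v p‖⁻¹ • v p, hmem p⟩
      continuous_toFun := ((hvc.norm.inv₀ hv0).smul hvc).subtype_mk hmem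
      map_zero_left := fun u => by
        apply Subtype.ext
        change ‖v (0, u)‖⁻¹ • v (0, u) = u
        rw [hv_zero, norm_smul, hu, mul_one, Real.norm_of_nonneg hδ.le, smul_smul,
          inv_mul_cancel₀ hδ.ne', one_smul]
      map_one_left := fun u => by
        apply Subtype.ext
        change ‖v (1, u)‖⁻¹ • v (1, u) = _
        rw [hv_one]
        rfl }
  have H' : TopCat.Homotopy (TopCat.ofHom (ContinuousMap.id _))
    (TopCat.ofHom (directionMap hδ hx h)) := H
  have h1 := H'.congr_homologyMap_singularChainComplexFunctor (ModuleCat.of ℤ ℤ) 3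
  unfold HasDegreeOne
  refine Eq.trans h1.symm ?_
  exact CategoryTheory.Functor.map_id
    ((AlgebraicTopology.singularHomologyFunctor (ModuleCat.{0} ℤ) 3).obj (ModuleCat.of ℤ ℤ))
    (TopCat.of (sphere (0 : C2) 1))

/-! ### Slice charts -/

section SliceCharts

variable {E F E' M N : Type} [NormedAddCommGroup E] [NormedSpace ℝ E] [NormedAddCommGroup F]
  [NormedSpace ℝ F] [NormedAddCommGroup E'] [NormedSpace ℝ E'] [TopologicalSpace M]
  {ι : N → M} {L : (E × F) ≃L[ℝ] E'}

/-- `φ` is a slice chart for the image of `ι`: in this chart the image of `ι` is the set where the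
coordinate in `F` vanishes. -/
def IsSliceChart (ι : N → M) (L : (E × F) ≃L[ℝ] E') (φ : OpenPartialHomeomorph M E') : Prop :=
  ∀ x ∈ φ.source, x ∈ Set.range ι ↔ (L.symm (φ x)).2 = 0

theorem IsSliceChart.apply_fst {φ : OpenPartialHomeomorph M E'} (h : IsSliceChart ι L φ) {q : N}
    (hq : ι q ∈ φ.source) : L ((L.symm (φ (ι q))).1, 0) = φ (ι q) := by
  rw [← (h _ hq).1 ⟨q, rfl⟩, Prod.mk.eta, L.apply_symm_apply]

theorem IsSliceChart.exists_eq_symm {φ : OpenPartialHomeomorph M E'} (h : IsSliceChart ι L φ)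
    {y : E} (hy : L (y, 0) ∈ φ.target) : ∃ q, ι q = φ.symm (L (y, 0)) :=
  (h _ (φ.map_target hy)).2 (by rw [φ.right_inv hy, L.symm_apply_apply])

theorem IsSliceChart.apply_invFun [Nonempty N] {φ : OpenPartialHomeomorph M E'}
    (h : IsSliceChart ι L φ) {y : E} (hy : L (y, 0) ∈ φ.target) :
    ι (Function.invFun ι (φ.symm (L (y, 0)))) = φ.symm (L (y, 0)) :=
  Function.invFun_eq (h.exists_eq_symm hy)

variable [TopologicalSpace N]

/-- The chart of the source of an embedding `ι` which a slice chart for the image of `ι`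
induces. -/
noncomputable def IsSliceChart.chart [Nonempty N] {φ : OpenPartialHomeomorph M E'}
    (h : IsSliceChart ι L φ) (hι : IsEmbedding ι) : OpenPartialHomeomorph N E where
  toFun q := (L.symm (φ (ι q))).1
  invFun y := Function.invFun ι (φ.symm (L (y, 0)))
  source := ι ⁻¹' φ.source
  target := {y | L (y, 0) ∈ φ.target}
  map_source' q hq := by
    rw [Set.mem_ofPred_eq, h.apply_fst hq]
    exact φ.map_source hq
  map_target' y hy := by
    rw [Set.mem_preimage, h.apply_invFun hy]
    exact φ.map_target hy
  left_inv' q hq := by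
    rw [h.apply_fst hq, φ.left_inv hq, Function.leftInverse_invFun hι.injective]
  right_inv' y hy := by
    rw [h.apply_invFun hy, φ.right_inv hy, L.symm_apply_apply]
  open_source := φ.open_source.preimage hι.continuous
  open_target := φ.open_target.preimage (by fun_prop)
  continuousOn_toFun :=
    (continuous_fst.comp L.symm.continuous).comp_continuousOn
      (φ.continuousOn.comp hι.continuous.continuousOn fun _ hq => hq)
  continuousOn_invFun := by
    rw [hι.continuousOn_iff]
    refine ContinuousOn.congr (f := fun y => φ.symm (L (y, 0))) ?_ fun y hy => h.apply_invFun hy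
    exact φ.continuousOn_symm.comp (by fun_prop) fun y hy => hy

variable [ChartedSpace E' M] {n : ℕ∞ω}

/-- An embedding whose image has slice charts of class `C^n` near each of its points is a `C^n`
embedding for a suitable manifold structure on its source. -/
theorem exists_isSmoothEmbedding_of_isSliceChart [IsManifold 𝓘(ℝ, E') n M] (hι : IsEmbedding ι)
    (hs : ∀ p : N, ∃ φ ∈ IsManifold.maximalAtlas 𝓘(ℝ, E') n M,
      ι p ∈ φ.source ∧ IsSliceChart ι L φ) :
    ∃ (_ : ChartedSpace E N) (_ : IsManifold 𝓘(ℝ, E) n N),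
      Manifold.IsSmoothEmbedding 𝓘(ℝ, E) 𝓘(ℝ, E') n ι := by
  choose φ hφ hp hsl using hs
  let ψ : N → OpenPartialHomeomorph N E := fun p =>
    haveI : Nonempty N := ⟨p⟩
    (hsl p).chart hι
  let cs : ChartedSpace E N :=
    { atlas := Set.range ψ
      chartAt := ψ
      mem_chart_source := fun p => hp p
      chart_mem_atlas := fun p => ⟨p, rfl⟩ }
  have hψ : ∀ p y, y ∈ (ψ p).target → ι ((ψ p).symm y) = (φ p).symm (L (y, 0)) := by
    intro p y hy
    have : Nonempty N := ⟨p⟩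
    exact (hsl p).apply_invFun hy
  have hm : IsManifold 𝓘(ℝ, E) n N := by
    refine isManifold_of_contDiffOn _ _ _ ?_
    rintro _ _ ⟨p, rfl⟩ ⟨q, rfl⟩
    have h1 := (IsManifold.compatible_of_mem_maximalAtlas (hφ p) (hφ q))
    rw [contDiffGroupoid, mem_groupoid_of_pregroupoid] at h1
    have h2 : ContDiffOn ℝ n ((φ p).symm.trans (φ q)) ((φ p).symm.trans (φ q)).source := by
      simpa [contDiffPregroupoid] using h1.1
    have h3 : ContDiffOn ℝ n (fun y : E => (L.symm ((φ p).symm.trans (φ q) (L (y, 0)))).1)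
        ((ψ p).symm.trans (ψ q)).source := by
      refine (contDiff_fst.comp L.symm.contDiff).comp_contDiffOn
        (h2.comp (L.contDiff.comp (by fun_prop)).contDiffOn fun y hy => ?_)
      refine ⟨hy.1, ?_⟩
      have h4 : ι ((ψ p).symm y) ∈ (φ q).source := hy.2
      rwa [hψ p y hy.1] at h4
    have h5 : ContDiffOn ℝ n ((ψ p).symm.trans (ψ q)) ((ψ p).symm.trans (ψ q)).source := by
      refine h3.congr fun y hy => ?_
      change (L.symm (φ q (ι ((ψ p).symm y)))).1 = _
      rw [hψ p y hy.1]
      rfl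
    simpa using h5
  refine ⟨cs, hm, ⟨F, inferInstance, inferInstance, fun p => ?_⟩, hι⟩
  refine Manifold.IsImmersionAtOfComplement.mk_of_charts L (ψ p) (φ p) (hp p) (hp p)
    (IsManifold.subset_maximalAtlas ⟨p, rfl⟩) (hφ p) subset_rfl ?_
  intro y hy
  have hy' : y ∈ (ψ p).target := by simpa using hy
  have h1 : φ p (ι ((ψ p).symm y)) = L (y, 0) := by
    rw [hψ p y hy']
    exact (φ p).right_inv hy'
  simpa using h1

end SliceCharts

/-! ### The link as a smoothly embedded manifold -/

/-- A surjective linear map is the second component of a linear isomorphism. -/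
theorem exists_continuousLinearEquiv_snd_eq {V W U : Type*} [NormedAddCommGroup V]
    [NormedSpace ℝ V] [FiniteDimensional ℝ V] [NormedAddCommGroup W] [NormedSpace ℝ W]
    [FiniteDimensional ℝ W] [NormedAddCommGroup U] [NormedSpace ℝ U] [FiniteDimensional ℝ U]
    {D : V →L[ℝ] W} (hD : Function.Surjective D)
    (hdim : Module.finrank ℝ V = Module.finrank ℝ U + Module.finrank ℝ W) :
    ∃ (P : V →L[ℝ] U) (A : V ≃L[ℝ] U × W), ∀ v, A v = (P v, D v) := by
  have hker : Module.finrank ℝ D.ker = Module.finrank ℝ U := by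
    have h1 := D.toLinearMap.finrank_range_add_finrank_ker
    rw [LinearMap.range_eq_top.2 hD, finrank_top] at h1
    change _ + Module.finrank ℝ D.ker = _ at h1
    omega
  obtain ⟨Q, hQ⟩ := D.ker_closedComplemented_of_finiteDimensional_range
  let i : D.ker ≃L[ℝ] U := ContinuousLinearEquiv.ofFinrankEq hker
  let P : V →L[ℝ] U := (i : D.ker →L[ℝ] U).comp Q
  have hinj : Function.Injective (P.prod D) := by
    rw [injective_iff_map_eq_zero]
    intro v hv
    have h1 : P v = 0 := congrArg Prod.fst hv
    have h2 : D v = 0 := congrArg Prod.snd hv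
    have h3 : Q v = 0 := i.injective (h1.trans (map_zero i).symm)
    have h4 := hQ ⟨v, h2⟩
    rw [h3] at h4
    exact (congrArg Subtype.val h4).symm
  let A := LinearMap.linearEquivOfInjective (P.prod D : V →ₗ[ℝ] U × W) hinj
    (by rw [hdim, Module.finrank_prod])
  exact ⟨P, A.toContinuousLinearEquiv, fun v => rfl⟩

theorem mem_contDiffGroupoid_of_contDiffOn {V : Type*} [NormedAddCommGroup V] [NormedSpace ℝ V]
    {n : ℕ∞ω} {e : OpenPartialHomeomorph V V} (h : ContDiffOn ℝ n e e.source)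
    (h' : ContDiffOn ℝ n e.symm e.target) : e ∈ contDiffGroupoid n 𝓘(ℝ, V) := by
  rw [contDiffGroupoid, mem_groupoid_of_pregroupoid]
  simpa [contDiffPregroupoid] using And.intro h h'

/-- A submersion is a coordinate projection in suitable local coordinates. -/
theorem exists_straightening {V W U : Type*} [NormedAddCommGroup V]
    [NormedSpace ℝ V] [FiniteDimensional ℝ V] [NormedAddCommGroup W] [NormedSpace ℝ W]
    [FiniteDimensional ℝ W] [NormedAddCommGroup U] [NormedSpace ℝ U] [FiniteDimensional ℝ U]
    (L : (U × W) ≃L[ℝ] V) {G : V → W} {a : V} (hG : ContDiffAt ℝ ω G a)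
    (hD : Function.Surjective (fderiv ℝ G a)) :
    ∃ e ∈ contDiffGroupoid ω 𝓘(ℝ, V), a ∈ e.source ∧ ∀ x, (L.symm (e x)).2 = G x := by
  have : CompleteSpace V := FiniteDimensional.complete ℝ V
  have hdim : Module.finrank ℝ V = Module.finrank ℝ U + Module.finrank ℝ W := by
    rw [← L.toLinearEquiv.finrank_eq, Module.finrank_prod]
  obtain ⟨P, A, hA⟩ := exists_continuousLinearEquiv_snd_eq (U := U) hD hdim
  have hf : ContDiffAt ℝ ω (fun x => L (P x, G x)) a :=
    L.contDiff.contDiffAt.comp a (P.contDiff.contDiffAt.prodMk hG)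
  have hf' : HasFDerivAt (fun x => L (P x, G x)) ((A.trans L : V ≃L[ℝ] V) : V →L[ℝ] V) a := by
    have h := L.hasFDerivAt.comp a
      (P.hasFDerivAt.prodMk (hG.differentiableAt (by simp)).hasFDerivAt)
    convert! h using 1
    ext v
    exact congrArg L (hA v)
  let e := hf.toOpenPartialHomeomorph _ hf' (by simp)
  have he : ∀ x, e x = L (P x, G x) := fun x => rfl
  have hω : ω ≠ (∞ : ℕ∞ω) := by simp
  have hsymm : ContDiffAt ℝ ω e.symm (e a) := hf.to_localInverse hf' (by simp)
  refine ⟨e.restrContDiff ℝ ω hω, mem_contDiffGroupoid_of_contDiffOn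
    (e.contDiffOn_restrContDiff_source ℝ hω) (e.contDiffOn_restrContDiff_target ℝ hω),
    ⟨hf.mem_toOpenPartialHomeomorph_source hf' (by simp), hf, hsymm⟩, fun x => ?_⟩
  change (L.symm (e x)).2 = G x
  rw [he, L.symm_apply_apply]

theorem trans_mem_maximalAtlas {H M : Type*} [TopologicalSpace H] [TopologicalSpace M]
    [ChartedSpace H M] {𝒢 : StructureGroupoid H} [HasGroupoid M 𝒢]
    {c : OpenPartialHomeomorph M H} (hc : c ∈ 𝒢.maximalAtlas M) {e : OpenPartialHomeomorph H H}
    (he : e ∈ 𝒢) : c.trans e ∈ 𝒢.maximalAtlas M := by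
  intro e' he'
  have h := hc e' he'
  constructor
  · rw [OpenPartialHomeomorph.trans_symm_eq_symm_trans_symm, OpenPartialHomeomorph.trans_assoc]
    exact 𝒢.trans (𝒢.symm he) h.1
  · rw [← OpenPartialHomeomorph.trans_assoc]
    exact 𝒢.trans h.2 he

/-- The derivative of a parametrization of the sphere by a chart has the tangent space as range. -/
theorem range_fderiv_chartAt_symm (p : sphere (0 : C2) 1) :
    (fderiv ℝ (fun y => ((chartAt (EuclideanSpace ℝ (Fin 3)) p).symm y : C2))
      (chartAt (EuclideanSpace ℝ (Fin 3)) p p)).range = (Submodule.span ℝ {(p : C2)})ᗮ := by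
  have h := range_mvfderiv_subtypeVal (n := 3) p
  rw [((contMDiff_coe_sphere p).mdifferentiableAt one_ne_zero).mvfderiv] at h
  simp only [fderivWithin_univ, mfld_simps] at h
  exact h

theorem contDiffAt_chartAt_symm (p : sphere (0 : C2) 1) :
    ContDiffAt ℝ ω (fun y => ((chartAt (EuclideanSpace ℝ (Fin 3)) p).symm y : C2))
      (chartAt (EuclideanSpace ℝ (Fin 3)) p p) := by
  have h : ContMDiffOn (𝓡 3) 𝓘(ℝ, C2) ω
      (fun y => ((chartAt (EuclideanSpace ℝ (Fin 3)) p).symm y : C2))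
      (chartAt (EuclideanSpace ℝ (Fin 3)) p).target :=
    contMDiff_coe_sphere.comp_contMDiffOn (contMDiffOn_chart_symm (I := 𝓡 3))
  exact h.contDiffOn.contDiffAt ((chartAt _ p).open_target.mem_nhds (mem_chart_target _ p))

theorem isEmbedding_toUnitSphere {ε : ℝ} (hε : 0 < ε) : IsEmbedding (toUnitSphere hε) := by
  have hc : Continuous (toUnitSphere hε) := by
    refine Continuous.subtype_mk ?_ _
    fun_prop
  refine (hc.isClosedEmbedding fun p q hpq => Subtype.ext ?_).isEmbedding
  exact smul_right_injective C2 (inv_ne_zero hε.ne') (congrArg Subtype.val hpq)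

/-- The restriction of a transverse equation to the sphere of radius `ε`, read in a chart of the
unit sphere, is a submersion at each zero: the tangent space contains the complex line spanned by
`perp x`, on which the differential of `F` is onto. -/
theorem IsTransverseEquation.surjective_fderiv {C : Set C2} {F : C2 → ℂ} {R : ℝ}
    (hF : IsTransverseEquation C F R) {ε : ℝ} (hε : 0 < ε) (hεR : ε < R) {p : sphere (0 : C2) 1}
    (hp : F (ε • (p : C2)) = 0) :
    ContDiffAt ℝ ω (fun y => F (ε • ((chartAt (EuclideanSpace ℝ (Fin 3)) p).symm y : C2)))
        (chartAt (EuclideanSpace ℝ (Fin 3)) p p) ∧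
      Function.Surjective (fderiv ℝ
        (fun y => F (ε • ((chartAt (EuclideanSpace ℝ (Fin 3)) p).symm y : C2)))
        (chartAt (EuclideanSpace ℝ (Fin 3)) p p)) := by
  set c := chartAt (EuclideanSpace ℝ (Fin 3)) p
  have hcp : c.symm (c p) = p := c.left_inv (mem_chart_source _ p)
  have hn : ‖(p : C2)‖ = 1 := mem_sphere_zero_iff_norm.1 p.2
  have hx : ε • (p : C2) ∈ ball (0 : C2) R := by
    rwa [mem_ball_zero_iff, norm_smul, hn, mul_one, Real.norm_of_nonneg hε.le]
  have hx0 : ε • (p : C2) ≠ 0 := smul_ne_zero hε.ne' (norm_pos_iff.1 (by rw [hn]; exact one_pos))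
  have hσ := contDiffAt_chartAt_symm p
  have hFa : AnalyticAt ℂ F (ε • (c.symm (c p) : C2)) := by
    rw [hcp]
    exact hF.analyticAt _ hx
  refine ⟨(hFa.contDiffAt.restrict_scalars ℝ).comp (c p) (hσ.const_smul ε), fun z => ?_⟩
  have hd := (hFa.differentiableAt.hasFDerivAt.restrictScalars ℝ).comp (c p)
    ((hσ.differentiableAt (by simp)).hasFDerivAt.const_smul ε)
  have ha := hF.transverse _ hx hx0 hp
  set x := ε • (p : C2) with hxdef
  set u : C2 := ε⁻¹ • (z / fderiv ℂ F x (perp x)) • perp x with hu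
  have hmem : u ∈ (Submodule.span ℝ {(p : C2)})ᗮ := by
    rw [Submodule.mem_orthogonal_singleton_iff_inner_right, hu, inner_smul_right]
    have h1 := inner_smul_perp (z / fderiv ℂ F x (perp x)) x
    nth_rewrite 1 [hxdef] at h1
    rw [real_inner_smul_left] at h1
    rw [(mul_eq_zero.1 h1).resolve_left hε.ne', mul_zero]
  rw [← range_fderiv_chartAt_symm p] at hmem
  obtain ⟨v, hv⟩ := hmem
  refine ⟨v, ?_⟩
  have h2 := DFunLike.congr_fun hd.fderiv v
  refine h2.trans ?_
  change fderiv ℂ F (ε • (c.symm (c p) : C2)) (ε • fderiv ℝ (fun y => (c.symm y : C2)) (c p) v) = z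
  have hv' : fderiv ℝ (fun y => (c.symm y : C2)) (c p) v = u := hv
  rw [hv', hcp, hu, smul_inv_smul₀ hε.ne', map_smul, smul_eq_mul, div_mul_cancel₀ _ ha]

/-- The link of the curve is a smoothly embedded manifold of dimension one. -/
theorem IsTransverseEquation.isSmoothlyEmbeddedOneManifold {C : Set C2} {F : C2 → ℂ} {R : ℝ}
    (hF : IsTransverseEquation C F R) {ε : ℝ} (hε : 0 < ε) (hεR : ε < R) :
    IsSmoothlyEmbeddedOneManifold hε {p : sphere (0 : C2) ε | (p : C2) ∈ C} := by
  let L : (EuclideanSpace ℝ (Fin 1) × ℂ) ≃L[ℝ] EuclideanSpace ℝ (Fin 3) :=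
    ContinuousLinearEquiv.ofFinrankEq (by
      rw [Module.finrank_prod, finrank_euclideanSpace_fin, finrank_euclideanSpace_fin,
        Complex.finrank_real_complex])
  have hball : ∀ x : sphere (0 : C2) 1, ε • (x : C2) ∈ ball (0 : C2) R := by
    intro x
    rwa [mem_ball_zero_iff, norm_smul, mem_sphere_zero_iff_norm.1 x.2, mul_one,
      Real.norm_of_nonneg hε.le]
  have hrange : ∀ x : sphere (0 : C2) 1,
      x ∈ Set.range (fun p : {p : sphere (0 : C2) ε | (p : C2) ∈ C} => toUnitSphere hε p) ↔
        F (ε • (x : C2)) = 0 := by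
    intro x
    rw [← hF.mem_iff _ (hball x)]
    constructor
    · rintro ⟨q, rfl⟩
      change ε • ε⁻¹ • ((q : sphere (0 : C2) ε) : C2) ∈ C
      rw [smul_inv_smul₀ hε.ne']
      exact q.2
    · intro hx
      refine ⟨⟨⟨ε • (x : C2), ?_⟩, hx⟩, Subtype.ext (inv_smul_smul₀ hε.ne' _)⟩
      rw [mem_sphere_zero_iff_norm, norm_smul, mem_sphere_zero_iff_norm.1 x.2, mul_one,
        Real.norm_of_nonneg hε.le]
  refine exists_isSmoothEmbedding_of_isSliceChart (L := L)
    ((isEmbedding_toUnitSphere hε).comp IsEmbedding.subtypeVal) fun q => ?_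
  set p := toUnitSphere hε q
  set c := chartAt (EuclideanSpace ℝ (Fin 3)) p
  obtain ⟨h1, h2⟩ := hF.surjective_fderiv hε hεR ((hrange p).1 ⟨q, rfl⟩)
  obtain ⟨e, he, hea, heG⟩ := exists_straightening L h1 h2
  refine ⟨c.trans e, trans_mem_maximalAtlas (IsManifold.chart_mem_maximalAtlas p)
    (contDiffGroupoid_le le_top he), ⟨mem_chart_source _ p, hea⟩, fun x hx => ?_⟩
  refine (hrange x).trans ?_
  change _ ↔ (L.symm (e (c x))).2 = 0
  rw [heG, c.left_inv hx.1]

/-! ### The homeomorphism onto the cone -/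

/-- If a norm-preserving homeomorphism `k` of the ball carries the union of the radial segments over
the link to the curve, then `k⁻¹` induces a homeomorphism of pairs from the ball to the cone. -/
theorem image_trans_coneHomeoBall_symm {C : Set C2} {ε : ℝ} (hε : 0 < ε) (h0 : (0 : C2) ∈ C)
    (hne : ∃ x : C2, ‖x‖ = ε ∧ x ∈ C) {k : closedBall (0 : C2) ε ≃ₜ closedBall (0 : C2) ε}
    (hk : ∀ x, ‖(k x : C2)‖ = ‖(x : C2)‖)
    (hkC : ∀ x : closedBall (0 : C2) ε, (x : C2) ≠ 0 →
      ((k x : C2) ∈ C ↔ (ε / ‖(x : C2)‖) • (x : C2) ∈ C)) :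
    k.symm.trans (coneHomeoBall hε).symm '' {q | (q : C2) ∈ C} =
      subCone ε {p : sphere (0 : C2) ε | (p : C2) ∈ C} := by
  have hpre : k.symm.trans (coneHomeoBall hε).symm '' {q | (q : C2) ∈ C} =
      {c | (k (coneHomeoBall hε c) : C2) ∈ C} := by
    rw [Homeomorph.image_eq_preimage_symm]
    rfl
  rw [hpre]
  have key : ∀ p : sphere (0 : C2) ε × Set.Icc (0 : ℝ) ε, (p.2 : ℝ) < ε →
      ((k (coneHomeoBall hε (Cone.mk p)) : C2) ∈ C ↔ (p.1 : C2) ∈ C) := by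
    intro p hp
    have hn : ‖(coneHomeoBall hε (Cone.mk p) : C2)‖ = ε - p.2 := norm_coneToBall_mk hε p
    have hv : (coneHomeoBall hε (Cone.mk p) : C2) = (1 - (p.2 : ℝ) / ε) • (p.1 : C2) := rfl
    have hpos : 0 < ε - p.2 := sub_pos.2 hp
    rw [hkC _ (norm_pos_iff.1 (hn ▸ hpos)), hn, hv, smul_smul]
    have h1 : ε / (ε - p.2) * (1 - (p.2 : ℝ) / ε) = 1 := by
      field_simp
    rw [h1, one_smul]
  ext c
  obtain ⟨p, rfl⟩ : ∃ p, Cone.mk p = c := Quotient.exists_rep c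
  rw [Set.mem_ofPred_eq]
  rcases p.2.2.2.lt_or_eq with hp | hp
  · rw [key p hp]
    constructor
    · exact fun h => ⟨p, ⟨h, trivial⟩, rfl⟩
    · rintro ⟨q, ⟨hq, -⟩, hqp⟩
      rcases Quotient.exact hqp with h | ⟨-, h⟩
      · rwa [← h]
      · exact absurd h hp.ne
  · -- At the apex both sides hold: the curve passes through the origin, the link is not empty.
    have hz : (k (coneHomeoBall hε (Cone.mk p)) : C2) = 0 := by
      rw [← norm_eq_zero, hk]
      exact (norm_coneToBall_mk hε p).trans (by rw [hp, sub_self])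
    obtain ⟨x, hx, hxC⟩ := hne
    refine iff_of_true (by rwa [hz]) ⟨(⟨x, mem_sphere_zero_iff_norm.2 hx⟩, p.2), ⟨hxC, trivial⟩, ?_⟩
    exact Quotient.sound (Or.inr ⟨hp, hp⟩)

end PlaneCurve

theorem mainTheorem5 (C : Set PlaneCurve.C2) (hC : PlaneCurve.IsCurveRepresentative C) :
    ∃ ε₀ : ℝ, 0 < ε₀ ∧ ∀ (ε : ℝ) (hε : 0 < ε), ε < ε₀ →
      PlaneCurve.IsSmoothlyEmbeddedOneManifold hε
        {p : Metric.sphere (0 : PlaneCurve.C2) ε | (p : PlaneCurve.C2) ∈ C} ∧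
      ∃ Φ : Metric.closedBall (0 : PlaneCurve.C2) ε ≃ₜ
          PlaneCurve.Cone (Metric.sphere (0 : PlaneCurve.C2) ε) ε,
        Φ '' {q : Metric.closedBall (0 : PlaneCurve.C2) ε | (q : PlaneCurve.C2) ∈ C} =
          PlaneCurve.subCone ε {p : Metric.sphere (0 : PlaneCurve.C2) ε | (p : PlaneCurve.C2) ∈ C} ∧
        PlaneCurve.PreservesOrientationToCone hε Φ := by
  obtain ⟨F, R, hR, hF⟩ := hC.exists_isTransverseEquation
  refine ⟨R, hR, fun ε hε hεR => ⟨hF.isSmoothlyEmbeddedOneManifold hε hεR, ?_⟩⟩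
  obtain ⟨k, hk1, hkn, hkC⟩ := hF.exists_homeomorph hε hεR
  refine ⟨k.symm.trans (PlaneCurve.coneHomeoBall hε).symm,
    PlaneCurve.image_trans_coneHomeoBall_symm hε
      ((hF.mem_iff 0 (Metric.mem_ball_self hR)).2 hF.map_zero) (hF.exists_mem_sphere hε hεR)
      hkn hkC, ?_⟩
  have hΦ : (k.symm.trans (PlaneCurve.coneHomeoBall hε).symm).trans
      (PlaneCurve.coneHomeoBall hε) = k.symm := by
    ext x
    simp
  rw [PlaneCurve.PreservesOrientationToCone, hΦ]
  refine PlaneCurve.preservesOrientation_of_eq_self fun x hx => ?_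
  rw [Homeomorph.symm_apply_eq, hk1 x hx]
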